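/- **Setting.** Let $\theta$ be a non-negative integer-valued random variable with $E\theta^3<\infty$, let $\theta_j$, $j\in\mathbb Z$, be copies of $\theta$, and for $j\in\mathbb Z$, $k\ge 1$ let $\rho^j_k=(\rho^j_{k,1},\dots,\rho^j_{k,k})$ be a random vector with values in $[j,j+1)^k$, such that $(\theta_j,(\rho^j_k)_{k\ge1})$, $j\in\mathbb Z$, are independent. Fix $\alpha\in(0,2]$ and let $\vartheta^{j,n}$, $j\in\mathbb Z$, $n\ge 1$, be independent standard symmetric $\alpha$-stable Lévy processes ($\vartheta^{j,n}_0=0$, $E e^{iu\vartheta^{j,n}_t}=e^{-t|u|^\alpha}$), independent of all $\theta_j,\rho^j_k$. For $T>0$ let $$N^T_t=\sum_{j\in\mathbb Z}\sum_{n=1}^{\theta_j}\delta_{\frac1T\rho^j_{\theta_j,n}+\vartheta^{j,n}_t},\qquad \langle X_T(t),\psi\rangle=\frac{\langle N^T_t,\psi\rangle-E\langle N^T_t,\psi\rangle}{\sqrt T},$$ where $\langle\mu,\psi\rangle=\int\psi\,d\mu$. Let $\mathcal T_t\varphi=p_t*\varphi$ for $t>0$, where $p_t(x)=\frac1{2\pi}\int_{\mathbb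 R}\cos(xy)\,e^{-t|y|^\alpha}dy$ is the transition density of the stable process, and $\mathcal T_0\varphi=\varphi$. A *density process* is a centered Gaussian process $X=(X(t))_{t\ge0}$ with values in the space $\mathcal S'$ of tempered distributions on $\mathbb R$ (that is, all the $\langle X(t),\varphi\rangle$, $t\ge 0$, $\varphi\in\mathcal S$, are jointly centered Gaussian) with covariance functional $$E\langle X(s),\varphi\rangle\langle X(t),\psi\rangle=E\theta\int_{\mathbb R}\varphi(x)\,\mathcal T_{|t-s|}\psi(x)\,dx+(\operatorname{Var}\theta-E\theta)\int_{\mathbb R}\mathcal T_s\varphi(x)\,\mathcal T_t\psi(x)\,dx,\qquad \varphi,\psi\in\mathcal S.$$ **Proposition.** Let $\Psi=(\psi_t)_{t\ge0}$ be any family of bounded, compactly supported functions on $\mathbb R$, each of them piecewise continuous (continuous except at finitely many points). 1. For all $T>0$ and $t\ge0$, almost surely $\psi_t$ is integrable with respect to $N^T_1$, and $\langle N_1^T,\psi_t\rangle$ is an integrable random variable. 2. There exists a centered Gaussian process $\varrho^\Psi=(\varrho^\Psi_t)_{t\ge0}$ with covariance $$E\varrho^\Psi_s\varrho^\Psi_t=E\theta\int_{\mathbb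 R}\psi_s(x)\psi_t(x)\,dx+(\operatorname{Var}\theta-E\theta)\int_{\mathbb R}\psi_s(x)\,\mathcal T_2\psi_t(x)\,dx,\qquad s,t\ge0,\tag{$*$}$$ and for every such process $(\langle X_T(1),\psi_t\rangle)_{t\ge0}$ converges to $\varrho^\Psi$ as $T\to\infty$ in the sense of weak convergence of finite-dimensional distributions. 3. Let $X$ be a density process. For each $t\ge 0$ the random variable $\langle X(1),\psi_t\rangle$ is well defined by $L^2$-approximation: there is an a.s. unique square integrable random variable, denoted $\langle X(1),\psi_t\rangle$, such that $\langle X(1),\varphi_n\rangle\to\langle X(1),\psi_t\rangle$ in $L^2$ of the underlying probability space for every sequence $\varphi_n\in\mathcal S$ with $\varphi_n\to\psi_t$ in $L^2(\mathbb R,dx)$. The process $(\langle X(1),\psi_t\rangle)_{t\ge0}$ is centered Gaussian with covariance $(*)$, and $(\langle X_T(1),\psi_t\rangle)_{t\ge0}$ converges to it as $T\to\infty$ in the sense of weak convergence of finite-dimensional distributions. -/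

import Mathlib

open MeasureTheory ProbabilityTheory Filter Topology
open scoped NNReal SchwartzMap

noncomputable section

namespace DensityProcess

/-! ### Symmetric stable Lévy motion and its semigroup -/

/-- Right-continuous paths with left limits (at `t = 0` the filter `𝓝[<] t` is trivial, so that
only right-continuity is required there). -/
def IsCadlag (f : ℝ≥0 → ℝ) : Prop :=
  ∀ t, ContinuousWithinAt f (Set.Ici t) t ∧ ∃ l, Tendsto f (𝓝[<] t) (𝓝 l)

/-- `L` is a standard symmetric `α`-stable Lévy process: it starts from `0`, has independent and
stationary increments with `E exp (i u (L t - L s)) = exp (-(t - s) |u| ^ α)` and càdlàg paths. -/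
structure IsStableLevy {Ω : Type*} [MeasurableSpace Ω] (α : ℝ) (L : ℝ≥0 → Ω → ℝ)
    (P : Measure Ω) : Prop where
  measurable : ∀ t, Measurable (L t)
  zero : ∀ᵐ ω ∂P, L 0 ω = 0
  indep_increments : HasIndepIncrements L P
  charFun_increment : ∀ s t : ℝ≥0, s ≤ t → ∀ u : ℝ,
    charFun (P.map (fun ω => L t ω - L s ω)) u
      = ((Real.exp (-(((t : ℝ) - (s : ℝ)) * |u| ^ α)) : ℝ) : ℂ)
  cadlag : ∀ᵐ ω ∂P, IsCadlag (fun t => L t ω)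

/-- The transition density `p_t(x)` (for `t > 0`) of the standard symmetric `α`-stable Lévy
process, i.e. the inverse Fourier transform of `y ↦ exp (-t |y| ^ α)`. -/
def stableDensity (α t x : ℝ) : ℝ :=
  (2 * Real.pi)⁻¹ * (∫ y : ℝ, Real.cos (x * y) * Real.exp (-(t * |y| ^ α)))

/-- The semigroup `𝒯_t φ = p_t * φ` for `t > 0`, with `𝒯_0` the identity. -/
def stableSemigroup (α t : ℝ) (φ : ℝ → ℝ) (x : ℝ) : ℝ :=
  if t = 0 then φ x else ∫ y : ℝ, stableDensity α t (x - y) * φ y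

/-! ### The particle system -/

/-- The random ingredients of the particle system.  `θ j` is the number of particles attached to
the integer `j`, with `P (θ j = k) = p k` and `E θ ^ 3 < ∞`; `ρ j k` is a random vector with values
in `[j, j + 1) ^ k` which gives the positions (before scaling) if `θ j = k`; the pairs
`(θ j, (ρ j k)_k)` are independent for different `j` (no independence is required between the two
components of one pair).  The `ϑ j n` are independent standard symmetric `α`-stable Lévy processes,
independent of the initial configuration. -/
structure IsParticleSystem {Ω : Type*} [MeasurableSpace Ω] (α : ℝ) (p : PMF ℕ)
    (θ : ℤ → Ω → ℕ) (ρ : ℤ → (k : ℕ) → Fin k → Ω → ℝ) (ϑ : ℤ → ℕ → ℝ≥0 → Ω → ℝ)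
    (P : Measure Ω) : Prop where
  third_moment : Integrable (fun k : ℕ => (k : ℝ) ^ 3) p.toMeasure
  measurable_number : ∀ j, Measurable (θ j)
  law_number : ∀ j, P.map (θ j) = p.toMeasure
  measurable_position : ∀ j k n, Measurable (ρ j k n)
  position_mem : ∀ (j : ℤ) (k : ℕ) (n : Fin k) (ω : Ω), ρ j k n ω ∈ Set.Ico (j : ℝ) ((j : ℝ) + 1)
  indep_initial :
    iIndepFun (fun (j : ℤ) (ω : Ω) =>
      ((θ j ω, fun k n => ρ j k n ω) : ℕ × ((k : ℕ) → Fin k → ℝ))) P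
  levy : ∀ j n, IsStableLevy α (ϑ j n) P
  indep_motion : iIndepFun (fun (q : ℤ × ℕ) (ω : Ω) => fun t : ℝ≥0 => ϑ q.1 q.2 t ω) P
  indep_initial_motion :
    IndepFun
      (fun ω => ((fun j => (θ j ω, fun k n => ρ j k n ω)) :
        ℤ → ℕ × ((k : ℕ) → Fin k → ℝ)))
      (fun ω => ((fun q t => ϑ q.1 q.2 t ω) : ℤ × ℕ → ℝ≥0 → ℝ)) P

section System

variable {Ω : Type*}
  (θ : ℤ → Ω → ℕ) (ρ : ℤ → (k : ℕ) → Fin k → Ω → ℝ) (ϑ : ℤ → ℕ → ℝ≥0 → Ω → ℝ)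

/-- The empirical measure `N_t^T`: the sum of the unit masses at the positions at time `t` of the
particles which started from the points `ρ j (θ j) n / T`, `n = 1, …, θ j`, `j ∈ ℤ`. -/
def empirical (T : ℝ) (t : ℝ≥0) (ω : Ω) : Measure ℝ :=
  Measure.sum fun j : ℤ => ∑ n : Fin (θ j ω),
    Measure.dirac (ρ j (θ j ω) n ω / T + ϑ j (n : ℕ) t ω)

/-- `⟨N_t^T, ψ⟩`. -/
def empiricalPairing (T : ℝ) (t : ℝ≥0) (ψ : ℝ → ℝ) (ω : Ω) : ℝ :=
  ∫ x, ψ x ∂(empirical θ ρ ϑ T t ω)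

/-- `⟨X_T(t), ψ⟩ = (⟨N_t^T, ψ⟩ - E ⟨N_t^T, ψ⟩) / √T`. -/
def fluctuation [MeasurableSpace Ω] (P : Measure Ω) (T : ℝ) (t : ℝ≥0) (ψ : ℝ → ℝ) (ω : Ω) : ℝ :=
  (empiricalPairing θ ρ ϑ T t ψ ω - ∫ ω', empiricalPairing θ ρ ϑ T t ψ ω' ∂P) / Real.sqrt T

end System

/-! ### Test functions, Gaussian limits and convergence -/

/-- Bounded, piecewise continuous, compactly supported functions: `ψ` is continuous except at
finitely many points. -/
structure IsTestFunction (ψ : ℝ → ℝ) : Prop where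
  bounded : ∃ C, ∀ x, |ψ x| ≤ C
  piecewise_continuous : {x | ¬ ContinuousAt ψ x}.Finite
  compact_support : HasCompactSupport ψ

/-- `E θ`, where `θ` has distribution `p`. -/
def meanNumber (p : PMF ℕ) : ℝ := ∫ k : ℕ, (k : ℝ) ∂p.toMeasure

/-- `Var θ`, where `θ` has distribution `p`. -/
def varNumber (p : PMF ℕ) : ℝ := Var[fun k : ℕ => (k : ℝ); p.toMeasure]

/-- The covariance functional of the density process. -/
def densityCov (α : ℝ) (p : PMF ℕ) (s t : ℝ≥0) (φ ψ : ℝ → ℝ) : ℝ :=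
  meanNumber p * (∫ x, φ x * stableSemigroup α |(t : ℝ) - (s : ℝ)| ψ x)
    + (varNumber p - meanNumber p) * (∫ x, stableSemigroup α s φ x * stableSemigroup α t ψ x)

/-- The covariance function of the limit process attached to a family of test functions. -/
def limitCov (α : ℝ) (p : PMF ℕ) (ψ : ℝ≥0 → ℝ → ℝ) (s t : ℝ≥0) : ℝ :=
  meanNumber p * (∫ x, ψ s x * ψ t x)
    + (varNumber p - meanNumber p) * (∫ x, ψ s x * stableSemigroup α 2 (ψ t) x)

/-- `ϱ` is a centered Gaussian process with covariance function `K`. -/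
structure IsCenteredGaussian {Ω S : Type*} [MeasurableSpace Ω] (ϱ : S → Ω → ℝ) (K : S → S → ℝ)
    (Q : Measure Ω) : Prop where
  gaussian : IsGaussianProcess ϱ Q
  centered : ∀ s, ∫ ω, ϱ s ω ∂Q = 0
  covariance : ∀ s t, ∫ ω, ϱ s ω * ϱ t ω ∂Q = K s t

/-- `X` is a density process: a centered Gaussian process with values in the space of tempered
distributions (the topological dual of the Schwartz space) whose covariance functional is
`E ⟨X(s), φ⟩ ⟨X(t), ψ⟩ = densityCov α p s t φ ψ`. -/
def IsDensityProcess {Ω : Type*} [MeasurableSpace Ω] (α : ℝ) (p : PMF ℕ)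
    (X : ℝ≥0 → Ω → (𝓢(ℝ, ℝ) →L[ℝ] ℝ)) (Q : Measure Ω) : Prop :=
  IsCenteredGaussian (fun (q : ℝ≥0 × 𝓢(ℝ, ℝ)) ω => X q.1 ω q.2)
    (fun q r => densityCov α p q.1 r.1 q.2 r.2) Q

/-- `Y` is the random variable `⟨X, ψ⟩` defined by `L²`-approximation: `⟨X, φ_n⟩ → Y` in `L²(Q)`
whenever the Schwartz functions `φ_n` converge to `ψ` in `L²` of the Lebesgue measure. -/
structure IsL2Pairing {Ω : Type*} [MeasurableSpace Ω] (X : Ω → (𝓢(ℝ, ℝ) →L[ℝ] ℝ))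
    (ψ : ℝ → ℝ) (Y : Ω → ℝ) (Q : Measure Ω) : Prop where
  memLp : MemLp Y 2 Q
  tendsto : ∀ φ : ℕ → 𝓢(ℝ, ℝ),
    Tendsto (fun n => eLpNorm (fun x => φ n x - ψ x) 2 volume) atTop (𝓝 0) →
    Tendsto (fun n => eLpNorm (fun ω => X ω (φ n) - Y ω) 2 Q) atTop (𝓝 0)

/-- Weak convergence of the finite-dimensional distributions of the processes `Y T`, as
`T → ∞`, to those of `Z`. -/
def FDDTendsto {Ω Ω' S : Type*} [MeasurableSpace Ω] [MeasurableSpace Ω'] (Y : ℝ → S → Ω → ℝ)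
    (Z : S → Ω' → ℝ) (P : Measure Ω) (Q : Measure Ω') [IsProbabilityMeasure P]
    [IsProbabilityMeasure Q] : Prop :=
  ∀ I : Finset S, TendstoInDistribution (fun (T : ℝ) ω => I.restrict (fun s => Y T s ω)) atTop
    (fun ω => I.restrict (fun s => Z s ω)) (fun _ => P) Q

end DensityProcess

end

/-!
For fixed `T` the pairing `⟨N_1^T, f⟩` is the sum over `j ∈ ℤ` of the contributions
`S_j = ∑_{n < θ_j} f (ρ_{j,n} / T + ϑ_1^{j,n})` of the integers (`clusterSum`), and these are
independent. The theorem is therefore a central limit theorem for a triangular array.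

Write `𝒯 f (x) = E f (x + ϑ_1)` (`transition`). Conditioning on the initial data
of `j` gives, with `x_n = ρ_{j,n} / T`,
`E S_j² = E [∑ (𝒯 (f²) (x_n) - (𝒯 f (x_n))²) + (∑ 𝒯 f (x_n))²]` and
`E S_j = E ∑ 𝒯 f (x_n)`. As `|x_n - j / T| ≤ 1 / T` and `𝒯` maps test functions to continuous ones
(the stable law has no atoms), the variance of `S_j` is, for `j = ⌊T u⌋` and `T → ∞`, close to
`E θ · 𝒯 (f²) (u) + (Var θ - E θ) (𝒯 f (u))²`. A sum over `j ∈ ℤ` divided by `T` is the integral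
over `u` of the term with `j = ⌊T u⌋` (`hasSum_div_integral_floor`), and if `f` vanishes outside
`[-R, R]`, the absolute moments of `S_j` up to order three are, for `T ≥ 1`, dominated by a multiple
of `P (|u + ϑ_1| ≤ R + 1)` (`ballProb`), which is integrable in `u`. By dominated convergence the
variance of `⟨X_T(1), f⟩` tends to
`E θ ∫ f² + (Var θ - E θ) ∫ (𝒯 f)²` (`tendsto_integral_variance_clusterSum`), while the Lyapunov sum
of third moments is `O(T ^ (-1 / 2))`; this gives the convergence of characteristic functions
(`norm_integral_cexp_hasSum_sub_exp_le`, `tendsto_integral_cexp_hasSum_clusterSum`). Linear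
combinations of pairings are pairings with linear combinations of test functions, so the Cramér–Wold
device (`fddTendsto_of_integral_cexp`) covers all the finite-dimensional distributions. The same
domination yields the integrability of `f` with respect to `N_1^T`.

Fourier inversion identifies `stableDensity` with the density of `ϑ_1` and of the sum of two
independent copies, so that `stableSemigroup` is `𝒯` at time `1` and `𝒯_2 = 𝒯 ∘ 𝒯` at time `2`,
and by symmetry `∫ (𝒯 f) (𝒯 g) = ∫ f · 𝒯_2 g` (`limitCov_eq_transitionCov`).

The limit process exists because its covariance is the Gram matrix of vectors in
`L²(P_{ϑ_1} ⊗ dx)` (`exists_isCenteredGaussian_transitionCov`), and every Gram matrix is the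
covariance of an isonormal Gaussian process (`exists_isCenteredGaussian_inner`). Finally `𝒯` is a
contraction of `L²(dx)`, which makes `φ ↦ ⟨X(1), φ⟩` Lipschitz from `L²(dx)` to `L²` of the
probability space; it extends by density of the Schwartz functions, and `L²`-limits of Gaussian
processes are Gaussian (`IsDensityProcess.isCenteredGaussian_of_isL2Pairing`).
-/

namespace DensityProcess

/-! ### Inversion of the stable characteristic function -/

section Inversion

open FourierTransform

lemma integrable_exp_neg_mul_abs_rpow {α t : ℝ} (hα : 0 < α) (ht : 0 < t) :
    Integrable fun y : ℝ => Real.exp (-(t * |y| ^ α)) := by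
  have h : IntegrableOn (fun y : ℝ => Real.exp (-(t * |y| ^ α))) (Set.Ioi 0) := by
    refine (integrableOn_rpow_mul_exp_neg_mul_rpow (s := 0) (by norm_num) hα ht).congr_fun ?_
      measurableSet_Ioi
    intro x hx
    simp [abs_of_pos (Set.mem_Ioi.1 hx)]
  have h' : IntegrableOn (fun y : ℝ => Real.exp (-(t * |y| ^ α))) (Set.Iic 0) := by
    rw [integrableOn_Iic_iff_integrableOn_Iio]
    have h2 := (Measure.measurePreserving_neg (volume : Measure ℝ)).integrableOn_comp_preimage
      (Homeomorph.neg ℝ).measurableEmbedding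
      (f := fun y : ℝ => Real.exp (-(t * |y| ^ α))) (s := Set.Ioi 0)
    have h3 := h2.2 h
    simpa [Function.comp_def] using h3
  rw [← integrableOn_univ, ← Set.Iic_union_Ioi (a := (0 : ℝ))]
  exact h'.union h

lemma stableDensity_neg (α t x : ℝ) : stableDensity α t (-x) = stableDensity α t x := by
  simp [stableDensity]

lemma continuous_stableDensity {α t : ℝ} (hα : 0 < α) (ht : 0 < t) :
    Continuous (stableDensity α t) := by
  refine continuous_const.mul ?_
  refine continuous_of_dominated (bound := fun y => Real.exp (-(t * |y| ^ α))) ?_ ?_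
    (integrable_exp_neg_mul_abs_rpow hα ht) ?_
  · intro x
    have := (integrable_exp_neg_mul_abs_rpow hα ht).aestronglyMeasurable
    exact (by fun_prop : Continuous fun y : ℝ => Real.cos (x * y)).aestronglyMeasurable.mul this
  · intro x
    refine ae_of_all _ fun y => ?_
    rw [norm_mul, Real.norm_of_nonneg (Real.exp_nonneg _)]
    exact mul_le_of_le_one_left (Real.exp_nonneg _) (Real.abs_cos_le_one _)
  · exact ae_of_all _ fun y => by fun_prop

/-- The stable density as a Fourier transform in Mathlib's normalization. -/
lemma stableDensity_eq_fourier {α t : ℝ} (hα : 0 < α) (ht : 0 < t) (x : ℝ) :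
    (stableDensity α t x : ℂ)
      = 𝓕 (fun y : ℝ => ((Real.exp (-(t * |2 * Real.pi * y| ^ α)) : ℝ) : ℂ)) x := by
  have hI := integrable_exp_neg_mul_abs_rpow hα ht
  rw [Real.fourier_real_eq_integral_exp_smul]
  have h1 := Measure.integral_comp_mul_left
    (fun y : ℝ => Complex.exp (((-(y * x) : ℝ) : ℂ) * Complex.I) *
      ((Real.exp (-(t * |y| ^ α)) : ℝ) : ℂ)) (2 * Real.pi)
  have h2 : ∀ v : ℝ, Complex.exp (((-2 * Real.pi * v * x : ℝ) : ℂ) * Complex.I) •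
      ((Real.exp (-(t * |2 * Real.pi * v| ^ α)) : ℝ) : ℂ)
      = Complex.exp (((-(2 * Real.pi * v * x) : ℝ) : ℂ) * Complex.I) *
      ((Real.exp (-(t * |2 * Real.pi * v| ^ α)) : ℝ) : ℂ) := by
    intro v; simp
  simp_rw [h2, h1]
  have hint : Integrable (fun y : ℝ => Complex.exp (((-(y * x) : ℝ) : ℂ) * Complex.I) *
    ((Real.exp (-(t * |y| ^ α)) : ℝ) : ℂ)) := by
    refine hI.ofReal.bdd_mul (c := 1) ?_ (ae_of_all _ fun y => (Complex.norm_exp_ofReal_mul_I _).le)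
    exact (by fun_prop : Continuous _).aestronglyMeasurable
  rw [abs_of_pos (by positivity), stableDensity, Complex.real_smul, Complex.ofReal_mul]
  congr 1
  apply Complex.ext
  · rw [Complex.ofReal_re, ← RCLike.re_eq_complex_re, ← integral_re hint]
    congr 1 with y
    rw [RCLike.re_eq_complex_re, Complex.re_mul_ofReal, Complex.exp_ofReal_mul_I_re,
      Real.cos_neg, mul_comm y]
  · rw [Complex.ofReal_im, ← RCLike.im_eq_complex_im, ← integral_im hint]
    have h3 : ∀ y : ℝ, RCLike.im (Complex.exp (((-(y * x) : ℝ) : ℂ) * Complex.I) *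
    ((Real.exp (-(t * |y| ^ α)) : ℝ) : ℂ)) = -(Real.sin (y * x) * Real.exp (-(t * |y| ^ α))) := by
      intro y
      rw [RCLike.im_eq_complex_im, Complex.im_mul_ofReal, Complex.exp_ofReal_mul_I_im, Real.sin_neg]
      ring
    simp_rw [h3]
    have h4 := integral_neg_eq_self
      (fun y : ℝ => -(Real.sin (y * x) * Real.exp (-(t * |y| ^ α)))) volume
    simp only [neg_mul, Real.sin_neg, abs_neg, neg_neg, integral_neg] at h4 ⊢
    linarith

/-- Testing a probability measure with stable characteristic function against a Schwartz function:
by Fourier inversion this is the same as integrating against the stable density. -/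
lemma integral_schwartz_eq_integral_stableDensity {α t : ℝ} (hα : 0 < α) (ht : 0 < t)
    (ν : Measure ℝ) [IsProbabilityMeasure ν]
    (hν : ∀ u, charFun ν u = ((Real.exp (-(t * |u| ^ α)) : ℝ) : ℂ)) (f : 𝓢(ℝ, ℂ)) :
    ∫ x, f x ∂ν = ∫ x, f x * (stableDensity α t x : ℂ) := by
  have hI := integrable_exp_neg_mul_abs_rpow hα ht
  have hW : Integrable fun y : ℝ => ((Real.exp (-(t * |2 * Real.pi * y| ^ α)) : ℝ) : ℂ) :=
    (hI.comp_mul_left' (by positivity : (2 * Real.pi) ≠ 0)).ofReal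
  simp_rw [stableDensity_eq_fourier hα ht]
  have h1 := VectorFourier.integral_fourierIntegral_smul_eq_flip (L := innerₗ ℝ)
    (μ := volume) (ν := volume) Real.continuous_fourierChar continuous_inner f.integrable hW
  have h1' : ∫ x, 𝓕 (f : ℝ → ℂ) x * ((Real.exp (-(t * |2 * Real.pi * x| ^ α)) : ℝ) : ℂ) =
     ∫ x, f x * 𝓕 (fun y : ℝ => ((Real.exp (-(t * |2 * Real.pi * y| ^ α)) : ℝ) : ℂ)) x := by
    simpa using! h1
  rw [← h1']
  have h2 := VectorFourier.integral_fourierIntegral_smul_eq_flip (L := innerₗ ℝ)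
    (μ := volume) (ν := ν) Real.continuous_fourierChar continuous_inner (𝓕⁻ f).integrable
    (integrable_const (1 : ℂ))
  have h2' : ∫ x, 𝓕 (𝓕⁻ f) x ∂ν
      = ∫ x, 𝓕⁻ f x * ((Real.exp (-(t * |2 * Real.pi * x| ^ α)) : ℝ) : ℂ) := by
    have h3 : ∀ x : ℝ,
        VectorFourier.fourierIntegral Real.fourierChar ν (innerₗ ℝ).flip (fun _ => (1 : ℂ)) x
          = ((Real.exp (-(t * |2 * Real.pi * x| ^ α)) : ℝ) : ℂ) := by
      intro x
      rw [← abs_neg, ← hν, charFun_apply]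
      simp only [VectorFourier.fourierIntegral, Real.fourierChar_apply', Circle.smul_def,
        Circle.coe_exp, LinearMap.flip_apply, innerₗ_apply_apply]
      congr 1 with y
      simp
      ring_nf
    simp_rw [h3] at h2
    simp only [smul_eq_mul, mul_one] at h2
    exact h2
  rw [FourierTransform.fourier_fourierInv_eq] at h2'
  rw [h2', ← integral_neg_eq_self]
  congr 1 with x
  rw [SchwartzMap.fourierInv_coe, Real.fourierInv_eq_fourier_neg, neg_neg]
  simp only [mul_neg, abs_neg]

lemma integral_contDiff_eq_integral_stableDensity {α t : ℝ} (hα : 0 < α) (ht : 0 < t)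
    (ν : Measure ℝ) [IsProbabilityMeasure ν]
    (hν : ∀ u, charFun ν u = ((Real.exp (-(t * |u| ^ α)) : ℝ) : ℂ)) {g : ℝ → ℝ}
    (hg : HasCompactSupport g) (hg' : ContDiff ℝ ((⊤ : ℕ∞) : WithTop ℕ∞) g) :
    ∫ x, g x ∂ν = ∫ x, g x * stableDensity α t x := by
  have h1 : HasCompactSupport (fun x => (g x : ℂ)) := hg.comp_left Complex.ofReal_zero
  have h2 : ContDiff ℝ ((⊤ : ℕ∞) : WithTop ℕ∞) (fun x => (g x : ℂ)) :=
    Complex.ofRealCLM.contDiff.comp hg'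
  have h3 := integral_schwartz_eq_integral_stableDensity hα ht ν hν (h1.toSchwartzMap h2)
  have h4 : ∀ x, (h1.toSchwartzMap h2) x = (g x : ℂ) := fun x => rfl
  simp_rw [h4, ← Complex.ofReal_mul] at h3
  rw [integral_complex_ofReal, integral_complex_ofReal] at h3
  exact_mod_cast h3

/-- A smooth bump function equal to `1` on `[a, b]`, which tends to the indicator of `[a, b]` as
`n → ∞`. -/
noncomputable def intervalBump (a b : ℝ) (hab : a ≤ b) (n : ℕ) : ContDiffBump ((a + b) / 2) where
  rIn := (b - a) / 2 + 1 / ((n : ℝ) + 1)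
  rOut := (b - a) / 2 + 1 / ((n : ℝ) + 1) + 1 / ((n : ℝ) + 1)
  rIn_pos := by
    have : (0 : ℝ) < 1 / ((n : ℝ) + 1) := by positivity
    linarith
  rIn_lt_rOut := by
    have : (0 : ℝ) < 1 / ((n : ℝ) + 1) := by positivity
    linarith

lemma tendsto_intervalBump (a b : ℝ) (hab : a ≤ b) (x : ℝ) :
    Tendsto (fun n => intervalBump a b hab n x) atTop
      (𝓝 ((Set.Icc a b).indicator (fun _ => (1 : ℝ)) x)) := by
  have hI : Set.Icc a b = Metric.closedBall ((a + b) / 2) ((b - a) / 2) := by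
    rw [Real.closedBall_eq_Icc]; congr 1 <;> ring
  by_cases hx : x ∈ Set.Icc a b
  · rw [Set.indicator_of_mem hx]
    refine tendsto_const_nhds.congr fun n => ?_
    refine ((intervalBump a b hab n).one_of_mem_closedBall ?_).symm
    rw [hI, Metric.mem_closedBall] at hx
    have : (0 : ℝ) < 1 / ((n : ℝ) + 1) := by positivity
    exact Metric.mem_closedBall.2 (hx.trans (by simp only [intervalBump]; linarith))
  · rw [Set.indicator_of_notMem hx]
    rw [hI, Metric.mem_closedBall, not_le] at hx
    have h1 : Tendsto (fun n : ℕ => (b - a) / 2 + 1 / ((n : ℝ) + 1) + 1 / ((n : ℝ) + 1)) atTop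
        (𝓝 ((b - a) / 2)) := by
      simpa using (tendsto_const_nhds.add tendsto_one_div_add_atTop_nhds_zero_nat).add
        (tendsto_one_div_add_atTop_nhds_zero_nat (𝕜 := ℝ))
    refine tendsto_const_nhds.congr' ?_
    filter_upwards [h1.eventually (gt_mem_nhds hx)] with n hn
    exact ((intervalBump a b hab n).zero_of_le_dist hn.le).symm

lemma setIntegral_stableDensity_Icc {α t : ℝ} (hα : 0 < α) (ht : 0 < t)
    (ν : Measure ℝ) [IsProbabilityMeasure ν]
    (hν : ∀ u, charFun ν u = ((Real.exp (-(t * |u| ^ α)) : ℝ) : ℂ)) {a b : ℝ} (hab : a ≤ b) :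
    ∫ x in Set.Icc a b, stableDensity α t x = ν.real (Set.Icc a b) := by
  have hc := continuous_stableDensity hα ht
  have h1 : Tendsto (fun n => ∫ x, intervalBump a b hab n x ∂ν) atTop
      (𝓝 (∫ x, (Set.Icc a b).indicator (fun _ => (1 : ℝ)) x ∂ν)) := by
    refine tendsto_integral_of_dominated_convergence (fun _ => 1)
      (fun n => (intervalBump a b hab n).continuous.aestronglyMeasurable) (integrable_const _) ?_
      (ae_of_all _ (tendsto_intervalBump a b hab))
    refine fun n => ae_of_all _ fun x => ?_
    rw [Real.norm_of_nonneg (intervalBump a b hab n).nonneg]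
    exact (intervalBump a b hab n).le_one
  have h2 : Tendsto (fun n => ∫ x, intervalBump a b hab n x * stableDensity α t x) atTop
      (𝓝 (∫ x, (Set.Icc a b).indicator (fun _ => (1 : ℝ)) x * stableDensity α t x)) := by
    refine tendsto_integral_of_dominated_convergence
      ((Set.Icc (a - 2) (b + 2)).indicator fun x => |stableDensity α t x|)
      (fun n => ((intervalBump a b hab n).continuous.mul hc).aestronglyMeasurable) ?_ ?_
      (ae_of_all _ fun x => (tendsto_intervalBump a b hab x).mul_const _)
    · exact (integrable_indicator_iff measurableSet_Icc).2
        (hc.abs.continuousOn.integrableOn_compact isCompact_Icc)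
    · refine fun n => ae_of_all _ fun x => ?_
      rw [norm_mul, Real.norm_of_nonneg (intervalBump a b hab n).nonneg, Real.norm_eq_abs]
      by_cases hx : x ∈ Set.Icc (a - 2) (b + 2)
      · rw [Set.indicator_of_mem hx]
        exact mul_le_of_le_one_left (abs_nonneg _) (intervalBump a b hab n).le_one
      · rw [Set.indicator_of_notMem hx, (intervalBump a b hab n).zero_of_le_dist, zero_mul]
        have h3 : (1 : ℝ) / ((n : ℝ) + 1) ≤ 1 := by
          rw [div_le_one (by positivity)]; linarith [(Nat.cast_nonneg n : (0 : ℝ) ≤ n)]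
        by_contra! hlt
        refine hx ?_
        have h4 : x ∈ Metric.closedBall ((a + b) / 2) ((b - a) / 2 + 2) := by
          refine Metric.mem_closedBall.2 (hlt.le.trans ?_)
          simp only [intervalBump]; linarith
        rw [Real.closedBall_eq_Icc] at h4
        exact ⟨by linarith [h4.1], by linarith [h4.2]⟩
  have h3 : (fun n => ∫ x, intervalBump a b hab n x ∂ν)
      = fun n => ∫ x, intervalBump a b hab n x * stableDensity α t x := by
    ext n
    exact integral_contDiff_eq_integral_stableDensity hα ht ν hν
      (intervalBump a b hab n).hasCompactSupport (intervalBump a b hab n).contDiff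
  rw [h3] at h1
  have h4 := tendsto_nhds_unique h1 h2
  rw [integral_indicator_const _ measurableSet_Icc, smul_eq_mul, mul_one] at h4
  rw [h4, ← integral_indicator measurableSet_Icc]
  congr 1 with x
  by_cases hx : x ∈ Set.Icc a b <;> simp [hx]

lemma stableDensity_nonneg {α t : ℝ} (hα : 0 < α) (ht : 0 < t)
    (ν : Measure ℝ) [IsProbabilityMeasure ν]
    (hν : ∀ u, charFun ν u = ((Real.exp (-(t * |u| ^ α)) : ℝ) : ℂ)) (x : ℝ) :
    0 ≤ stableDensity α t x := by
  by_contra! hx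
  have hc := continuous_stableDensity hα ht
  -- a negative value would give a short interval of negative measure
  obtain ⟨ε, hε, hball⟩ := Metric.eventually_nhds_iff_ball.1
    (hc.continuousAt.eventually (gt_mem_nhds hx))
  have hlt : x - ε / 2 < x + ε / 2 := by linarith
  have h1 : ∫ y in (x - ε / 2)..(x + ε / 2), -stableDensity α t y > 0 := by
    refine intervalIntegral.intervalIntegral_pos_of_pos_on (hc.neg.intervalIntegrable _ _) ?_ hlt
    intro y hy
    have := hball y (by rw [Real.ball_eq_Ioo]; exact ⟨by linarith [hy.1], by linarith [hy.2]⟩)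
    linarith
  have h2 := setIntegral_stableDensity_Icc hα ht ν hν hlt.le
  rw [integral_Icc_eq_integral_Ioc, ← intervalIntegral.integral_of_le hlt.le] at h2
  rw [intervalIntegral.integral_neg, h2] at h1
  linarith [measureReal_nonneg (μ := ν) (s := Set.Icc (x - ε / 2) (x + ε / 2))]

/-- The inversion formula: the probability measure with characteristic function
`exp (-t |u| ^ α)` has the density `stableDensity α t`. -/
theorem eq_withDensity_stableDensity {α t : ℝ} (hα : 0 < α) (ht : 0 < t)
    (ν : Measure ℝ) [IsProbabilityMeasure ν]
    (hν : ∀ u, charFun ν u = ((Real.exp (-(t * |u| ^ α)) : ℝ) : ℂ)) :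
    ν = volume.withDensity fun x => ENNReal.ofReal (stableDensity α t x) := by
  refine Measure.ext_of_Icc _ _ fun a b hab => ?_
  rw [withDensity_apply _ measurableSet_Icc, ← ofReal_integral_eq_lintegral_ofReal,
    setIntegral_stableDensity_Icc hα ht ν hν hab, ofReal_measureReal]
  · exact (continuous_stableDensity hα ht).continuousOn.integrableOn_compact isCompact_Icc
  · exact ae_of_all _ (stableDensity_nonneg hα ht ν hν)

end Inversion

/-- The operator `f ↦ (x ↦ E f (x + Y))`, where `Y` has distribution `ν`. -/
noncomputable def transition (ν : Measure ℝ) (f : ℝ → ℝ) (x : ℝ) : ℝ := ∫ y, f (x + y) ∂ν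

lemma stableSemigroup_eq_transition {α t : ℝ} (hα : 0 < α) (ht : 0 < t)
    (ν : Measure ℝ) [IsProbabilityMeasure ν]
    (hν : ∀ u, charFun ν u = ((Real.exp (-(t * |u| ^ α)) : ℝ) : ℂ)) (f : ℝ → ℝ) :
    stableSemigroup α t f = transition ν f := by
  ext x
  rw [stableSemigroup, if_neg ht.ne', transition, eq_withDensity_stableDensity hα ht ν hν,
    integral_withDensity_eq_integral_toReal_smul
      (continuous_stableDensity hα ht).measurable.ennreal_ofReal
      (ae_of_all _ fun _ => ENNReal.ofReal_lt_top)]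
  rw [← integral_add_left_eq_self _ x]
  congr 1 with y
  rw [ENNReal.toReal_ofReal (stableDensity_nonneg hα ht ν hν y), smul_eq_mul,
    show x - (x + y) = -y by ring, stableDensity_neg]

lemma nullSingletonClass_of_charFun {α t : ℝ} (hα : 0 < α) (ht : 0 < t)
    (ν : Measure ℝ) [IsProbabilityMeasure ν]
    (hν : ∀ u, charFun ν u = ((Real.exp (-(t * |u| ^ α)) : ℝ) : ℂ)) : NullSingletonClass ν := by
  rw [eq_withDensity_stableDensity hα ht ν hν]
  exact ⟨fun x => withDensity_absolutelyContinuous _ _ (measure_singleton x)⟩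

lemma map_neg_eq_self_of_charFun {α t : ℝ} (ν : Measure ℝ) [IsProbabilityMeasure ν]
    (hν : ∀ u, charFun ν u = ((Real.exp (-(t * |u| ^ α)) : ℝ) : ℂ)) :
    ν.map (fun x => -x) = ν := by
  have : IsProbabilityMeasure (ν.map (fun x => -x)) :=
    Measure.isProbabilityMeasure_map (by fun_prop)
  refine Measure.ext_of_charFun ?_
  ext u
  have h := charFun_map_mul (μ := ν) (-1) u
  simp only [neg_mul, one_mul] at h
  rw [h, hν, hν, abs_neg]

lemma charFun_conv_self {α t : ℝ} (ν : Measure ℝ) [IsProbabilityMeasure ν]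
    (hν : ∀ u, charFun ν u = ((Real.exp (-(t * |u| ^ α)) : ℝ) : ℂ)) (u : ℝ) :
    charFun (ν ∗ ν) u = ((Real.exp (-((2 * t) * |u| ^ α)) : ℝ) : ℂ) := by
  rw [charFun_conv, hν, ← Complex.ofReal_mul, ← Real.exp_add]
  congr 3
  ring

/-! ### Convergence in `L²` and characteristic functions -/

section L2

variable {Ω : Type*} [MeasurableSpace Ω] {Q : Measure Ω}

lemma inner_toLp_eq_integral {u v : Ω → ℝ} (hu : MemLp u 2 Q) (hv : MemLp v 2 Q) :
    inner ℝ (hu.toLp u : Lp ℝ 2 Q) (hv.toLp v) = ∫ ω, u ω * v ω ∂Q := by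
  rw [L2.inner_def]
  refine integral_congr_ae ?_
  filter_upwards [hu.coeFn_toLp, hv.coeFn_toLp] with ω h1 h2
  rw [h1, h2]
  simp [mul_comm]

lemma tendsto_integral_mul_of_tendsto_eLpNorm {ι : Type*} {l : Filter ι} {f g : ι → Ω → ℝ}
    {f' g' : Ω → ℝ}
    (hf : ∀ n, MemLp (f n) 2 Q) (hg : ∀ n, MemLp (g n) 2 Q) (hf' : MemLp f' 2 Q)
    (hg' : MemLp g' 2 Q) (hff' : Tendsto (fun n => eLpNorm (fun ω => f n ω - f' ω) 2 Q) l (𝓝 0))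
    (hgg' : Tendsto (fun n => eLpNorm (fun ω => g n ω - g' ω) 2 Q) l (𝓝 0)) :
    Tendsto (fun n => ∫ ω, f n ω * g n ω ∂Q) l (𝓝 (∫ ω, f' ω * g' ω ∂Q)) := by
  have h1 : Tendsto (fun n => (hf n).toLp (f n)) l (𝓝 (hf'.toLp f')) :=
    (Lp.tendsto_Lp_iff_tendsto_eLpNorm'' _ _ _ _).2 hff'
  have h2 : Tendsto (fun n => (hg n).toLp (g n)) l (𝓝 (hg'.toLp g')) :=
    (Lp.tendsto_Lp_iff_tendsto_eLpNorm'' _ _ _ _).2 hgg'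
  simpa only [inner_toLp_eq_integral] using Filter.Tendsto.inner (𝕜 := ℝ) h1 h2

lemma integrable_cexp_mul_I [IsFiniteMeasure Q] {Y : Ω → ℝ} (hY : AEStronglyMeasurable Y Q) :
    Integrable (fun ω => Complex.exp (Y ω * Complex.I)) Q := by
  refine Integrable.of_bound (C := 1) ?_ (ae_of_all _ fun ω => (Complex.norm_exp_ofReal_mul_I _).le)
  have hc : Continuous fun x : ℝ => Complex.exp (x * Complex.I) := by fun_prop
  exact hc.comp_aestronglyMeasurable hY

lemma norm_cexp_mul_I_sub_le (a b : ℝ) :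
    ‖Complex.exp (a * Complex.I) - Complex.exp (b * Complex.I)‖ ≤ |a - b| := by
  have h : Complex.exp (a * Complex.I) - Complex.exp (b * Complex.I)
      = Complex.exp (b * Complex.I) * (Complex.exp (Complex.I * ((a - b : ℝ) : ℂ)) - 1) := by
    rw [mul_sub, ← Complex.exp_add, mul_one]
    congr 2
    push_cast; ring
  rw [h, norm_mul, Complex.norm_exp_ofReal_mul_I, one_mul]
  exact Real.norm_exp_I_mul_ofReal_sub_one_le

lemma tendsto_integral_cexp_of_tendsto_eLpNorm [IsProbabilityMeasure Q] {ι : Type*} {l : Filter ι}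
    {Y : ι → Ω → ℝ} {Z : Ω → ℝ}
    (hY : ∀ n, MemLp (Y n) 2 Q) (hZ : MemLp Z 2 Q)
    (h : Tendsto (fun n => eLpNorm (fun ω => Y n ω - Z ω) 2 Q) l (𝓝 0)) :
    Tendsto (fun n => ∫ ω, Complex.exp (Y n ω * Complex.I) ∂Q) l
      (𝓝 (∫ ω, Complex.exp (Z ω * Complex.I) ∂Q)) := by
  have hi : ∀ n, MemLp (fun ω => Y n ω - Z ω) 2 Q := fun n => (hY n).sub hZ
  have h1 : Tendsto (fun n => (eLpNorm (fun ω => Y n ω - Z ω) 2 Q).toReal) l (𝓝 0) := by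
    simpa [Function.comp_def] using (ENNReal.tendsto_toReal ENNReal.zero_ne_top).comp h
  rw [tendsto_iff_norm_sub_tendsto_zero]
  refine squeeze_zero (fun _ => norm_nonneg _) (fun n => ?_) h1
  rw [← integral_sub (integrable_cexp_mul_I (hY n).1) (integrable_cexp_mul_I hZ.1)]
  calc ‖∫ ω, (Complex.exp (Y n ω * Complex.I) - Complex.exp (Z ω * Complex.I)) ∂Q‖
      ≤ ∫ ω, ‖Y n ω - Z ω‖ ∂Q := by
        refine norm_integral_le_of_norm_le ((hi n).integrable (by norm_num)).norm ?_
        exact ae_of_all _ fun ω => norm_cexp_mul_I_sub_le _ _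
    _ = (eLpNorm (fun ω => Y n ω - Z ω) 1 Q).toReal := by
        rw [eLpNorm_one_eq_lintegral_enorm, integral_norm_eq_lintegral_enorm (hi n).1]
    _ ≤ _ := ENNReal.toReal_mono (hi n).2.ne
        (eLpNorm_le_eLpNorm_of_exponent_le (by norm_num) (hi n).1)

end L2

section Gaussian

variable {Ω S : Type*} [MeasurableSpace Ω] {Q : Measure Ω}

lemma strongDual_apply_eq_sum {I : Finset S} (L : StrongDual ℝ (I → ℝ)) :
    ∃ c : I → ℝ, ∀ v, L v = ∑ i, c i * v i := by
  classical
  refine ⟨fun i => L (Pi.single i 1), fun v => ?_⟩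
  conv_lhs => rw [← Finset.univ_sum_single v]
  rw [map_sum]
  refine Finset.sum_congr rfl fun i _ => ?_
  have : Pi.single i (v i) = (v i) • (Pi.single i 1 : I → ℝ) := by
    rw [← Pi.single_smul]; simp
  rw [this, map_smul, smul_eq_mul, mul_comm]

/-- A centered square integrable process is Gaussian as soon as the characteristic functions of its
linear combinations are the Gaussian ones. -/
lemma isGaussianProcess_of_integral_cexp [IsProbabilityMeasure Q] {Y : S → Ω → ℝ}
    (hY : ∀ s, MemLp (Y s) 2 Q) (hY0 : ∀ s, ∫ ω, Y s ω ∂Q = 0)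
    (h : ∀ (I : Finset S) (c : I → ℝ),
      ∫ ω, Complex.exp ((∑ i, c i * Y i ω : ℝ) * Complex.I) ∂Q
        = ((Real.exp (-(∫ ω, (∑ i, c i * Y i ω) ^ 2 ∂Q) / 2) : ℝ) : ℂ)) :
    IsGaussianProcess Y Q := by
  refine ⟨fun I => ?_⟩
  have hm : AEMeasurable (fun ω => I.restrict fun s => Y s ω) Q :=
    aemeasurable_pi_iff.2 fun i => (hY i).1.aemeasurable
  refine (hasGaussianLaw_iff_charFunDual_map_eq hm).2 fun L => ?_
  obtain ⟨c, hc⟩ := strongDual_apply_eq_sum L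
  have hL : ∀ ω, L (I.restrict fun s => Y s ω) = ∑ i, c i * Y i ω := fun ω => hc _
  have hmem : MemLp (fun ω => ∑ i, c i * Y i ω) 2 Q :=
    memLp_finsetSum _ fun i _ => (hY i).const_mul _
  have h0 : ∫ ω, ∑ i, c i * Y i ω ∂Q = 0 := by
    rw [integral_finsetSum _ fun (i : I) _ => ((hY i).const_mul (c i)).integrable (by norm_num)]
    simp [integral_const_mul, hY0]
  rw [charFunDual_apply, integral_map hm (by fun_prop)]
  have hcomp : (⇑L ∘ fun ω => I.restrict fun s => Y s ω) = fun ω => ∑ i, c i * Y i ω := by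
    ext ω; exact hL ω
  simp_rw [hcomp, hL]
  rw [h, h0, variance_of_integral_eq_zero hmem.1.aemeasurable h0]
  push_cast
  congr 1
  simp [neg_div]

lemma IsCenteredGaussian.memLp {ϱ : S → Ω → ℝ} {K : S → S → ℝ} (h : IsCenteredGaussian ϱ K Q)
    (s : S) : MemLp (ϱ s) 2 Q :=
  (h.gaussian.hasGaussianLaw_eval s).memLp_two

lemma integral_sq_sum_eq {Y : S → Ω → ℝ} (hY : ∀ s, MemLp (Y s) 2 Q) {K : S → S → ℝ}
    (hK : ∀ s t, ∫ ω, Y s ω * Y t ω ∂Q = K s t) (I : Finset S) (c : I → ℝ) :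
    ∫ ω, (∑ i, c i * Y i ω) ^ 2 ∂Q = ∑ i, ∑ j, c i * c j * K i j := by
  have h1 : ∀ ω, (∑ i, c i * Y i ω) ^ 2 = ∑ i, ∑ j, c i * c j * (Y i ω * Y j ω) := by
    intro ω
    rw [sq, Finset.sum_mul_sum]
    refine Finset.sum_congr rfl fun i _ => Finset.sum_congr rfl fun j _ => by ring
  have h2 : ∀ i j : I, Integrable (fun ω => c i * c j * (Y i ω * Y j ω)) Q :=
    fun i j => ((hY i).integrable_mul (hY j)).const_mul _
  simp_rw [h1]
  rw [integral_finsetSum _ fun i _ => integrable_finsetSum _ fun j _ => h2 i j]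
  refine Finset.sum_congr rfl fun i _ => ?_
  rw [integral_finsetSum _ fun j _ => h2 i j]
  simp_rw [integral_const_mul, hK]

lemma IsCenteredGaussian.integral_cexp [IsProbabilityMeasure Q] {ϱ : S → Ω → ℝ} {K : S → S → ℝ}
    (h : IsCenteredGaussian ϱ K Q) (I : Finset S) (c : I → ℝ) :
    ∫ ω, Complex.exp ((∑ i, c i * ϱ i ω : ℝ) * Complex.I) ∂Q
      = ((Real.exp (-(∑ i, ∑ j, c i * c j * K i j) / 2) : ℝ) : ℂ) := by
  have hG := h.gaussian.hasGaussianLaw I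
  have hm := hG.aemeasurable
  let L : StrongDual ℝ (I → ℝ) := ∑ i, c i • ContinuousLinearMap.proj i
  have hL : ∀ ω, L (I.restrict fun s => ϱ s ω) = ∑ i, c i * ϱ i ω := by
    intro ω; simp [L]
  have hcomp : (⇑L ∘ fun ω => I.restrict fun s => ϱ s ω) = fun ω => ∑ i, c i * ϱ i ω := by
    ext ω; exact hL ω
  have hmem : MemLp (fun ω => ∑ i, c i * ϱ i ω) 2 Q :=
    memLp_finsetSum _ fun i _ => (h.memLp i).const_mul _
  have h0 : ∫ ω, ∑ i, c i * ϱ i ω ∂Q = 0 := by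
    rw [integral_finsetSum _ fun (i : I) _ =>
      ((h.memLp i).const_mul (c i)).integrable (by norm_num)]
    simp [integral_const_mul, h.centered]
  have h1 := hG.charFunDual_map_eq L
  rw [charFunDual_apply, integral_map hm (by fun_prop)] at h1
  simp_rw [hcomp, hL] at h1
  rw [h1, h0, variance_of_integral_eq_zero hmem.1.aemeasurable h0,
    ← integral_sq_sum_eq h.memLp h.covariance]
  push_cast
  congr 1
  simp [neg_div]

variable {Ω' : Type*} [MeasurableSpace Ω'] {P : Measure Ω'} [IsProbabilityMeasure P]

/-- The Cramér–Wold device, in terms of characteristic functions. -/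
lemma fddTendsto_of_integral_cexp [IsProbabilityMeasure Q] {Y : ℝ → S → Ω' → ℝ} {Z : S → Ω → ℝ}
    (hY : ∀ T s, AEMeasurable (Y T s) P) (hZ : ∀ s, AEMeasurable (Z s) Q)
    (h : ∀ (I : Finset S) (c : I → ℝ),
      Tendsto (fun T => ∫ ω, Complex.exp ((∑ i, c i * Y T i ω : ℝ) * Complex.I) ∂P) atTop
        (𝓝 (∫ ω, Complex.exp ((∑ i, c i * Z i ω : ℝ) * Complex.I) ∂Q))) :
    FDDTendsto Y Z P Q := by
  intro I
  have hYm : ∀ T, AEMeasurable (fun ω => WithLp.toLp 2 (I.restrict fun s => Y T s ω)) P :=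
    fun T => (by fun_prop :
      Measurable (WithLp.toLp 2 : (I → ℝ) → EuclideanSpace ℝ I)).comp_aemeasurable
      (aemeasurable_pi_iff.2 fun i => hY T i)
  have hZm : AEMeasurable (fun ω => WithLp.toLp 2 (I.restrict fun s => Z s ω)) Q :=
    (by fun_prop : Measurable (WithLp.toLp 2 : (I → ℝ) → EuclideanSpace ℝ I)).comp_aemeasurable
      (aemeasurable_pi_iff.2 fun i => hZ i)
  have key : TendstoInDistribution
      (fun (T : ℝ) ω => (WithLp.toLp 2 (I.restrict fun s => Y T s ω) : EuclideanSpace ℝ I)) atTop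
      (fun ω => WithLp.toLp 2 (I.restrict fun s => Z s ω)) (fun _ => P) Q := by
    refine ⟨hYm, hZm, ?_⟩
    refine tendsto_of_seq_tendsto fun u hu => ?_
    refine ProbabilityMeasure.tendsto_iff_tendsto_charFun.2 fun t => ?_
    have h1 := (h I (fun i => t i)).comp hu
    have h2 : ∀ v : I → ℝ, inner ℝ (WithLp.toLp 2 v : EuclideanSpace ℝ I) t = ∑ i, t i * v i := by
      intro v
      simp [PiLp.inner_apply]
    have h3 : ∀ T, charFun (P.map fun ω => WithLp.toLp 2 (I.restrict fun s => Y T s ω)) t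
        = ∫ ω, Complex.exp ((∑ i, t i * Y T i ω : ℝ) * Complex.I) ∂P := by
      intro T
      rw [charFun_apply, integral_map (hYm T) (by fun_prop)]
      simp_rw [h2]
      rfl
    have h4 : charFun (Q.map fun ω => WithLp.toLp 2 (I.restrict fun s => Z s ω)) t
        = ∫ ω, Complex.exp ((∑ i, t i * Z i ω : ℝ) * Complex.I) ∂Q := by
      rw [charFun_apply, integral_map hZm (by fun_prop)]
      simp_rw [h2]
      rfl
    rw [← h4] at h1
    exact h1.congr fun n => (h3 (u n)).symm
  have := key.continuous_comp (g := fun v : EuclideanSpace ℝ I => (v.ofLp : I → ℝ)) (by fun_prop)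
  exact this

end Gaussian

/-! ### The isonormal Gaussian process -/

section Isonormal

lemma integral_cexp_sum_of_iIndepFun {Ω ι : Type*} [MeasurableSpace Ω] {P : Measure Ω}
    {Y : ι → Ω → ℝ} (hm : ∀ j, AEMeasurable (Y j) P)
    (hind : iIndepFun Y P) (F : Finset ι) :
    ∫ ω, Complex.exp ((∑ j ∈ F, Y j ω : ℝ) * Complex.I) ∂P
      = ∏ j ∈ F, ∫ ω, Complex.exp (Y j ω * Complex.I) ∂P := by
  have h := congrFun ((hind.restrict F).charFun_map_fun_finsetSum_eq_prod fun j _ => hm j) 1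
  rw [charFun_apply,
    integral_map (Finset.aemeasurable_fun_sum F fun j _ => hm j) (by fun_prop)] at h
  simp only [Real.inner_apply, mul_one, Finset.prod_apply] at h
  rw [h]
  refine Finset.prod_congr rfl fun j _ => ?_
  rw [charFun_apply, integral_map (hm j) (by fun_prop)]
  simp

lemma iIndepFun_eval_gaussian (ι : Type*) (c : ι → ℝ) :
    iIndepFun (fun (i : ι) (ω : ι → ℝ) => c i * ω i)
      (Measure.infinitePi fun _ : ι => gaussianReal 0 1) :=
  iIndepFun_infinitePi (X := fun i x => c i * x) fun i => measurable_const_mul (c i)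

lemma hasLaw_eval_gaussian {ι : Type*} (i : ι) :
    HasLaw (fun ω : ι → ℝ => ω i) (gaussianReal 0 1)
      (Measure.infinitePi fun _ : ι => gaussianReal 0 1) where
  aemeasurable := (measurable_pi_apply i).aemeasurable
  map_eq := Measure.infinitePi_map_eval _ i

lemma memLp_eval_gaussian {ι : Type*} (i : ι) :
    MemLp (fun ω : ι → ℝ => ω i) 2 (Measure.infinitePi fun _ : ι => gaussianReal 0 1) :=
  (hasLaw_eval_gaussian i).hasGaussianLaw.memLp_two

lemma integral_eval_gaussian {ι : Type*} (i : ι) :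
    ∫ ω : ι → ℝ, ω i ∂(Measure.infinitePi fun _ : ι => gaussianReal 0 1) = 0 := by
  have := (hasLaw_eval_gaussian i).integral_eq
  simpa using this

lemma integral_eval_sq_gaussian {ι : Type*} (i : ι) :
    ∫ ω : ι → ℝ, ω i * ω i ∂(Measure.infinitePi fun _ : ι => gaussianReal 0 1) = 1 := by
  have h := (hasLaw_eval_gaussian i).variance_eq
  rw [variance_of_integral_eq_zero (measurable_pi_apply i).aemeasurable (integral_eval_gaussian i),
    variance_id_gaussianReal] at h
  simpa [sq] using h

lemma integral_cexp_sum_gaussian {ι : Type*} (F : Finset ι) (c : ι → ℝ) :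
    ∫ ω : ι → ℝ, Complex.exp ((∑ i ∈ F, c i * ω i : ℝ) * Complex.I)
        ∂(Measure.infinitePi fun _ : ι => gaussianReal 0 1)
      = ((Real.exp (-(∑ i ∈ F, c i ^ 2) / 2) : ℝ) : ℂ) := by
  rw [integral_cexp_sum_of_iIndepFun (Y := fun i (ω : ι → ℝ) => c i * ω i)
    (fun i => ((measurable_const_mul (c i)).comp (measurable_pi_apply i)).aemeasurable)
    (iIndepFun_eval_gaussian ι c)]
  have h1 : ∀ i, ∫ ω : ι → ℝ, Complex.exp ((c i * ω i : ℝ) * Complex.I)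
      ∂(Measure.infinitePi fun _ : ι => gaussianReal 0 1)
      = ((Real.exp (-(c i ^ 2) / 2) : ℝ) : ℂ) := by
    intro i
    have h2 := charFun_gaussianReal (μ := 0) (v := 1) (c i)
    rw [← (hasLaw_eval_gaussian i).map_eq, charFun_apply,
      integral_map (measurable_pi_apply i).aemeasurable (by fun_prop)] at h2
    simp only [Real.inner_apply] at h2
    simp_rw [mul_comm (c i)]
    rw [h2]
    push_cast
    congr 1
    simp [neg_div]
  simp_rw [h1, ← Complex.ofReal_prod, ← Real.exp_sum, ← Finset.sum_div, Finset.sum_neg_distrib]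

/-- The isonormal Gaussian process: every family of vectors of a Hilbert space is the family of
covariances of a centered Gaussian process. The process is the image of the vectors under a linear
isometry into `L²` which maps a Hilbert basis to independent standard Gaussian variables. -/
theorem exists_isCenteredGaussian_inner {H : Type} [NormedAddCommGroup H] [InnerProductSpace ℝ H]
    [CompleteSpace H] {S : Type*} (v : S → H) :
    ∃ (Ω' : Type) (_ : MeasurableSpace Ω') (Q : Measure Ω') (_ : IsProbabilityMeasure Q)
      (ϱ : S → Ω' → ℝ), IsCenteredGaussian ϱ (fun s t => inner ℝ (v s) (v t)) Q := by
  classical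
  obtain ⟨w, b, -⟩ := exists_hilbertBasis ℝ H
  let Q : Measure (w → ℝ) := Measure.infinitePi fun _ => gaussianReal 0 1
  let e : w → Lp ℝ 2 Q := fun i => (memLp_eval_gaussian i).toLp _
  have hinner : ∀ f g : Lp ℝ 2 Q, inner ℝ f g = ∫ ω, f ω * g ω ∂Q := by
    intro f g
    rw [L2.inner_def]
    simp [mul_comm]
  have he : Orthonormal ℝ e := by
    rw [orthonormal_iff_ite]
    intro i j
    have h1 : inner ℝ (e i) (e j) = ∫ ω : w → ℝ, ω i * ω j ∂Q := by
      rw [hinner]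
      refine integral_congr_ae ?_
      filter_upwards [(memLp_eval_gaussian i).coeFn_toLp, (memLp_eval_gaussian j).coeFn_toLp]
        with ω h1 h2
      rw [h1, h2]
    rw [h1]
    split_ifs with hij
    · subst hij
      exact integral_eval_sq_gaussian i
    · have hi := (iIndepFun_eval_gaussian w fun _ => 1).indepFun hij
      simp only [one_mul] at hi
      rw [hi.integral_fun_mul_eq_mul_integral (measurable_pi_apply i).aestronglyMeasurable
        (measurable_pi_apply j).aestronglyMeasurable, integral_eval_gaussian,
        zero_mul]
  let V : H →ₗᵢ[ℝ] Lp ℝ 2 Q :=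
    he.orthogonalFamily.linearIsometry.comp b.repr.toLinearIsometry
  have hVb : ∀ i, V (b i) = e i := by
    intro i
    simp [V, b.repr_self]
  have hsum : ∀ h : H, Tendsto (fun F : Finset w => ∑ i ∈ F, b.repr h i • e i) atTop (𝓝 (V h)) := by
    intro h
    have h1 := (b.hasSum_repr h).mapL V.toContinuousLinearMap
    simpa [hVb, HasSum] using h1
  have hcoe : ∀ (F : Finset w) (c : w → ℝ),
      (∑ i ∈ F, c i • e i : Lp ℝ 2 Q) =ᵐ[Q] fun ω => ∑ i ∈ F, c i * ω i := by
    intro F c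
    have h1 : ∀ i : w, (c i • e i : Lp ℝ 2 Q) =ᵐ[Q] fun ω => c i * ω i := by
      intro i
      filter_upwards [Lp.coeFn_smul (c i) (e i), (memLp_eval_gaussian i).coeFn_toLp] with ω h1 h2
      rw [h1, Pi.smul_apply, h2, smul_eq_mul]
    have h2 : ∀ᵐ ω ∂Q, ∀ i ∈ F, (c i • e i : Lp ℝ 2 Q) ω = c i * ω i :=
      (ae_ball_iff F.countable_toSet).2 fun i _ => h1 i
    filter_upwards [Lp.coeFn_finsetSum F fun i => c i • e i, h2] with ω h3 h4
    rw [h3, Finset.sum_apply]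
    exact Finset.sum_congr rfl h4
  have hlim : ∀ h : H, Tendsto
      (fun F : Finset w => eLpNorm (fun ω => (∑ i ∈ F, b.repr h i • e i : Lp ℝ 2 Q) ω - V h ω) 2 Q)
      atTop (𝓝 0) := fun h => (Lp.tendsto_Lp_iff_tendsto_eLpNorm' _ _).1 (hsum h)
  have hmean : ∀ h : H, ∫ ω, V h ω ∂Q = 0 := by
    intro h
    have h1 := tendsto_integral_mul_of_tendsto_eLpNorm (g := fun _ _ => 1) (g' := fun _ => 1)
      (fun F => Lp.memLp _) (fun _ => memLp_const _) (Lp.memLp (V h)) (memLp_const _) (hlim h)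
      (by simp)
    simp only [mul_one] at h1
    refine tendsto_nhds_unique h1 (tendsto_const_nhds.congr fun F => ?_)
    rw [integral_congr_ae (hcoe F _),
      integral_finsetSum _ fun i _ =>
        ((memLp_eval_gaussian i).const_mul _).integrable (by norm_num)]
    simp [integral_const_mul, integral_eval_gaussian]
  have hchar : ∀ h : H, ∫ ω, Complex.exp (V h ω * Complex.I) ∂Q
      = ((Real.exp (-‖h‖ ^ 2 / 2) : ℝ) : ℂ) := by
    intro h
    have h1 := tendsto_integral_cexp_of_tendsto_eLpNorm (fun F => Lp.memLp _) (Lp.memLp (V h))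
      (hlim h)
    refine tendsto_nhds_unique h1 ?_
    have h2 : ∀ F : Finset w, ∫ ω, Complex.exp
        (((∑ i ∈ F, b.repr h i • e i : Lp ℝ 2 Q) ω : ℝ) * Complex.I) ∂Q
        = ((Real.exp (-(∑ i ∈ F, b.repr h i ^ 2) / 2) : ℝ) : ℂ) := by
      intro F
      rw [← integral_cexp_sum_gaussian]
      refine integral_congr_ae ?_
      filter_upwards [hcoe F fun i => b.repr h i] with ω h3
      rw [h3]
    simp_rw [h2]
    have h3 : HasSum (fun i => b.repr h i ^ 2) (‖h‖ ^ 2) := by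
      rw [← real_inner_self_eq_norm_sq]
      refine (b.hasSum_inner_mul_inner h h).congr_fun fun i => ?_
      rw [b.repr_apply_apply, sq, real_inner_comm]
    have hc : Continuous fun x : ℝ => ((Real.exp (-x / 2) : ℝ) : ℂ) := by fun_prop
    exact (hc.tendsto _).comp h3
  refine ⟨w → ℝ, inferInstance, Q, inferInstance, fun s => V (v s), ?_, fun s => hmean _, ?_⟩
  · refine isGaussianProcess_of_integral_cexp (fun s => Lp.memLp _) (fun s => hmean _) ?_
    intro I c
    have h1 : (V (∑ i, c i • v i) : Lp ℝ 2 Q) =ᵐ[Q] fun ω => ∑ i, c i * V (v i) ω := by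
      have h2 : ∀ᵐ ω ∂Q, ∀ i : I, (c i • V (v i) : Lp ℝ 2 Q) ω = c i * V (v i) ω := by
        rw [ae_all_iff]
        intro i
        filter_upwards [Lp.coeFn_smul (c i) (V (v i))] with ω h1
        rw [h1, Pi.smul_apply, smul_eq_mul]
      rw [map_sum]
      simp_rw [map_smul]
      filter_upwards [Lp.coeFn_finsetSum Finset.univ fun i : I => c i • V (v i), h2] with ω h3 h4
      rw [h3, Finset.sum_apply]
      exact Finset.sum_congr rfl fun i _ => h4 i
    have h5 := hchar (∑ i, c i • v i)
    rw [← V.norm_map, ← real_inner_self_eq_norm_sq, hinner] at h5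
    rw [integral_congr_ae (g := fun ω => (∑ i, c i * V (v i) ω) ^ 2)
      (by filter_upwards [h1] with ω h using by rw [h, sq])] at h5
    rw [← h5]
    refine integral_congr_ae ?_
    filter_upwards [h1] with ω h
    rw [h]
  · intro s t
    rw [← hinner, V.inner_map_map]

end Isonormal

/-! ### A Lyapunov estimate -/

section Lyapunov

lemma norm_cexp_sub_taylor_two_le (x : ℝ) :
    ‖Complex.exp (x * Complex.I) - (1 + x * Complex.I - x ^ 2 / 2)‖ ≤ 4 * |x| ^ 3 := by
  have hn : ‖(x : ℂ) * Complex.I‖ = |x| := by simp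
  rcases le_or_gt |x| 1 with hx | hx
  · have h := Complex.norm_exp_sub_sum_le_norm_mul_exp ((x : ℂ) * Complex.I) 3
    have h1 : ∑ m ∈ Finset.range 3, ((x : ℂ) * Complex.I) ^ m / (m.factorial : ℂ)
        = 1 + x * Complex.I - x ^ 2 / 2 := by
      simp [Finset.sum_range_succ, mul_pow, Nat.factorial]
      ring
    rw [h1, hn] at h
    refine h.trans ?_
    have h2 : Real.exp |x| ≤ 4 :=
      (Real.exp_le_exp.2 hx).trans (by linarith [Real.exp_one_lt_d9])
    nlinarith [pow_nonneg (abs_nonneg x) 3]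
  · have h1 : ‖(1 : ℂ) + x * Complex.I - x ^ 2 / 2‖ ≤ 1 + |x| + |x| ^ 2 / 2 := by
      refine (norm_sub_le _ _).trans (add_le_add ((norm_add_le _ _).trans ?_) ?_)
      · simp
      · simp
    refine (norm_sub_le _ _).trans ?_
    rw [Complex.norm_exp_ofReal_mul_I]
    nlinarith [mul_pos (sub_pos.2 hx) (sub_pos.2 hx), pow_pos (zero_lt_one.trans hx) 2,
      mul_nonneg (sub_pos.2 hx).le (pow_pos (zero_lt_one.trans hx) 2).le]

lemma abs_exp_neg_sub_le {x : ℝ} (hx : 0 ≤ x) : |Real.exp (-x) - (1 - x)| ≤ x ^ 2 := by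
  rcases le_or_gt x 1 with h | h
  · have := Real.abs_exp_sub_one_sub_id_le (x := -x) (by rwa [abs_neg, abs_of_nonneg hx])
    rw [neg_sq] at this
    convert this using 2
    ring
  · rw [abs_of_nonneg (by linarith [Real.one_sub_le_exp_neg x])]
    nlinarith [Real.exp_le_one_iff.2 (neg_nonpos.2 hx)]

lemma norm_prod_sub_prod_le {ι : Type*} (F : Finset ι) (a b : ι → ℂ) (ha : ∀ i, ‖a i‖ ≤ 1)
    (hb : ∀ i, ‖b i‖ ≤ 1) : ‖∏ i ∈ F, a i - ∏ i ∈ F, b i‖ ≤ ∑ i ∈ F, ‖a i - b i‖ := by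
  classical
  induction F using Finset.induction with
  | empty => simp
  | insert j F hj ih =>
    rw [Finset.prod_insert hj, Finset.prod_insert hj, Finset.sum_insert hj]
    have h1 : a j * ∏ i ∈ F, a i - b j * ∏ i ∈ F, b i
        = (a j - b j) * ∏ i ∈ F, a i + b j * (∏ i ∈ F, a i - ∏ i ∈ F, b i) := by ring
    rw [h1]
    refine (norm_add_le _ _).trans (add_le_add ?_ ?_)
    · rw [norm_mul]
      refine mul_le_of_le_one_right (norm_nonneg _) ?_
      rw [norm_prod]
      exact Finset.prod_le_one (fun i _ => norm_nonneg _) fun i _ => ha i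
    · rw [norm_mul]
      exact (mul_le_of_le_one_left (norm_nonneg _) (hb j)).trans ih

variable {Ω : Type*} [MeasurableSpace Ω] {P : Measure Ω} [IsProbabilityMeasure P]

/-- Comparison of the characteristic function of a centered random variable at `1` with that of the
Gaussian variable with the same variance. -/
lemma norm_integral_cexp_sub_exp_le {Y : Ω → ℝ} (hY : MemLp Y 3 P) (h0 : ∫ ω, Y ω ∂P = 0) :
    ‖∫ ω, Complex.exp (Y ω * Complex.I) ∂P - ((Real.exp (-(∫ ω, Y ω ^ 2 ∂P) / 2) : ℝ) : ℂ)‖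
      ≤ 4 * ∫ ω, |Y ω| ^ 3 ∂P + (∫ ω, Y ω ^ 2 ∂P) ^ 2 := by
  have h3 : Integrable (fun ω => |Y ω| ^ 3) P := by
    simpa using hY.integrable_norm_pow (p := 3) (by norm_num)
  have hY2 : MemLp Y 2 P := hY.mono_exponent (by norm_num)
  have h2 : Integrable (fun ω => Y ω ^ 2) P := hY2.integrable_sq
  have h1 : Integrable Y P := hY2.integrable (by norm_num)
  set v := ∫ ω, Y ω ^ 2 ∂P with hv
  have hv0 : 0 ≤ v := integral_nonneg fun ω => sq_nonneg _
  have e1 : Integrable (fun ω => (Y ω : ℂ) * Complex.I) P := h1.ofReal.mul_const _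
  have e0 : Integrable (fun ω => (1 : ℂ) + (Y ω : ℂ) * Complex.I) P := (integrable_const _).add e1
  have e2 : Integrable (fun ω => (Y ω : ℂ) ^ 2 / 2) P := by
    have := h2.ofReal (𝕜 := ℂ)
    simp only [Complex.coe_algebraMap, RCLike.ofReal_pow] at this
    exact this.div_const _
  have hT : ∫ ω, ((1 : ℂ) + Y ω * Complex.I - Y ω ^ 2 / 2) ∂P = ((1 - v / 2 : ℝ) : ℂ) := by
    have : ∫ ω, (Y ω : ℂ) ^ 2 ∂P = (v : ℂ) := by
      rw [hv, ← integral_complex_ofReal]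
      push_cast
      rfl
    rw [integral_sub e0 e2, integral_add (integrable_const _) e1,
      integral_mul_const, integral_div, integral_complex_ofReal, h0, this]
    simp
  have e3 : Integrable (fun ω => (1 : ℂ) + Y ω * Complex.I - Y ω ^ 2 / 2) P := e0.sub e2
  have hA : ‖∫ ω, Complex.exp (Y ω * Complex.I) ∂P - ((1 - v / 2 : ℝ) : ℂ)‖
      ≤ 4 * ∫ ω, |Y ω| ^ 3 ∂P := by
    rw [← hT, ← integral_sub (integrable_cexp_mul_I hY.1) e3, ← integral_const_mul]
    exact norm_integral_le_of_norm_le (h3.const_mul 4)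
      (ae_of_all _ fun ω => norm_cexp_sub_taylor_two_le _)
  have hB : ‖((1 - v / 2 : ℝ) : ℂ) - ((Real.exp (-v / 2) : ℝ) : ℂ)‖ ≤ v ^ 2 := by
    rw [← Complex.ofReal_sub, Complex.norm_real, Real.norm_eq_abs, abs_sub_comm, neg_div]
    refine (abs_exp_neg_sub_le (by positivity)).trans ?_
    nlinarith [sq_nonneg v]
  calc _ = ‖(∫ ω, Complex.exp (Y ω * Complex.I) ∂P - ((1 - v / 2 : ℝ) : ℂ))
        + (((1 - v / 2 : ℝ) : ℂ) - ((Real.exp (-v / 2) : ℝ) : ℂ))‖ := by congr 1; ring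
    _ ≤ _ := (norm_add_le _ _).trans (add_le_add hA hB)

/-- Lyapunov's estimate for a convergent series of independent centered random variables. -/
theorem norm_integral_cexp_hasSum_sub_exp_le {ι : Type*} [Countable ι] {Y : ι → Ω → ℝ} {Z : Ω → ℝ}
    (hY : ∀ j, MemLp (Y j) 3 P) (hind : iIndepFun Y P) (h0 : ∀ j, ∫ ω, Y j ω ∂P = 0)
    (hZ : ∀ᵐ ω ∂P, HasSum (fun j => Y j ω) (Z ω))
    (h2 : Summable fun j => ∫ ω, Y j ω ^ 2 ∂P) (h3 : Summable fun j => ∫ ω, |Y j ω| ^ 3 ∂P)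
    {ε : ℝ} (hε : ∀ j, ∫ ω, Y j ω ^ 2 ∂P ≤ ε) :
    ‖∫ ω, Complex.exp (Z ω * Complex.I) ∂P
        - ((Real.exp (-(∑' j, ∫ ω, Y j ω ^ 2 ∂P) / 2) : ℝ) : ℂ)‖
      ≤ 4 * (∑' j, ∫ ω, |Y j ω| ^ 3 ∂P) + ε * ∑' j, ∫ ω, Y j ω ^ 2 ∂P := by
  have hm : ∀ j, AEMeasurable (Y j) P := fun j => (hY j).1.aemeasurable
  have hlim1 : Tendsto (fun F : Finset ι => ∫ ω, Complex.exp ((∑ j ∈ F, Y j ω : ℝ) * Complex.I) ∂P)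
      atTop (𝓝 (∫ ω, Complex.exp (Z ω * Complex.I) ∂P)) := by
    refine tendsto_integral_filter_of_dominated_convergence (fun _ => 1) ?_ ?_
      (integrable_const _) ?_
    · refine Eventually.of_forall fun F => (integrable_cexp_mul_I ?_).1
      exact (Finset.aemeasurable_fun_sum F fun j _ => hm j).aestronglyMeasurable
    · exact Eventually.of_forall fun F => ae_of_all _ fun ω => (Complex.norm_exp_ofReal_mul_I _).le
    · filter_upwards [hZ] with ω hω
      have hc : Continuous fun x : ℝ => Complex.exp (x * Complex.I) := by fun_prop
      exact (hc.tendsto _).comp hω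
  have hlim2 : Tendsto
      (fun F : Finset ι => ((Real.exp (-(∑ j ∈ F, ∫ ω, Y j ω ^ 2 ∂P) / 2) : ℝ) : ℂ))
      atTop (𝓝 ((Real.exp (-(∑' j, ∫ ω, Y j ω ^ 2 ∂P) / 2) : ℝ) : ℂ)) :=
    (by fun_prop : Continuous fun x : ℝ => ((Real.exp (-x / 2) : ℝ) : ℂ)).continuousAt.tendsto.comp
      h2.hasSum
  refine le_of_tendsto (hlim1.sub hlim2).norm (Eventually.of_forall fun F => ?_)
  have hv : ∀ j, 0 ≤ ∫ ω, Y j ω ^ 2 ∂P := fun j => integral_nonneg fun ω => sq_nonneg _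
  rw [integral_cexp_sum_of_iIndepFun hm hind, ← Finset.sum_neg_distrib, Finset.sum_div,
    Real.exp_sum, Complex.ofReal_prod]
  refine (norm_prod_sub_prod_le F _ _ (fun j => ?_) (fun j => ?_)).trans ?_
  · refine (norm_integral_le_integral_norm _).trans ?_
    simp [Complex.norm_exp_ofReal_mul_I]
  · rw [Complex.norm_real, Real.norm_of_nonneg (Real.exp_nonneg _), Real.exp_le_one_iff]
    linarith [hv j]
  · calc _ ≤ ∑ j ∈ F, (4 * ∫ ω, |Y j ω| ^ 3 ∂P + ε * ∫ ω, Y j ω ^ 2 ∂P) := by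
          refine Finset.sum_le_sum fun j _ => (norm_integral_cexp_sub_exp_le (hY j) (h0 j)).trans ?_
          rw [sq (∫ ω, Y j ω ^ 2 ∂P)]
          gcongr
          exact hε j
      _ = 4 * (∑ j ∈ F, ∫ ω, |Y j ω| ^ 3 ∂P) + ε * ∑ j ∈ F, ∫ ω, Y j ω ^ 2 ∂P := by
          rw [Finset.sum_add_distrib, Finset.mul_sum, Finset.mul_sum]
      _ ≤ _ := by
          rcases isEmpty_or_nonempty ι with hι | ⟨⟨j⟩⟩
          · simp [Finset.eq_empty_of_isEmpty F]
          have hε0 : 0 ≤ ε := (hv j).trans (hε j)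
          gcongr
          · exact h3.sum_le_tsum F fun j _ => integral_nonneg fun ω => by positivity
          · exact h2.sum_le_tsum F fun j _ => hv j

end Lyapunov

/-! ### The transition operator on bounded integrable functions -/

/-- Bounded, Borel measurable and Lebesgue integrable functions. -/
structure IsBddIntegrable (f : ℝ → ℝ) : Prop where
  measurable : Measurable f
  bounded : ∃ C, ∀ x, |f x| ≤ C
  integrable : Integrable f

namespace IsBddIntegrable

variable {f g : ℝ → ℝ}

lemma exists_bound_nonneg (hf : IsBddIntegrable f) : ∃ C, 0 ≤ C ∧ ∀ x, |f x| ≤ C := by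
  obtain ⟨C, hC⟩ := hf.bounded
  exact ⟨C, (abs_nonneg _).trans (hC 0), hC⟩

lemma const_mul (hf : IsBddIntegrable f) (c : ℝ) : IsBddIntegrable fun x => c * f x := by
  obtain ⟨C, hC⟩ := hf.bounded
  refine ⟨hf.measurable.const_mul c, ⟨|c| * C, fun x => ?_⟩, hf.integrable.const_mul c⟩
  rw [abs_mul]
  exact mul_le_mul_of_nonneg_left (hC x) (abs_nonneg c)

lemma add (hf : IsBddIntegrable f) (hg : IsBddIntegrable g) :
    IsBddIntegrable fun x => f x + g x := by
  obtain ⟨C, hC⟩ := hf.bounded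
  obtain ⟨D, hD⟩ := hg.bounded
  exact ⟨hf.measurable.add hg.measurable,
    ⟨C + D, fun x => (abs_add_le _ _).trans (add_le_add (hC x) (hD x))⟩,
    hf.integrable.add hg.integrable⟩

lemma sub (hf : IsBddIntegrable f) (hg : IsBddIntegrable g) :
    IsBddIntegrable fun x => f x - g x := by
  simpa [sub_eq_add_neg] using hf.add (hg.const_mul (-1))

lemma mul (hf : IsBddIntegrable f) (hg : IsBddIntegrable g) :
    IsBddIntegrable fun x => f x * g x := by
  obtain ⟨C, hC0, hC⟩ := hf.exists_bound_nonneg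
  obtain ⟨D, hD⟩ := hg.bounded
  refine ⟨hf.measurable.mul hg.measurable, ⟨C * D, fun x => ?_⟩,
    hg.integrable.bdd_mul hf.measurable.aestronglyMeasurable (ae_of_all _ hC)⟩
  rw [abs_mul]
  exact mul_le_mul (hC x) (hD x) (abs_nonneg _) hC0

lemma memLp_two (hf : IsBddIntegrable f) : MemLp f 2 := by
  rw [memLp_two_iff_integrable_sq hf.measurable.aestronglyMeasurable]
  simpa [sq] using (hf.mul hf).integrable

lemma _root_.SchwartzMap.isBddIntegrable (φ : 𝓢(ℝ, ℝ)) : IsBddIntegrable φ := by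
  obtain ⟨C, -, hC⟩ := φ.decay 0 0
  exact ⟨φ.continuous.measurable, ⟨C, fun x => by simpa using hC x⟩, φ.integrable⟩

end IsBddIntegrable

lemma IsTestFunction.measurable {f : ℝ → ℝ} (hf : IsTestFunction f) : Measurable f := by
  classical
  have hD := hf.piecewise_continuous
  have h1 : ContinuousOn f {x | ¬ ContinuousAt f x}ᶜ := by
    intro x hx
    simp only [Set.mem_compl_iff, Set.mem_ofPred_eq, not_not] at hx
    exact hx.continuousWithinAt
  have h2 : Measurable ({x | ¬ ContinuousAt f x}.piecewise (fun _ => (0 : ℝ)) f) :=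
    continuousOn_const.measurable_piecewise h1 hD.measurableSet
  refine h2.measurable_of_countable_ne (hD.countable.mono ?_)
  intro x hx
  by_contra h
  exact hx (Set.piecewise_eq_of_notMem _ _ _ h)

lemma IsTestFunction.isBddIntegrable {f : ℝ → ℝ} (hf : IsTestFunction f) : IsBddIntegrable f := by
  refine ⟨hf.measurable, hf.bounded, ?_⟩
  obtain ⟨C, hC⟩ := hf.bounded
  refine (integrableOn_iff_integrable_of_support_subset (subset_tsupport f)).1 ?_
  exact Measure.integrableOn_of_bounded (M := C) hf.compact_support.isCompact.measure_lt_top.ne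
    hf.measurable.aestronglyMeasurable (ae_of_all _ hC)

lemma IsTestFunction.mul {f g : ℝ → ℝ} (hf : IsTestFunction f) (hg : IsTestFunction g) :
    IsTestFunction fun x => f x * g x where
  bounded := (hf.isBddIntegrable.mul hg.isBddIntegrable).bounded
  piecewise_continuous := by
    refine (hf.piecewise_continuous.union hg.piecewise_continuous).subset fun x hx => ?_
    by_contra h
    simp only [Set.mem_union, Set.mem_ofPred_eq, not_or, not_not] at h
    exact hx (h.1.mul h.2)
  compact_support := hf.compact_support.mul_right

lemma IsTestFunction.sum_mul {ι : Type*} (F : Finset ι) (c : ι → ℝ) {f : ι → ℝ → ℝ}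
    (hf : ∀ i, IsTestFunction (f i)) : IsTestFunction fun x => ∑ i ∈ F, c i * f i x := by
  classical
  induction F using Finset.induction with
  | empty =>
    simp only [Finset.sum_empty]
    refine ⟨⟨0, by simp⟩, ?_, HasCompactSupport.zero⟩
    convert Set.finite_empty with x
    simp [continuousAt_const]
  | insert j F hj ih =>
    simp only [Finset.sum_insert hj]
    refine ⟨(((hf j).isBddIntegrable.const_mul (c j)).add ih.isBddIntegrable).bounded, ?_, ?_⟩
    · refine ((hf j).piecewise_continuous.union ih.piecewise_continuous).subset fun x hx => ?_
      by_contra h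
      simp only [Set.mem_union, Set.mem_ofPred_eq, not_or, not_not] at h
      exact hx ((h.1.const_mul (c j)).add h.2)
    · exact ((hf j).compact_support.mul_left (f := fun _ => c j)).add ih.compact_support

section Transition

variable {ν : Measure ℝ} [IsProbabilityMeasure ν] {f g : ℝ → ℝ}

lemma IsBddIntegrable.integrable_comp_add (hf : IsBddIntegrable f) (x : ℝ) :
    Integrable (fun y => f (x + y)) ν := by
  obtain ⟨C, hC⟩ := hf.bounded
  exact Integrable.of_bound (hf.measurable.comp (measurable_const_add x)).aestronglyMeasurable C
    (ae_of_all _ fun y => hC _)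

lemma abs_transition_le {C : ℝ} (hC : ∀ x, |f x| ≤ C) (x : ℝ) : |transition ν f x| ≤ C := by
  have := norm_integral_le_of_norm_le_const (μ := ν) (f := fun y => f (x + y)) (C := C)
    (ae_of_all _ fun y => hC _)
  simpa [transition] using this

lemma measurable_transition (hf : Measurable f) : Measurable (transition ν f) := by
  have h : StronglyMeasurable fun z : ℝ × ℝ => f (z.1 + z.2) :=
    (hf.comp measurable_add).stronglyMeasurable
  exact h.integral_prod_right.measurable

lemma integrable_comp_add_prod (hf : Integrable f) :
    Integrable (fun z : ℝ × ℝ => f (z.1 + z.2)) (ν.prod volume) :=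
  (measurePreserving_prod_add ν volume).integrable_comp_of_integrable (g := fun z : ℝ × ℝ => f z.2)
    (hf.comp_snd ν)

lemma IsBddIntegrable.transition (hf : IsBddIntegrable f) :
    IsBddIntegrable (transition ν f) := by
  obtain ⟨C, hC⟩ := hf.bounded
  refine ⟨measurable_transition hf.measurable, ⟨C, abs_transition_le hC⟩, ?_⟩
  have h := (integrable_comp_add_prod (ν := ν) hf.integrable).integral_prod_right
  refine h.congr (ae_of_all _ fun x => ?_)
  simp [DensityProcess.transition, add_comm]

lemma integral_transition_mul (hf : IsBddIntegrable f) (hg : IsBddIntegrable g) :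
    ∫ x, transition ν f x * g x = ∫ z : ℝ × ℝ, f (z.1 + z.2) * g z.2 ∂(ν.prod volume) := by
  obtain ⟨C, hC⟩ := hg.bounded
  rw [integral_prod_symm]
  · congr 1 with x
    simp only [transition]
    rw [← integral_mul_const]
    simp_rw [add_comm x]
  · exact (integrable_comp_add_prod hf.integrable).mul_bdd (c := C)
      (hg.measurable.comp measurable_snd).aestronglyMeasurable (ae_of_all _ fun z => hC z.2)

lemma integral_transition (hf : IsBddIntegrable f) : ∫ x, transition ν f x = ∫ x, f x := by
  have h1 := integrable_comp_add_prod (ν := ν) hf.integrable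
  have h2 : ∫ x, transition ν f x = ∫ z : ℝ × ℝ, f (z.1 + z.2) ∂(ν.prod volume) := by
    rw [integral_prod_symm _ h1]
    simp only [transition]
    simp_rw [add_comm]
  rw [h2, integral_prod _ h1]
  simp [integral_add_left_eq_self]

/-- The transition operator of a symmetric distribution is self-adjoint. -/
lemma integral_transition_mul_comm (hν : ν.map (fun x => -x) = ν) (hf : IsBddIntegrable f)
    (hg : IsBddIntegrable g) :
    ∫ x, transition ν f x * g x = ∫ x, f x * transition ν g x := by
  have hi : ∀ {u v : ℝ → ℝ}, IsBddIntegrable u → IsBddIntegrable v →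
      Integrable (fun z : ℝ × ℝ => u (z.1 + z.2) * v z.2) (ν.prod volume) := by
    intro u v hu hv
    obtain ⟨C, hC⟩ := hv.bounded
    exact (integrable_comp_add_prod hu.integrable).mul_bdd (c := C)
      (hv.measurable.comp measurable_snd).aestronglyMeasurable (ae_of_all _ fun z => hC z.2)
  have h1 : ∀ y, ∫ x, f (y + x) * g x = ∫ x, g (-y + x) * f x := by
    intro y
    rw [← integral_add_left_eq_self (fun x => g (-y + x) * f x) y]
    congr 1 with x
    rw [neg_add_cancel_left, mul_comm]
  rw [integral_transition_mul hf hg, integral_prod _ (hi hf hg)]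
  simp_rw [mul_comm (f _) (transition ν g _)]
  rw [integral_transition_mul hg hf, integral_prod _ (hi hg hf)]
  simp_rw [h1]
  conv_rhs => rw [← hν]
  rw [integral_map (by fun_prop)]
  have h : Measurable fun z : ℝ × ℝ => g (z.1 + z.2) * f z.2 :=
    (hg.measurable.comp measurable_add).mul (hf.measurable.comp measurable_snd)
  exact h.stronglyMeasurable.integral_prod_right.aestronglyMeasurable

lemma transition_transition (hf : IsBddIntegrable f) (x : ℝ) :
    transition ν (transition ν f) x = transition (ν ∗ ν) f x := by
  obtain ⟨C, hC⟩ := hf.bounded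
  simp only [transition]
  rw [integral_conv]
  · simp_rw [add_assoc]
  · exact Integrable.of_bound (hf.measurable.comp (measurable_const_add x)).aestronglyMeasurable C
      (ae_of_all _ fun y => hC _)

lemma integral_transition_mul_transition (hν : ν.map (fun x => -x) = ν) (hf : IsBddIntegrable f)
    (hg : IsBddIntegrable g) :
    ∫ x, transition ν f x * transition ν g x = ∫ x, f x * transition (ν ∗ ν) g x := by
  rw [integral_transition_mul_comm hν hf hg.transition]
  simp_rw [transition_transition hg]

lemma sq_transition_le (hf : IsBddIntegrable f) (x : ℝ) :
    transition ν f x ^ 2 ≤ transition ν (fun y => f y * f y) x := by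
  have h2 : MemLp (fun y => f (x + y)) 2 ν := by
    have hm : AEStronglyMeasurable (fun y => f (x + y)) ν :=
      (hf.measurable.comp (measurable_const_add x)).aestronglyMeasurable
    rw [memLp_two_iff_integrable_sq hm]
    simpa [sq] using (hf.mul hf).integrable_comp_add (ν := ν) x
  have h := variance_nonneg (fun y => f (x + y)) ν
  rw [variance_eq_sub h2] at h
  have h3 : ∫ y, ((fun y => f (x + y)) ^ 2) y ∂ν = transition ν (fun y => f y * f y) x := by
    simp [transition, sq]
  rw [h3] at h
  simp only [transition] at h ⊢
  linarith

/-- The transition operator is a contraction of `L²`. -/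
lemma eLpNorm_transition_le (hf : IsBddIntegrable f) :
    eLpNorm (transition ν f) 2 volume ≤ eLpNorm f 2 volume := by
  have e : ∀ {u : ℝ → ℝ}, IsBddIntegrable u →
      eLpNorm u 2 volume = ENNReal.ofReal ((∫ x, u x * u x) ^ (2⁻¹ : ℝ)) := by
    intro u hu
    rw [hu.memLp_two.eLpNorm_eq_integral_rpow_norm (by norm_num) (by norm_num)]
    simp [sq]
  rw [e hf, e hf.transition]
  refine ENNReal.ofReal_le_ofReal (Real.rpow_le_rpow ?_ ?_ (by norm_num))
  · exact integral_nonneg fun x => mul_self_nonneg _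
  · rw [← integral_transition (ν := ν) (hf.mul hf)]
    refine integral_mono (hf.transition.mul hf.transition).integrable
      (hf.mul hf).transition.integrable fun x => ?_
    simpa [sq] using sq_transition_le hf x

lemma transition_sub (hf : IsBddIntegrable f) (hg : IsBddIntegrable g) (x : ℝ) :
    transition ν (fun y => f y - g y) x = transition ν f x - transition ν g x :=
  integral_sub (hf.integrable_comp_add x) (hg.integrable_comp_add x)

lemma transition_sum {ι : Type*} (F : Finset ι) (c : ι → ℝ) {u : ι → ℝ → ℝ}
    (hu : ∀ i, IsBddIntegrable (u i)) (x : ℝ) :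
    transition ν (fun y => ∑ i ∈ F, c i * u i y) x = ∑ i ∈ F, c i * transition ν (u i) x := by
  simp only [transition]
  rw [integral_finsetSum _ fun i _ => ((hu i).integrable_comp_add x).const_mul (c i)]
  simp_rw [integral_const_mul]

lemma IsTestFunction.continuous_transition [NullSingletonClass ν] (hf : IsTestFunction f) :
    Continuous (DensityProcess.transition ν f) := by
  obtain ⟨C, hC⟩ := hf.bounded
  refine continuous_iff_continuousAt.2 fun x => ?_
  refine continuousAt_of_dominated (bound := fun _ => C) ?_ ?_ (integrable_const _) ?_
  · exact Eventually.of_forall fun z =>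
      (hf.measurable.comp (measurable_const_add z)).aestronglyMeasurable
  · exact Eventually.of_forall fun z => ae_of_all _ fun y => hC _
  · have hc : {y | ¬ ContinuousAt f (x + y)}.Finite :=
      hf.piecewise_continuous.preimage (add_right_injective x).injOn
    have h0 : ν {y | ¬ ContinuousAt f (x + y)} = 0 := hc.measure_zero ν
    filter_upwards [ae_iff.2 h0] with y hy
    exact ContinuousAt.comp (f := fun z => z + y) hy (by fun_prop)

/-- The probability that `x + Y` lies within distance `R` from the origin, where `Y` has
distribution `ν`. It dominates the transition operator on functions supported in a ball. -/
noncomputable def ballProb (ν : Measure ℝ) (R x : ℝ) : ℝ :=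
  transition ν ((Metric.closedBall (0 : ℝ) R).indicator fun _ => 1) x

lemma isBddIntegrable_indicator_closedBall (R : ℝ) :
    IsBddIntegrable ((Metric.closedBall (0 : ℝ) R).indicator fun _ => (1 : ℝ)) := by
  refine ⟨measurable_const.indicator Metric.isClosed_closedBall.measurableSet, ⟨1, fun x => ?_⟩, ?_⟩
  · by_cases hx : x ∈ Metric.closedBall (0 : ℝ) R <;> simp [hx]
  · exact (integrable_indicator_iff Metric.isClosed_closedBall.measurableSet).2
      (integrableOn_const (isCompact_closedBall _ _).measure_lt_top.ne)

lemma integrable_ballProb (R : ℝ) : Integrable (ballProb ν R) :=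
  (isBddIntegrable_indicator_closedBall R).transition.integrable

lemma ballProb_nonneg (ν : Measure ℝ) (R x : ℝ) : 0 ≤ ballProb ν R x :=
  integral_nonneg fun _ => Set.indicator_nonneg (fun _ _ => zero_le_one) _

lemma ballProb_le_one (R x : ℝ) : ballProb ν R x ≤ 1 := by
  refine (le_abs_self _).trans (abs_transition_le (fun y => ?_) x)
  by_cases hy : y ∈ Metric.closedBall (0 : ℝ) R <;> simp [hy]

lemma transition_abs_le_ballProb (hf : IsBddIntegrable f) {C R δ : ℝ} (hC0 : 0 ≤ C)
    (hC : ∀ x, |f x| ≤ C) (hR : ∀ x, R < |x| → f x = 0) {x x' : ℝ} (hx : |x - x'| ≤ δ) :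
    transition ν (fun y => |f y|) x ≤ C * ballProb ν (R + δ) x' := by
  rw [ballProb, transition, transition, ← integral_const_mul]
  refine integral_mono (hf.integrable_comp_add x).abs
    (((isBddIntegrable_indicator_closedBall _).integrable_comp_add x').const_mul C) fun y => ?_
  by_cases h : |x + y| ≤ R
  · have h1 : x' + y ∈ Metric.closedBall (0 : ℝ) (R + δ) := by
      rw [mem_closedBall_zero_iff, Real.norm_eq_abs]
      calc |x' + y| = |(x + y) - (x - x')| := by congr 1; ring
        _ ≤ |x + y| + |x - x'| := abs_sub _ _
        _ ≤ R + δ := add_le_add h hx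
    simpa [Set.indicator_of_mem h1] using hC (x + y)
  · simp only [hR _ (not_le.1 h), abs_zero]
    exact mul_nonneg hC0 (Set.indicator_nonneg (fun _ _ => zero_le_one) _)

lemma IsTestFunction.exists_support_bound (hf : IsTestFunction f) :
    ∃ R, ∀ x, R < |x| → f x = 0 := by
  obtain ⟨R, hR⟩ := hf.compact_support.isCompact.isBounded.subset_closedBall 0
  refine ⟨R, fun x hx => ?_⟩
  by_contra h
  have := hR (subset_tsupport f h)
  rw [mem_closedBall_zero_iff, Real.norm_eq_abs] at this
  exact absurd this (not_le.2 hx)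

end Transition

/-! ### The limit covariance -/

lemma meanNumber_nonneg (p : PMF ℕ) : 0 ≤ meanNumber p :=
  integral_nonneg fun _ => Nat.cast_nonneg _

lemma varNumber_nonneg (p : PMF ℕ) : 0 ≤ varNumber p := variance_nonneg _ _

/-- The covariance form of the limit, written symmetrically in terms of the distribution `ν` of the
displacement of a particle. -/
noncomputable def transitionCov (p : PMF ℕ) (ν : Measure ℝ) (f g : ℝ → ℝ) : ℝ :=
  meanNumber p * (∫ x, f x * g x)
    + (varNumber p - meanNumber p) * (∫ x, transition ν f x * transition ν g x)

section

variable {α : ℝ} {p : PMF ℕ} {ν : Measure ℝ} [IsProbabilityMeasure ν]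

lemma limitCov_eq_transitionCov (hα : 0 < α)
    (hν : ∀ u, charFun ν u = ((Real.exp (-(1 * |u| ^ α)) : ℝ) : ℂ)) {ψ : ℝ≥0 → ℝ → ℝ}
    (hψ : ∀ t, IsBddIntegrable (ψ t)) (s t : ℝ≥0) :
    limitCov α p ψ s t = transitionCov p ν (ψ s) (ψ t) := by
  have h2 : ∀ u, charFun (ν ∗ ν) u = ((Real.exp (-(2 * |u| ^ α)) : ℝ) : ℂ) := by
    simpa using charFun_conv_self ν hν
  rw [limitCov, transitionCov,
    integral_transition_mul_transition (map_neg_eq_self_of_charFun ν hν) (hψ s) (hψ t),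
    stableSemigroup_eq_transition hα two_pos (ν ∗ ν) h2]

lemma densityCov_one_eq_transitionCov (hα : 0 < α)
    (hν : ∀ u, charFun ν u = ((Real.exp (-(1 * |u| ^ α)) : ℝ) : ℂ)) (f g : ℝ → ℝ) :
    densityCov α p 1 1 f g = transitionCov p ν f g := by
  have h := fun f => stableSemigroup_eq_transition hα one_pos ν hν f
  simp only [densityCov, transitionCov, NNReal.coe_one, h]
  simp [stableSemigroup]

lemma transitionCov_sum {ι : Type*} (F : Finset ι) (c : ι → ℝ) {f : ι → ℝ → ℝ}
    (hf : ∀ i, IsBddIntegrable (f i)) :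
    transitionCov p ν (fun x => ∑ i ∈ F, c i * f i x) (fun x => ∑ i ∈ F, c i * f i x)
      = ∑ i ∈ F, ∑ j ∈ F, c i * c j * transitionCov p ν (f i) (f j) := by
  have key : ∀ {u : ι → ℝ → ℝ}, (∀ i, IsBddIntegrable (u i)) →
      ∫ x, (∑ i ∈ F, c i * u i x) * (∑ i ∈ F, c i * u i x)
        = ∑ i ∈ F, ∑ j ∈ F, c i * c j * ∫ x, u i x * u j x := by
    intro u hu
    have h1 : ∀ i j, Integrable fun x => c i * c j * (u i x * u j x) :=
      fun i j => ((hu i).mul (hu j)).integrable.const_mul _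
    have h2 : ∀ x, (∑ i ∈ F, c i * u i x) * (∑ i ∈ F, c i * u i x)
        = ∑ i ∈ F, ∑ j ∈ F, c i * c j * (u i x * u j x) := by
      intro x
      rw [Finset.sum_mul_sum]
      exact Finset.sum_congr rfl fun i _ => Finset.sum_congr rfl fun j _ => by ring
    simp_rw [h2]
    rw [integral_finsetSum _ fun i _ => integrable_finsetSum _ fun j _ => h1 i j]
    refine Finset.sum_congr rfl fun i _ => ?_
    rw [integral_finsetSum _ fun j _ => h1 i j]
    simp_rw [integral_const_mul]
  have h1 : ∀ x, transition ν (fun x => ∑ i ∈ F, c i * f i x) x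
      = ∑ i ∈ F, c i * transition ν (f i) x :=
    transition_sum F c hf
  simp only [transitionCov, h1]
  rw [key hf, key fun i => (hf i).transition, Finset.mul_sum, Finset.mul_sum,
    ← Finset.sum_add_distrib]
  refine Finset.sum_congr rfl fun i _ => ?_
  rw [Finset.mul_sum, Finset.mul_sum, ← Finset.sum_add_distrib]
  exact Finset.sum_congr rfl fun j _ => by ring

/-- In the Hilbert space `L²(ν ⊗ dx)` put `A_s (y, x) = f_s (y + x)` and
`B_s (y, x) = transition ν f_s x`. The projection of `A_s` on the functions of `x` is `B_s`, so that
the vectors `√(E θ) (A_s - B_s) + √(Var θ) B_s` have the inner products `transitionCov`. -/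
theorem exists_isCenteredGaussian_transitionCov {S : Type*} {f : S → ℝ → ℝ}
    (hf : ∀ s, IsBddIntegrable (f s)) :
    ∃ (Ω' : Type) (_ : MeasurableSpace Ω') (Q : Measure Ω') (_ : IsProbabilityMeasure Q)
      (ϱ : S → Ω' → ℝ), IsCenteredGaussian ϱ (fun s t => transitionCov p ν (f s) (f t)) Q := by
  have hA : ∀ s, MemLp (fun z : ℝ × ℝ => f s (z.1 + z.2)) 2 (ν.prod volume) := by
    intro s
    have hm : AEStronglyMeasurable (fun z : ℝ × ℝ => f s (z.1 + z.2)) (ν.prod volume) :=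
      ((hf s).measurable.comp measurable_add).aestronglyMeasurable
    rw [memLp_two_iff_integrable_sq hm]
    simpa [sq] using integrable_comp_add_prod (ν := ν) ((hf s).mul (hf s)).integrable
  have hB : ∀ s, MemLp (fun z : ℝ × ℝ => transition ν (f s) z.2) 2 (ν.prod volume) :=
    fun s => (hf s).transition.memLp_two.comp_snd ν
  have hAA : ∀ s t, inner ℝ ((hA s).toLp _ : Lp ℝ 2 (ν.prod volume)) ((hA t).toLp _)
      = ∫ x, f s x * f t x := by
    intro s t
    rw [inner_toLp_eq_integral,
      integral_prod _ (integrable_comp_add_prod ((hf s).mul (hf t)).integrable)]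
    simp [integral_add_left_eq_self (fun x => f s x * f t x)]
  have hAB : ∀ s t, inner ℝ ((hA s).toLp _ : Lp ℝ 2 (ν.prod volume)) ((hB t).toLp _)
      = ∫ x, transition ν (f s) x * transition ν (f t) x := by
    intro s t
    rw [inner_toLp_eq_integral, integral_transition_mul (hf s) (hf t).transition]
  have hBA : ∀ s t, inner ℝ ((hB s).toLp _ : Lp ℝ 2 (ν.prod volume)) ((hA t).toLp _)
      = ∫ x, transition ν (f s) x * transition ν (f t) x := by
    intro s t
    rw [real_inner_comm, hAB]
    simp_rw [mul_comm]
  have hBB : ∀ s t, inner ℝ ((hB s).toLp _ : Lp ℝ 2 (ν.prod volume)) ((hB t).toLp _)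
      = ∫ x, transition ν (f s) x * transition ν (f t) x := by
    intro s t
    rw [inner_toLp_eq_integral,
      integral_fun_snd (fun x => transition ν (f s) x * transition ν (f t) x)]
    simp
  obtain ⟨Ω', m, Q, hQ, ϱ, h⟩ := exists_isCenteredGaussian_inner fun s =>
    Real.sqrt (meanNumber p) • ((hA s).toLp _ : Lp ℝ 2 (ν.prod volume))
      + (Real.sqrt (varNumber p) - Real.sqrt (meanNumber p)) • (hB s).toLp _
  refine ⟨Ω', m, Q, hQ, ϱ, h.gaussian, h.centered, fun s t => ?_⟩
  rw [h.covariance]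
  simp only [inner_add_left, inner_add_right, real_inner_smul_left, real_inner_smul_right, hAA, hAB,
    hBA, hBB, transitionCov]
  have h1 := Real.mul_self_sqrt (meanNumber_nonneg p)
  have h2 := Real.mul_self_sqrt (varNumber_nonneg p)
  linear_combination ((∫ x, f s x * f t x) - ∫ x, transition ν (f s) x * transition ν (f t) x) * h1
    + (∫ x, transition ν (f s) x * transition ν (f t) x) * h2

/-- The form `transitionCov` is continuous for the convergence in `L²`. -/
lemma tendsto_transitionCov {f g : ℕ → ℝ → ℝ} {f' g' : ℝ → ℝ} (hf : ∀ n, IsBddIntegrable (f n))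
    (hg : ∀ n, IsBddIntegrable (g n)) (hf' : IsBddIntegrable f') (hg' : IsBddIntegrable g')
    (hff' : Tendsto (fun n => eLpNorm (fun x => f n x - f' x) 2 volume) atTop (𝓝 0))
    (hgg' : Tendsto (fun n => eLpNorm (fun x => g n x - g' x) 2 volume) atTop (𝓝 0)) :
    Tendsto (fun n => transitionCov p ν (f n) (g n)) atTop (𝓝 (transitionCov p ν f' g')) := by
  have h : ∀ {u : ℕ → ℝ → ℝ} {u' : ℝ → ℝ}, (∀ n, IsBddIntegrable (u n)) → IsBddIntegrable u' →
      Tendsto (fun n => eLpNorm (fun x => u n x - u' x) 2 volume) atTop (𝓝 0) →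
      Tendsto (fun n => eLpNorm (fun x => transition ν (u n) x - transition ν u' x) 2 volume)
        atTop (𝓝 0) := by
    intro u u' hu hu' huu'
    refine tendsto_of_tendsto_of_tendsto_of_le_of_le tendsto_const_nhds huu'
      (fun _ => zero_le) fun n => ?_
    refine le_trans (le_of_eq ?_) (eLpNorm_transition_le (ν := ν) ((hu n).sub hu'))
    congr 1 with x
    exact (transition_sub (hu n) hu' x).symm
  refine ((tendsto_integral_mul_of_tendsto_eLpNorm (fun n => (hf n).memLp_two)
    (fun n => (hg n).memLp_two) hf'.memLp_two hg'.memLp_two hff' hgg').const_mul _).add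
    ((tendsto_integral_mul_of_tendsto_eLpNorm (fun n => (hf n).transition.memLp_two)
    (fun n => (hg n).transition.memLp_two) hf'.transition.memLp_two hg'.transition.memLp_two
    (h hf hf' hff') (h hg hg' hgg')).const_mul _)

end

/-! ### The extension of the density process by `L²`-approximation -/

lemma exists_schwartz_tendsto_eLpNorm {f : ℝ → ℝ} (hf : MemLp f 2 volume) :
    ∃ φ : ℕ → 𝓢(ℝ, ℝ), Tendsto (fun n => eLpNorm (fun x => φ n x - f x) 2 volume) atTop (𝓝 0) := by
  have h : ∀ n : ℕ, ∃ φ : 𝓢(ℝ, ℝ),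
      eLpNorm (fun x => φ x - f x) 2 volume ≤ ENNReal.ofReal (1 / ((n : ℝ) + 1)) := by
    intro n
    obtain ⟨g, hg, hg', hle⟩ := hf.exist_eLpNorm_sub_le (by norm_num) (by norm_num)
      (ε := 1 / ((n : ℝ) + 1)) (by positivity)
    refine ⟨hg.toSchwartzMap hg', ?_⟩
    rw [eLpNorm_sub_comm] at hle
    exact hle
  choose φ hφ using h
  refine ⟨φ, tendsto_of_tendsto_of_tendsto_of_le_of_le tendsto_const_nhds ?_
    (fun _ => zero_le) hφ⟩
  have := (ENNReal.continuous_ofReal.tendsto 0).comp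
    (tendsto_one_div_add_atTop_nhds_zero_nat (𝕜 := ℝ))
  simpa [Function.comp_def] using this

section

variable {Ω : Type*} [MeasurableSpace Ω] {Q : Measure Ω}

lemma tendsto_eLpNorm_sum_mul_sub {ι : Type*} (F : Finset ι) (c : ι → ℝ) {a : ι → ℕ → Ω → ℝ}
    {b : ι → Ω → ℝ} (ha : ∀ i n, MemLp (a i n) 2 Q) (hb : ∀ i, MemLp (b i) 2 Q)
    (h : ∀ i, Tendsto (fun n => eLpNorm (fun ω => a i n ω - b i ω) 2 Q) atTop (𝓝 0)) :
    Tendsto (fun n => eLpNorm (fun ω => ∑ i ∈ F, c i * a i n ω - ∑ i ∈ F, c i * b i ω) 2 Q)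
      atTop (𝓝 0) := by
  have h1 : Tendsto (fun n => ∑ i ∈ F, ‖c i‖ₑ * eLpNorm (fun ω => a i n ω - b i ω) 2 Q) atTop
      (𝓝 0) := by
    have := tendsto_finsetSum F fun i _ =>
      ENNReal.Tendsto.const_mul (a := ‖c i‖ₑ) (h i) (Or.inr enorm_ne_top)
    simpa using this
  refine tendsto_of_tendsto_of_tendsto_of_le_of_le tendsto_const_nhds h1
    (fun _ => zero_le) fun n => ?_
  have h2 : (fun ω => ∑ i ∈ F, c i * a i n ω - ∑ i ∈ F, c i * b i ω)
      = ∑ i ∈ F, c i • fun ω => a i n ω - b i ω := by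
    ext ω
    rw [Finset.sum_apply, ← Finset.sum_sub_distrib]
    exact Finset.sum_congr rfl fun i _ => by simp [mul_sub]
  simp only [h2]
  refine (eLpNorm_sum_le (fun i _ => (((ha i n).sub (hb i)).const_smul (c i)).1)
    (by norm_num)).trans ?_
  exact Finset.sum_le_sum fun i _ => (eLpNorm_const_smul_le ..)

lemma eLpNorm_two_le_of_integral_sq_le {Ω' : Type*} [MeasurableSpace Ω'] {P : Measure Ω'}
    {u : Ω → ℝ} {v : Ω' → ℝ} (hu : MemLp u 2 Q) (hv : MemLp v 2 P) {C : ℝ} (hC : 0 ≤ C)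
    (h : ∫ ω, u ω * u ω ∂Q ≤ C * ∫ ω, v ω * v ω ∂P) :
    eLpNorm u 2 Q ≤ ENNReal.ofReal (Real.sqrt C) * eLpNorm v 2 P := by
  have e : ∀ {Ω : Type _} [MeasurableSpace Ω] {Q : Measure Ω} {u : Ω → ℝ}, MemLp u 2 Q →
      eLpNorm u 2 Q = ENNReal.ofReal (Real.sqrt (∫ x, u x * u x ∂Q)) := by
    intro Ω _ Q u hu
    rw [hu.eLpNorm_eq_integral_rpow_norm (by norm_num) (by norm_num), Real.sqrt_eq_rpow]
    simp [sq]
  have e' : eLpNorm v 2 P = ENNReal.ofReal (Real.sqrt (∫ x, v x * v x ∂P)) := by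
    rw [hv.eLpNorm_eq_integral_rpow_norm (by norm_num) (by norm_num), Real.sqrt_eq_rpow]
    simp [sq]
  rw [e hu, e', ← ENNReal.ofReal_mul (Real.sqrt_nonneg _), ← Real.sqrt_mul hC]
  exact ENNReal.ofReal_le_ofReal (Real.sqrt_le_sqrt h)

variable {α : ℝ} {p : PMF ℕ} {ν : Measure ℝ} [IsProbabilityMeasure ν]
  {X : ℝ≥0 → Ω → (𝓢(ℝ, ℝ) →L[ℝ] ℝ)}

lemma IsDensityProcess.memLp (h : IsDensityProcess α p X Q) (φ : 𝓢(ℝ, ℝ)) :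
    MemLp (fun ω => X 1 ω φ) 2 Q :=
  IsCenteredGaussian.memLp h (1, φ)

lemma IsDensityProcess.integral_mul (h : IsDensityProcess α p X Q) (hα : 0 < α)
    (hν : ∀ u, charFun ν u = ((Real.exp (-(1 * |u| ^ α)) : ℝ) : ℂ)) (φ χ : 𝓢(ℝ, ℝ)) :
    ∫ ω, X 1 ω φ * X 1 ω χ ∂Q = transitionCov p ν φ χ := by
  rw [← densityCov_one_eq_transitionCov hα hν]
  exact h.covariance (1, φ) (1, χ)

lemma IsDensityProcess.integral_cexp [IsProbabilityMeasure Q] (h : IsDensityProcess α p X Q)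
    (φ : 𝓢(ℝ, ℝ)) :
    ∫ ω, Complex.exp ((X 1 ω φ : ℝ) * Complex.I) ∂Q
      = ((Real.exp (-(∫ ω, X 1 ω φ * X 1 ω φ ∂Q) / 2) : ℝ) : ℂ) := by
  have h1 := IsCenteredGaussian.integral_cexp h {((1 : ℝ≥0), φ)} fun _ => 1
  have h2 : ∀ g : ({((1 : ℝ≥0), φ)} : Finset (ℝ≥0 × 𝓢(ℝ, ℝ))) → ℝ,
      ∑ i, g i = g ⟨((1 : ℝ≥0), φ), Finset.mem_singleton_self _⟩ := by
    intro g
    exact Fintype.sum_subsingleton _ _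
  simp only [h2, one_mul] at h1
  rw [h1, ← h.covariance (1, φ) (1, φ)]

/-- The random functional `X 1` is Lipschitz from `L²(dx)` to `L²(Q)`. -/
lemma IsDensityProcess.eLpNorm_apply_sub_le (h : IsDensityProcess α p X Q) (hα : 0 < α)
    (hν : ∀ u, charFun ν u = ((Real.exp (-(1 * |u| ^ α)) : ℝ) : ℂ)) :
    ∃ K : ℝ, 0 ≤ K ∧ ∀ φ χ : 𝓢(ℝ, ℝ), eLpNorm (fun ω => X 1 ω φ - X 1 ω χ) 2 Q
      ≤ ENNReal.ofReal K * eLpNorm (fun x => φ x - χ x) 2 volume := by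
  have hC : 0 ≤ meanNumber p + |varNumber p - meanNumber p| :=
    add_nonneg (meanNumber_nonneg p) (abs_nonneg _)
  refine ⟨Real.sqrt (meanNumber p + |varNumber p - meanNumber p|), Real.sqrt_nonneg _,
    fun φ χ => ?_⟩
  have h1 : (fun ω => X 1 ω φ - X 1 ω χ) = fun ω => X 1 ω (φ - χ) := by
    ext ω; rw [map_sub]
  have h2 : (fun x => φ x - χ x) = (φ - χ : 𝓢(ℝ, ℝ)) := by
    ext x; simp
  rw [h1, h2]
  generalize φ - χ = η
  have hB := η.isBddIntegrable
  refine eLpNorm_two_le_of_integral_sq_le (h.memLp _) hB.memLp_two hC ?_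
  rw [h.integral_mul hα hν, transitionCov, add_mul]
  have h3 : ∫ x, transition ν η x * transition ν η x ≤ ∫ x, η x * η x := by
    rw [← integral_transition (ν := ν) (hB.mul hB)]
    refine integral_mono (hB.transition.mul hB.transition).integrable
      (hB.mul hB).transition.integrable fun x => ?_
    simpa [sq] using sq_transition_le hB x
  have h4 : 0 ≤ ∫ x, transition ν η x * transition ν η x :=
    integral_nonneg fun x => mul_self_nonneg _
  have h5 := le_abs_self (varNumber p - meanNumber p)
  have h6 := abs_nonneg (varNumber p - meanNumber p)
  nlinarith

/-- Existence of the extension of `X 1` to square integrable functions. -/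
lemma IsDensityProcess.exists_isL2Pairing (h : IsDensityProcess α p X Q) (hα : 0 < α)
    (hν : ∀ u, charFun ν u = ((Real.exp (-(1 * |u| ^ α)) : ℝ) : ℂ)) {f : ℝ → ℝ}
    (hf : MemLp f 2 volume) : ∃ Y, IsL2Pairing (X 1) f Y Q := by
  obtain ⟨K, hK0, hK⟩ := h.eLpNorm_apply_sub_le hα hν
  have hS : ∀ φ : 𝓢(ℝ, ℝ), MemLp φ 2 volume := fun φ => φ.isBddIntegrable.memLp_two
  obtain ⟨φ, hφ⟩ := exists_schwartz_tendsto_eLpNorm hf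
  have hc : CauchySeq fun n => (hS (φ n)).toLp (φ n) :=
    ((Lp.tendsto_Lp_iff_tendsto_eLpNorm'' _ _ _ hf).2 hφ).cauchySeq
  have hc' : CauchySeq fun n => (h.memLp (φ n)).toLp fun ω => X 1 ω (φ n) := by
    have hd : ∀ n m, dist ((h.memLp (φ n)).toLp fun ω => X 1 ω (φ n))
        ((h.memLp (φ m)).toLp fun ω => X 1 ω (φ m))
        ≤ K * dist ((hS (φ n)).toLp (φ n)) ((hS (φ m)).toLp (φ m)) := by
      intro n m
      rw [Lp.dist_edist, Lp.dist_edist, Lp.edist_toLp_toLp, Lp.edist_toLp_toLp,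
        ← ENNReal.toReal_ofReal hK0, ← ENNReal.toReal_mul]
      refine ENNReal.toReal_mono (ENNReal.mul_ne_top ENNReal.ofReal_ne_top
        ((hS (φ n)).sub (hS (φ m))).2.ne) ?_
      exact hK (φ n) (φ m)
    rw [Metric.cauchySeq_iff] at hc ⊢
    intro ε hε
    obtain ⟨N, hN⟩ := hc (ε / (K + 1)) (by positivity)
    refine ⟨N, fun m hm n hn => (hd m n).trans_lt ?_⟩
    have h1 := hN m hm n hn
    rw [lt_div_iff₀ (by positivity)] at h1
    nlinarith [dist_nonneg (x := (hS (φ m)).toLp (φ m)) (y := (hS (φ n)).toLp (φ n))]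
  obtain ⟨Y, hY⟩ := cauchySeq_tendsto_of_complete hc'
  have hY' : Tendsto (fun n => eLpNorm (fun ω => X 1 ω (φ n) - Y ω) 2 Q) atTop (𝓝 0) := by
    have hY2 : Tendsto (fun n => (h.memLp (φ n)).toLp fun ω => X 1 ω (φ n)) atTop
        (𝓝 ((Lp.memLp Y).toLp Y)) := by
      rwa [Lp.toLp_coeFn]
    exact (Lp.tendsto_Lp_iff_tendsto_eLpNorm'' _ _ _ _).1 hY2
  refine ⟨Y, Lp.memLp Y, fun χ hχ => ?_⟩
  have h1 : Tendsto (fun n => ENNReal.ofReal K * (eLpNorm (fun x => χ n x - f x) 2 volume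
      + eLpNorm (fun x => φ n x - f x) 2 volume)
      + eLpNorm (fun ω => X 1 ω (φ n) - Y ω) 2 Q) atTop (𝓝 0) := by
    have := (ENNReal.Tendsto.const_mul (a := ENNReal.ofReal K) (hχ.add hφ)
      (Or.inr ENNReal.ofReal_ne_top)).add hY'
    simpa using this
  refine tendsto_of_tendsto_of_tendsto_of_le_of_le tendsto_const_nhds h1
    (fun _ => zero_le) fun n => ?_
  have e1 : (fun ω => X 1 ω (χ n) - Y ω)
      = (fun ω => X 1 ω (χ n) - X 1 ω (φ n)) + fun ω => X 1 ω (φ n) - Y ω := by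
    ext ω; simp
  have e2 : (fun x => χ n x - φ n x) = (fun x => χ n x - f x) - fun x => φ n x - f x := by
    ext x; simp
  simp only [e1]
  refine (eLpNorm_add_le ((h.memLp _).sub (h.memLp _)).1 ((h.memLp _).sub (Lp.memLp Y)).1
    (by norm_num)).trans (add_le_add_left ((hK _ _).trans ?_) _)
  gcongr
  rw [e2]
  exact eLpNorm_sub_le ((hS _).sub hf).1 ((hS _).sub hf).1 (by norm_num)

lemma IsL2Pairing.ae_eq {Z : Ω → (𝓢(ℝ, ℝ) →L[ℝ] ℝ)} {f : ℝ → ℝ} (hf : MemLp f 2 volume)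
    {Y Y' : Ω → ℝ} (hZ : ∀ φ, MemLp (fun ω => Z ω φ) 2 Q)
    (hY : IsL2Pairing Z f Y Q) (hY' : IsL2Pairing Z f Y' Q) : Y' =ᵐ[Q] Y := by
  obtain ⟨φ, hφ⟩ := exists_schwartz_tendsto_eLpNorm hf
  have h1 := (Lp.tendsto_Lp_iff_tendsto_eLpNorm'' _ (fun n => hZ (φ n)) _ hY.memLp).2
    (hY.tendsto φ hφ)
  have h2 := (Lp.tendsto_Lp_iff_tendsto_eLpNorm'' _ (fun n => hZ (φ n)) _ hY'.memLp).2
    (hY'.tendsto φ hφ)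
  exact (MemLp.toLp_eq_toLp_iff _ _).1 (tendsto_nhds_unique h2 h1)

/-- The extension of `X 1` to square integrable functions is again a centered Gaussian process, with
the covariance extended by continuity. -/
lemma IsDensityProcess.isCenteredGaussian_of_isL2Pairing [IsProbabilityMeasure Q]
    (h : IsDensityProcess α p X Q) (hα : 0 < α)
    (hν : ∀ u, charFun ν u = ((Real.exp (-(1 * |u| ^ α)) : ℝ) : ℂ)) {S : Type*} {f : S → ℝ → ℝ}
    (hf : ∀ s, IsBddIntegrable (f s)) {ϱ : S → Ω → ℝ} (hϱ : ∀ s, IsL2Pairing (X 1) (f s) (ϱ s) Q) :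
    IsCenteredGaussian ϱ (fun s t => transitionCov p ν (f s) (f t)) Q := by
  choose φ hφ using fun s => exists_schwartz_tendsto_eLpNorm (hf s).memLp_two
  have hlim : ∀ s, Tendsto (fun n => eLpNorm (fun ω => X 1 ω (φ s n) - ϱ s ω) 2 Q) atTop (𝓝 0) :=
    fun s => (hϱ s).tendsto (φ s) (hφ s)
  have h0 : ∀ s, ∫ ω, ϱ s ω ∂Q = 0 := by
    intro s
    have h1 := tendsto_integral_mul_of_tendsto_eLpNorm (g := fun _ _ => 1) (g' := fun _ => 1)
      (fun n => h.memLp (φ s n)) (fun _ => memLp_const _) (hϱ s).memLp (memLp_const _) (hlim s)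
      (by simp)
    simp only [mul_one] at h1
    exact tendsto_nhds_unique h1 (tendsto_const_nhds.congr fun n => (h.centered (1, φ s n)).symm)
  refine ⟨isGaussianProcess_of_integral_cexp (fun s => (hϱ s).memLp) h0 fun I c => ?_, h0,
    fun s t => ?_⟩
  · have e1 : ∀ n ω, X 1 ω (∑ i : I, c i • φ i n) = ∑ i : I, c i * X 1 ω (φ i n) := by
      intro n ω; simp [map_sum]
    have hm : ∀ n, MemLp (fun ω => ∑ i : I, c i * X 1 ω (φ i n)) 2 Q :=
      fun n => memLp_finsetSum _ fun i _ => (h.memLp _).const_mul _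
    have hm' : MemLp (fun ω => ∑ i : I, c i * ϱ i ω) 2 Q :=
      memLp_finsetSum _ fun i _ => (hϱ i).memLp.const_mul _
    have hl := tendsto_eLpNorm_sum_mul_sub (Q := Q) Finset.univ c
      (a := fun i : I => fun n ω => X 1 ω (φ i n))
      (b := fun i : I => ϱ i) (fun i n => h.memLp _) (fun i => (hϱ i).memLp) fun i => hlim i
    have h1 := tendsto_integral_cexp_of_tendsto_eLpNorm hm hm' hl
    have h2 := tendsto_integral_mul_of_tendsto_eLpNorm hm hm hm' hm' hl hl
    simp_rw [sq]
    refine tendsto_nhds_unique h1 ?_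
    have hc : Continuous fun x : ℝ => ((Real.exp (-x / 2) : ℝ) : ℂ) := by fun_prop
    refine ((hc.tendsto _).comp h2).congr fun n => ?_
    have h4 := h.integral_cexp (∑ i : I, c i • φ i n)
    simp only [e1] at h4
    exact h4.symm
  · have h1 := tendsto_integral_mul_of_tendsto_eLpNorm (fun n => h.memLp (φ s n))
      (fun n => h.memLp (φ t n)) (hϱ s).memLp (hϱ t).memLp (hlim s) (hlim t)
    refine tendsto_nhds_unique h1 ?_
    simp_rw [h.integral_mul hα hν]
    exact tendsto_transitionCov (fun n => (φ s n).isBddIntegrable)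
      (fun n => (φ t n).isBddIntegrable) (hf s) (hf t) (hφ s) (hφ t)

end

/-! ### Independence of the contributions of different integers -/

section Independence

variable {Ω ι κ 𝓐 𝓑 : Type*} [MeasurableSpace Ω] [MeasurableSpace 𝓐] [MeasurableSpace 𝓑]
  {P : Measure Ω}

/-- Two independent families, each consisting of independent random variables, can be paired. -/
lemma iIndepFun_prodMk_of_indepFun {A : ι → Ω → 𝓐} {B : ι → Ω → 𝓑}
    (hAm : ∀ i, Measurable (A i)) (hBm : ∀ i, Measurable (B i)) (hA : iIndepFun A P)
    (hB : iIndepFun B P) (hAB : IndepFun (fun ω i => A i ω) (fun ω i => B i ω) P) :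
    iIndepFun (fun i ω => (A i ω, B i ω)) P := by
  let R : Set (Set (𝓐 × 𝓑)) := Set.image2 (· ×ˢ ·) {s | MeasurableSet s} {t | MeasurableSet t}
  refine (iIndepFun_iff_iIndep _ _ _).2 (iIndepSets.iIndep
    (fun i => ((hAm i).prodMk (hBm i)).comap_le)
    (fun i => Set.preimage (fun ω => (A i ω, B i ω)) '' R) (fun i => ?_) (fun i => ?_) ?_)
  · exact isPiSystem_prod.comap _
  · rw [← MeasurableSpace.comap_generateFrom, generateFrom_prod]
  · rw [iIndepSets_iff]
    intro s F hF
    have hF' : ∀ i ∈ s, ∃ a b, MeasurableSet a ∧ MeasurableSet b ∧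
        F i = A i ⁻¹' a ∩ B i ⁻¹' b := by
      intro i hi
      obtain ⟨_, ⟨a, ha, b, hb, rfl⟩, hab⟩ := hF i hi
      exact ⟨a, b, ha, hb, hab.symm⟩
    choose! a b ha hb hab using hF'
    have h1 : ⋂ i ∈ s, F i = (⋂ i ∈ s, A i ⁻¹' a i) ∩ ⋂ i ∈ s, B i ⁻¹' b i := by
      rw [Set.iInter₂_congr hab]
      ext ω
      simp only [Set.mem_iInter, Set.mem_inter_iff]
      exact ⟨fun h => ⟨fun i hi => (h i hi).1, fun i hi => (h i hi).2⟩,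
        fun h i hi => ⟨h.1 i hi, h.2 i hi⟩⟩
    have h2 : P ((⋂ i ∈ s, A i ⁻¹' a i) ∩ ⋂ i ∈ s, B i ⁻¹' b i)
        = P (⋂ i ∈ s, A i ⁻¹' a i) * P (⋂ i ∈ s, B i ⁻¹' b i) := by
      have := hAB.measure_inter_preimage_eq_mul (⋂ i ∈ s, (fun x : ι → 𝓐 => x i) ⁻¹' a i)
        (⋂ i ∈ s, (fun x : ι → 𝓑 => x i) ⁻¹' b i)
        (s.measurableSet_biInter fun i hi => measurable_pi_apply i (ha i hi))
        (s.measurableSet_biInter fun i hi => measurable_pi_apply i (hb i hi))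
      simp only [Set.preimage_iInter] at this
      exact this
    rw [h1, h2, hA.measure_inter_preimage_eq_mul s ha, hB.measure_inter_preimage_eq_mul s hb,
      ← Finset.prod_mul_distrib]
    refine Finset.prod_congr rfl fun i hi => ?_
    rw [hab i hi]
    refine (IndepFun.measure_inter_preimage_eq_mul (f := A i) (g := B i) ?_ _ _ (ha i hi)
      (hb i hi)).symm
    exact hAB.comp (measurable_pi_apply i) (measurable_pi_apply i)

/-- Independent random variables indexed by pairs, grouped according to the first index. -/
lemma iIndepFun_curry [IsProbabilityMeasure P] {X : ι × κ → Ω → 𝓐} (hX : ∀ q, Measurable (X q))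
    (h : iIndepFun X P) : iIndepFun (fun i ω => fun k => X (i, k) ω) P := by
  have hp : ∀ q, IsProbabilityMeasure (P.map (X q)) :=
    fun q => Measure.isProbabilityMeasure_map (hX q).aemeasurable
  have h1 := (iIndepFun_iff_map_fun_eq_infinitePi_map hX).1 h
  have h2 : P.map (fun ω i k => X (i, k) ω)
      = Measure.infinitePi fun i => Measure.infinitePi fun k => P.map (X (i, k)) := by
    rw [← Measure.infinitePi_map_curry (fun i k => P.map (X (i, k))), ← h1,
      Measure.map_map (by fun_prop) (by fun_prop)]
    rfl
  have h3 : ∀ i, P.map (fun ω k => X (i, k) ω) = Measure.infinitePi fun k => P.map (X (i, k)) := by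
    intro i
    have : (fun k => X (i, k)) = fun k => X ((fun k => (i, k)) k) := rfl
    exact (iIndepFun_iff_map_fun_eq_infinitePi_map (by fun_prop)).1
      (h.precomp (g := fun k => (i, k)) fun _ _ hk => (Prod.mk.inj hk).2)
  rw [iIndepFun_iff_map_fun_eq_infinitePi_map (by fun_prop), h2]
  simp_rw [h3]

lemma integral_comp_prodMk_of_indepFun [IsProbabilityMeasure P] {A : Ω → 𝓐} {B : Ω → 𝓑}
    (hA : Measurable A) (hB : Measurable B) (hAB : IndepFun A B P) {F : 𝓐 × 𝓑 → ℝ}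
    (hF : Measurable F) (hint : Integrable (fun ω => F (A ω, B ω)) P) :
    ∫ ω, F (A ω, B ω) ∂P = ∫ ω, ∫ ω', F (A ω, B ω') ∂P ∂P := by
  have h1 := (indepFun_iff_map_prod_eq_prod_map_map hA.aemeasurable hB.aemeasurable).1 hAB
  have h2 : ∫ ω, F (A ω, B ω) ∂P = ∫ q, F q ∂(P.map fun ω => (A ω, B ω)) :=
    (integral_map (hA.prodMk hB).aemeasurable hF.aestronglyMeasurable).symm
  have h3 : Integrable F (P.map fun ω => (A ω, B ω)) :=
    (integrable_map_measure hF.aestronglyMeasurable (hA.prodMk hB).aemeasurable).2 hint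
  have := Measure.isProbabilityMeasure_map (μ := P) hA.aemeasurable
  have := Measure.isProbabilityMeasure_map (μ := P) hB.aemeasurable
  rw [h1] at h2 h3
  rw [h2, integral_prod _ h3, integral_map hA.aemeasurable]
  · refine integral_congr_ae (ae_of_all _ fun ω => ?_)
    exact integral_map hB.aemeasurable (hF.comp measurable_prodMk_left).aestronglyMeasurable
  · exact hF.stronglyMeasurable.integral_prod_right'.aestronglyMeasurable

end Independence

/-! ### Moments of the contribution of one integer -/

/-- The contribution of one integer to `⟨N_t^T, f⟩`, as a function of the initial data
`i = (k, r)` attached to this integer, namely the number `k` of particles and their positions `r k`,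
and of the displacements `m` of the particles. -/
noncomputable def clusterSum (T : ℝ) (f : ℝ → ℝ) (i : ℕ × ((k : ℕ) → Fin k → ℝ)) (m : ℕ → ℝ) : ℝ :=
  ∑ n : Fin i.1, f (i.2 i.1 n / T + m n)

lemma measurable_clusterSum (T : ℝ) {f : ℝ → ℝ} (hf : Measurable f) :
    Measurable fun q : (ℕ × ((k : ℕ) → Fin k → ℝ)) × (ℕ → ℝ) => clusterSum T f q.1 q.2 := by
  have h : Measurable fun q : ℕ × (((k : ℕ) → Fin k → ℝ) × (ℕ → ℝ)) =>
      ∑ n : Fin q.1, f (q.2.1 q.1 n / T + q.2.2 n) := by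
    refine measurable_from_prod_countable_right fun k => ?_
    refine Finset.measurable_fun_sum Finset.univ
      (f := fun (n : Fin k) (z : ((k : ℕ) → Fin k → ℝ) × (ℕ → ℝ)) => f (z.1 k n / T + z.2 n))
      fun n _ => ?_
    have h1 : Measurable fun z : ((k : ℕ) → Fin k → ℝ) × (ℕ → ℝ) => z.1 k n :=
      (measurable_pi_apply n).comp ((measurable_pi_apply k).comp measurable_fst)
    have h2 : Measurable fun z : ((k : ℕ) → Fin k → ℝ) × (ℕ → ℝ) => z.2 n :=
      (measurable_pi_apply _).comp measurable_snd
    exact hf.comp ((h1.div_const T).add h2)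
  exact h.comp (measurable_fst.fst.prodMk (measurable_fst.snd.prodMk measurable_snd))

lemma abs_clusterSum_le (T : ℝ) {f : ℝ → ℝ} {C : ℝ} (hC : ∀ x, |f x| ≤ C)
    (i : ℕ × ((k : ℕ) → Fin k → ℝ)) (m : ℕ → ℝ) : |clusterSum T f i m| ≤ C * i.1 := by
  refine (Finset.abs_sum_le_sum_abs _ _).trans ((Finset.sum_le_sum fun n _ => hC _).trans ?_)
  simp [mul_comm]

lemma abs_clusterSum_pow_le {f : ℝ → ℝ} {C : ℝ} (hC : ∀ x, |f x| ≤ C) (l : ℕ) (T : ℝ)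
    (i : ℕ × ((k : ℕ) → Fin k → ℝ)) (m : ℕ → ℝ) :
    |clusterSum T f i m| ^ l ≤ C ^ l * (i.1 : ℝ) ^ l := by
  rw [← mul_pow]
  exact pow_le_pow_left₀ (abs_nonneg _) (abs_clusterSum_le T hC i m) l

lemma abs_clusterSum_le_clusterSum_abs (T : ℝ) (f : ℝ → ℝ)
    (i : ℕ × ((k : ℕ) → Fin k → ℝ)) (m : ℕ → ℝ) :
    |clusterSum T f i m| ≤ clusterSum T (fun x => |f x|) i m :=
  Finset.abs_sum_le_sum_abs _ _

/-- `I = (θ_j, (ρ^j_k)_k)` and the displacements `M` describe the particles attached to the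
integer `j`: the displacements are independent of each other and of `I` and have law `ν`. -/
structure IsCluster {Ω : Type*} [MeasurableSpace Ω] (j : ℤ) (p : PMF ℕ) (ν : Measure ℝ)
    (I : Ω → ℕ × ((k : ℕ) → Fin k → ℝ)) (M : Ω → ℕ → ℝ) (P : Measure Ω) : Prop where
  measurable_initial : Measurable I
  measurable_motion : Measurable M
  law_number : P.map (fun ω => (I ω).1) = p.toMeasure
  position_mem : ∀ ω k n, (I ω).2 k n ∈ Set.Ico (j : ℝ) (j + 1)
  law_motion : ∀ n, P.map (fun ω => M ω n) = ν
  indep_motion : iIndepFun (fun n ω => M ω n) P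
  indep : IndepFun I M P

/-- The moment `E θ ^ l`, where `θ` has distribution `p`. -/
noncomputable def momentNumber (p : PMF ℕ) (l : ℕ) : ℝ := ∫ k : ℕ, (k : ℝ) ^ l ∂p.toMeasure

lemma momentNumber_nonneg (p : PMF ℕ) (l : ℕ) : 0 ≤ momentNumber p l :=
  integral_nonneg fun _ => by positivity

lemma momentNumber_one (p : PMF ℕ) : momentNumber p 1 = meanNumber p := by
  simp [momentNumber, meanNumber]

lemma integrable_pow_number {p : PMF ℕ} (h3 : Integrable (fun k : ℕ => (k : ℝ) ^ 3) p.toMeasure)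
    {l : ℕ} (hl : l ≤ 3) : Integrable (fun k : ℕ => (k : ℝ) ^ l) p.toMeasure := by
  refine (h3.add (integrable_const 1)).mono' (by fun_prop) (ae_of_all _ fun k => ?_)
  rw [Real.norm_of_nonneg (by positivity)]
  rcases Nat.eq_zero_or_pos k with rfl | hk
  · rcases Nat.eq_zero_or_pos l with rfl | h <;> simp_all [Nat.pos_iff_ne_zero]
  · exact (pow_le_pow_right₀ (by exact_mod_cast hk) hl).trans (by simp)

lemma varNumber_eq_momentNumber {p : PMF ℕ}
    (h3 : Integrable (fun k : ℕ => (k : ℝ) ^ 3) p.toMeasure) :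
    varNumber p = momentNumber p 2 - meanNumber p ^ 2 := by
  have h : MemLp (fun k : ℕ => (k : ℝ)) 2 p.toMeasure :=
    (memLp_two_iff_integrable_sq (by fun_prop)).2 (integrable_pow_number h3 (by norm_num))
  rw [varNumber, variance_eq_sub h]
  rfl

namespace IsCluster

variable {Ω : Type*} [MeasurableSpace Ω] {P : Measure Ω} {j : ℤ} {p : PMF ℕ} {ν : Measure ℝ}
  {I : Ω → ℕ × ((k : ℕ) → Fin k → ℝ)} {M : Ω → ℕ → ℝ} {f : ℝ → ℝ} {T C R δ u : ℝ}

lemma measurable_clusterSum (h : IsCluster j p ν I M P) (T : ℝ) (hf : Measurable f) :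
    Measurable fun ω => clusterSum T f (I ω) (M ω) :=
  (DensityProcess.measurable_clusterSum T hf).comp (h.measurable_initial.prodMk h.measurable_motion)

lemma measurable_clusterSum_zero (h : IsCluster j p ν I M P) (T : ℝ) (hf : Measurable f) :
    Measurable fun ω => clusterSum T f (I ω) 0 :=
  (DensityProcess.measurable_clusterSum T hf).comp (h.measurable_initial.prodMk measurable_const)

lemma measurable_number (h : IsCluster j p ν I M P) : Measurable fun ω => (I ω).1 :=
  h.measurable_initial.fst

lemma integrable_number (h : IsCluster j p ν I M P)
    (h3 : Integrable (fun k : ℕ => (k : ℝ) ^ 3) p.toMeasure) {l : ℕ} (hl : l ≤ 3) :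
    Integrable (fun ω => ((I ω).1 : ℝ) ^ l) P := by
  have := integrable_pow_number h3 hl
  rw [← h.law_number] at this
  exact this.comp_measurable h.measurable_number

lemma integral_number (h : IsCluster j p ν I M P) (l : ℕ) :
    ∫ ω, ((I ω).1 : ℝ) ^ l ∂P = momentNumber p l := by
  rw [momentNumber, ← h.law_number, integral_map h.measurable_number.aemeasurable (by fun_prop)]

lemma integral_comp_motion (h : IsCluster j p ν I M P) (hf : Measurable f) (x : ℝ) (n : ℕ) :
    ∫ ω, f (x + M ω n) ∂P = transition ν f x := by
  rw [transition, ← h.law_motion n, integral_map]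
  · exact ((measurable_pi_apply n).comp h.measurable_motion).aemeasurable
  · exact (hf.comp (measurable_const_add x)).aestronglyMeasurable

lemma abs_position_div_sub_le (h : IsCluster j p ν I M P) (hT : 0 < T) (hu : ⌊T * u⌋ = j) (ω : Ω)
    (k : ℕ) (n : Fin k) : |(I ω).2 k n / T - u| ≤ 1 / T := by
  have h1 := h.position_mem ω k n
  have h2 := Int.floor_le (T * u)
  have h2' := Int.lt_floor_add_one (T * u)
  rw [hu] at h2 h2'
  have h4 : (I ω).2 k n / T - u = ((I ω).2 k n - T * u) / T := by field_simp
  rw [h4, abs_div, abs_of_pos hT]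
  refine div_le_div_of_nonneg_right (abs_le.2 ⟨?_, ?_⟩) hT.le <;> linarith [h1.1, h1.2]

lemma abs_clusterSum_zero_sub_le (h : IsCluster j p ν I M P) {ε : ℝ} (hT : 0 < T)
    (hu : ⌊T * u⌋ = j) (hε : ∀ x, |x - u| ≤ 1 / T → |f x - f u| ≤ ε) (ω : Ω) :
    |clusterSum T f (I ω) 0 - (I ω).1 * f u| ≤ ε * (I ω).1 := by
  have : clusterSum T f (I ω) 0 - (I ω).1 * f u
      = ∑ n : Fin (I ω).1, (f ((I ω).2 (I ω).1 n / T) - f u) := by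
    simp [clusterSum, Finset.sum_sub_distrib]
  rw [this]
  refine (Finset.abs_sum_le_sum_abs _ _).trans ((Finset.sum_le_sum fun n _ =>
    hε _ (h.abs_position_div_sub_le hT hu ω _ n)).trans ?_)
  simp [mul_comm]

lemma integrable_of_abs_le_pow (h : IsCluster j p ν I M P)
    (h3 : Integrable (fun k : ℕ => (k : ℝ) ^ 3) p.toMeasure) {l : ℕ} (hl : l ≤ 3) {F : Ω → ℝ}
    (hF : Measurable F) (hFC : ∀ ω, |F ω| ≤ C * ((I ω).1 : ℝ) ^ l) : Integrable F P :=
  ((h.integrable_number h3 hl).const_mul C).mono' hF.aestronglyMeasurable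
    (ae_of_all _ fun ω => hFC ω)

lemma integrable_clusterSum_pow (h : IsCluster j p ν I M P)
    (h3 : Integrable (fun k : ℕ => (k : ℝ) ^ 3) p.toMeasure) (hf : IsBddIntegrable f)
    (T : ℝ) {l : ℕ} (hl : l ≤ 3) : Integrable (fun ω => clusterSum T f (I ω) (M ω) ^ l) P := by
  obtain ⟨C, hC0, hC⟩ := hf.exists_bound_nonneg
  refine h.integrable_of_abs_le_pow h3 hl (C := C ^ l)
    ((h.measurable_clusterSum T hf.measurable).pow_const l) fun ω => ?_
  rw [abs_pow]
  exact abs_clusterSum_pow_le hC l T _ _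

lemma integrable_clusterSum (h : IsCluster j p ν I M P)
    (h3 : Integrable (fun k : ℕ => (k : ℝ) ^ 3) p.toMeasure) (hf : IsBddIntegrable f)
    (T : ℝ) : Integrable (fun ω => clusterSum T f (I ω) (M ω)) P := by
  simpa using h.integrable_clusterSum_pow h3 hf T (l := 1) (by norm_num)

lemma integrable_clusterSum_zero_pow (h : IsCluster j p ν I M P)
    (h3 : Integrable (fun k : ℕ => (k : ℝ) ^ 3) p.toMeasure) (hf : IsBddIntegrable f)
    (T : ℝ) {l : ℕ} (hl : l ≤ 3) : Integrable (fun ω => clusterSum T f (I ω) 0 ^ l) P := by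
  obtain ⟨C, hC0, hC⟩ := hf.exists_bound_nonneg
  refine h.integrable_of_abs_le_pow h3 hl (C := C ^ l)
    ((h.measurable_clusterSum_zero T hf.measurable).pow_const l) fun ω => ?_
  rw [abs_pow]
  exact abs_clusterSum_pow_le hC l T _ _

lemma integrable_clusterSum_zero (h : IsCluster j p ν I M P)
    (h3 : Integrable (fun k : ℕ => (k : ℝ) ^ 3) p.toMeasure) (hf : IsBddIntegrable f)
    (T : ℝ) : Integrable (fun ω => clusterSum T f (I ω) 0) P := by
  simpa using h.integrable_clusterSum_zero_pow h3 hf T (l := 1) (by norm_num)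

lemma integrable_number_pow_mul_clusterSum (h : IsCluster j p ν I M P)
    (h3 : Integrable (fun k : ℕ => (k : ℝ) ^ 3) p.toMeasure) (hf : IsBddIntegrable f)
    (T : ℝ) {l : ℕ} (hl : l ≤ 2) :
    Integrable (fun ω => ((I ω).1 : ℝ) ^ l * clusterSum T f (I ω) (M ω)) P := by
  obtain ⟨C, hC0, hC⟩ := hf.exists_bound_nonneg
  refine h.integrable_of_abs_le_pow h3 (Nat.succ_le_succ hl) (C := C) ?_ fun ω => ?_
  · exact ((measurable_of_countable fun k : ℕ => (k : ℝ) ^ l).comp h.measurable_number).mul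
      (h.measurable_clusterSum T hf.measurable)
  · rw [abs_mul, abs_of_nonneg (by positivity), pow_succ]
    have := mul_le_mul_of_nonneg_left (abs_clusterSum_le T hC (I ω) (M ω))
      (by positivity : (0 : ℝ) ≤ ((I ω).1 : ℝ) ^ l)
    linarith

lemma abs_integral_clusterSum_zero_sub_le (h : IsCluster j p ν I M P)
    (h3 : Integrable (fun k : ℕ => (k : ℝ) ^ 3) p.toMeasure) (hf : IsBddIntegrable f)
    {ε : ℝ} (hT : 0 < T)
    (hu : ⌊T * u⌋ = j) (hε : ∀ x, |x - u| ≤ 1 / T → |f x - f u| ≤ ε) :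
    |∫ ω, clusterSum T f (I ω) 0 ∂P - momentNumber p 1 * f u| ≤ ε * momentNumber p 1 := by
  have h1 := h.integrable_number h3 (l := 1) (by norm_num)
  rw [← h.integral_number, ← integral_mul_const, ← integral_sub
    (h.integrable_clusterSum_zero h3 hf T) (h1.mul_const _), ← integral_const_mul]
  refine (abs_integral_le_integral_abs).trans (integral_mono_of_nonneg
    (ae_of_all _ fun ω => abs_nonneg _) (h1.const_mul ε) (ae_of_all _ fun ω => ?_))
  simpa using h.abs_clusterSum_zero_sub_le hT hu hε ω

lemma abs_integral_clusterSum_zero_sq_sub_le (h : IsCluster j p ν I M P)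
    (h3 : Integrable (fun k : ℕ => (k : ℝ) ^ 3) p.toMeasure) (hf : IsBddIntegrable f)
    (hC : ∀ x, |f x| ≤ C) {ε : ℝ} (hT : 0 < T)
    (hu : ⌊T * u⌋ = j) (hε : ∀ x, |x - u| ≤ 1 / T → |f x - f u| ≤ ε) :
    |∫ ω, clusterSum T f (I ω) 0 ^ 2 ∂P - momentNumber p 2 * f u ^ 2|
      ≤ ε * (2 * C * momentNumber p 2) := by
  have h1 := h.integrable_number h3 (l := 2) (by norm_num)
  rw [← h.integral_number, ← integral_mul_const, ← integral_sub
    (h.integrable_clusterSum_zero_pow h3 hf T (by norm_num)) (h1.mul_const _),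
    ← integral_const_mul, ← integral_const_mul]
  refine (abs_integral_le_integral_abs).trans (integral_mono_of_nonneg
    (ae_of_all _ fun ω => abs_nonneg _) ((h1.const_mul _).const_mul ε) (ae_of_all _ fun ω => ?_))
  have ha := h.abs_clusterSum_zero_sub_le hT hu hε ω
  have hb : |clusterSum T f (I ω) 0 + (I ω).1 * f u| ≤ 2 * C * (I ω).1 := by
    refine (abs_add_le _ _).trans ?_
    have h5 := abs_clusterSum_le T hC (I ω) 0
    have h6 : |((I ω).1 : ℝ) * f u| ≤ (I ω).1 * C := by
      rw [abs_mul, Nat.abs_cast]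
      exact mul_le_mul_of_nonneg_left (hC u) (Nat.cast_nonneg _)
    linarith
  have hm := mul_le_mul ha hb (abs_nonneg _) ((abs_nonneg _).trans ha)
  rw [← abs_mul] at hm
  calc |clusterSum T f (I ω) 0 ^ 2 - ((I ω).1 : ℝ) ^ 2 * f u ^ 2|
      = |(clusterSum T f (I ω) 0 - (I ω).1 * f u) * (clusterSum T f (I ω) 0 + (I ω).1 * f u)| := by
        congr 1; ring
    _ ≤ _ := hm.trans_eq (by ring)

variable [IsProbabilityMeasure P]

lemma memLp_comp_motion (h : IsCluster j p ν I M P) (hf : IsBddIntegrable f) (x : ℝ) (n : ℕ) :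
    MemLp (fun ω => f (x + M ω n)) 2 P := by
  obtain ⟨C, hC⟩ := hf.bounded
  refine MemLp.of_bound (hf.measurable.comp ?_).aestronglyMeasurable C (ae_of_all _ fun ω => hC _)
  exact ((measurable_pi_apply n).comp h.measurable_motion).const_add x

lemma integral_clusterSum_motion (h : IsCluster j p ν I M P) (hf : IsBddIntegrable f)
    (T : ℝ) (i : ℕ × ((k : ℕ) → Fin k → ℝ)) :
    ∫ ω, clusterSum T f i (M ω) ∂P = clusterSum T (transition ν f) i 0 := by
  simp only [clusterSum]
  rw [integral_finsetSum (f := fun (n : Fin i.1) ω => f (i.2 i.1 n / T + M ω n)) _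
    fun n _ => (h.memLp_comp_motion hf _ n).integrable (by norm_num)]
  simp [h.integral_comp_motion hf.measurable]

/-- Conditionally on the initial data the particles of a cluster are independent, so that the
second moment of the cluster is the sum of the variances plus the square of the mean. -/
lemma integral_clusterSum_motion_sq (h : IsCluster j p ν I M P) (hf : IsBddIntegrable f)
    (T : ℝ) (i : ℕ × ((k : ℕ) → Fin k → ℝ)) :
    ∫ ω, clusterSum T f i (M ω) ^ 2 ∂P
      = clusterSum T (transition ν fun x => f x ^ 2) i 0
        - clusterSum T (fun x => transition ν f x ^ 2) i 0
        + clusterSum T (transition ν f) i 0 ^ 2 := by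
  let X : Fin i.1 → Ω → ℝ := fun n ω => f (i.2 i.1 n / T + M ω n)
  have hX : ∀ n, MemLp (X n) 2 P := fun n => h.memLp_comp_motion hf _ n
  have hsum : (fun ω => clusterSum T f i (M ω)) = ∑ n, X n := by
    ext ω
    simp [clusterSum, X]
  have hvar : Var[∑ n, X n; P] = ∑ n, Var[X n; P] := by
    refine IndepFun.variance_sum (fun n _ => hX n) fun n _ m _ hnm => ?_
    have := h.indep_motion.indepFun (i := (n : ℕ)) (j := (m : ℕ)) (by simpa [Fin.ext_iff] using hnm)
    exact this.comp (φ := fun y => f (i.2 i.1 n / T + y)) (ψ := fun y => f (i.2 i.1 m / T + y))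
      (hf.measurable.comp (measurable_const_add _)) (hf.measurable.comp (measurable_const_add _))
  have h2 : ∀ n, Var[X n; P] = transition ν (fun x => f x ^ 2) (i.2 i.1 n / T)
      - transition ν f (i.2 i.1 n / T) ^ 2 := by
    intro n
    rw [variance_eq_sub (hX n)]
    congr 1
    · exact h.integral_comp_motion (f := fun x => f x ^ 2) (hf.measurable.pow_const 2) _ n
    · rw [h.integral_comp_motion hf.measurable]
  have hS : MemLp (∑ n, X n) 2 P := by
    have := memLp_finsetSum' Finset.univ (f := X) fun n _ => hX n
    exact this
  have h3 := variance_eq_sub hS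
  rw [hvar] at h3
  simp_rw [h2, ← hsum, h.integral_clusterSum_motion hf] at h3
  have h4 : ∫ ω, clusterSum T f i (M ω) ^ 2 ∂P
      = ∫ ω, ((fun ω => clusterSum T f i (M ω)) ^ 2) ω ∂P := rfl
  rw [h4, ← sub_eq_iff_eq_add, ← h3]
  simp [clusterSum, Finset.sum_sub_distrib]

lemma integral_number_pow_mul_clusterSum (h : IsCluster j p ν I M P)
    (h3 : Integrable (fun k : ℕ => (k : ℝ) ^ 3) p.toMeasure) (hf : IsBddIntegrable f)
    (T : ℝ) {l : ℕ} (hl : l ≤ 2) :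
    ∫ ω, ((I ω).1 : ℝ) ^ l * clusterSum T f (I ω) (M ω) ∂P
      = ∫ ω, ((I ω).1 : ℝ) ^ l * clusterSum T (transition ν f) (I ω) 0 ∂P := by
  have hF : Measurable fun q : (ℕ × ((k : ℕ) → Fin k → ℝ)) × (ℕ → ℝ) =>
      (q.1.1 : ℝ) ^ l * clusterSum T f q.1 q.2 :=
    ((measurable_of_countable fun k : ℕ => (k : ℝ) ^ l).comp measurable_fst.fst).mul
      (DensityProcess.measurable_clusterSum T hf.measurable)
  rw [integral_comp_prodMk_of_indepFun h.measurable_initial h.measurable_motion h.indep hF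
    (h.integrable_number_pow_mul_clusterSum h3 hf T hl)]
  simp only [integral_const_mul, h.integral_clusterSum_motion hf]

lemma integral_clusterSum (h : IsCluster j p ν I M P)
    (h3 : Integrable (fun k : ℕ => (k : ℝ) ^ 3) p.toMeasure) (hf : IsBddIntegrable f)
    (T : ℝ) :
    ∫ ω, clusterSum T f (I ω) (M ω) ∂P = ∫ ω, clusterSum T (transition ν f) (I ω) 0 ∂P := by
  simpa using h.integral_number_pow_mul_clusterSum h3 hf T (l := 0) (by norm_num)

variable [IsProbabilityMeasure ν]

lemma integral_clusterSum_sq (h : IsCluster j p ν I M P)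
    (h3 : Integrable (fun k : ℕ => (k : ℝ) ^ 3) p.toMeasure) (hf : IsBddIntegrable f)
    (T : ℝ) :
    ∫ ω, clusterSum T f (I ω) (M ω) ^ 2 ∂P
      = (∫ ω, clusterSum T (transition ν fun x => f x ^ 2) (I ω) 0 ∂P)
        - (∫ ω, clusterSum T (fun x => transition ν f x ^ 2) (I ω) 0 ∂P)
        + ∫ ω, clusterSum T (transition ν f) (I ω) 0 ^ 2 ∂P := by
  have hf2 : IsBddIntegrable fun x => f x ^ 2 := by simpa [sq] using hf.mul hf
  have hg2 : IsBddIntegrable fun x => transition ν f x ^ 2 := by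
    simpa [sq] using hf.transition.mul hf.transition
  have hF : Measurable fun q : (ℕ × ((k : ℕ) → Fin k → ℝ)) × (ℕ → ℝ) =>
      clusterSum T f q.1 q.2 ^ 2 :=
    (DensityProcess.measurable_clusterSum T hf.measurable).pow_const 2
  rw [integral_comp_prodMk_of_indepFun h.measurable_initial h.measurable_motion h.indep hF
    (h.integrable_clusterSum_pow h3 hf T (by norm_num))]
  simp only [h.integral_clusterSum_motion_sq hf]
  have h1 := h.integrable_clusterSum_zero h3 (hf2.transition (ν := ν)) T
  have h2 := h.integrable_clusterSum_zero h3 hg2 T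
  rw [← integral_sub h1 h2, ← integral_add]
  · exact h1.sub h2
  · exact h.integrable_clusterSum_zero_pow h3 hf.transition T (by norm_num)

/-- The moments of the contribution of the integer `⌊T u⌋` are dominated, uniformly in large `T`,
by an integrable function of `u`. -/
lemma integral_abs_clusterSum_pow_le (h : IsCluster j p ν I M P)
    (h3 : Integrable (fun k : ℕ => (k : ℝ) ^ 3) p.toMeasure) (hf : IsBddIntegrable f)
    (hC0 : 0 ≤ C) (hC : ∀ x, |f x| ≤ C) (hR : ∀ x, R < |x| → f x = 0) (hT : 0 < T)
    (hδ : 1 / T ≤ δ) (hu : ⌊T * u⌋ = j) {l : ℕ} (hl : l ≤ 2) :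
    ∫ ω, |clusterSum T f (I ω) (M ω)| ^ (l + 1) ∂P
      ≤ C ^ (l + 1) * momentNumber p (l + 1) * ballProb ν (R + δ) u := by
  have hfa : IsBddIntegrable fun x => |f x| :=
    ⟨hf.measurable.abs, ⟨C, by simpa using hC⟩, hf.integrable.abs⟩
  have hint := h.integrable_number_pow_mul_clusterSum h3 hfa T hl
  have hle : ∀ ω, |clusterSum T f (I ω) (M ω)| ^ (l + 1)
      ≤ C ^ l * (((I ω).1 : ℝ) ^ l * clusterSum T (fun x => |f x|) (I ω) (M ω)) := by
    intro ω
    rw [pow_succ, ← mul_assoc]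
    exact mul_le_mul (abs_clusterSum_pow_le hC l T _ _)
      (abs_clusterSum_le_clusterSum_abs T f _ _) (abs_nonneg _) (by positivity)
  have hb : ∀ ω, clusterSum T (transition ν fun x => |f x|) (I ω) 0
      ≤ ((I ω).1 : ℝ) * (C * ballProb ν (R + δ) u) := by
    intro ω
    refine (Finset.sum_le_card_nsmul _ _ (C * ballProb ν (R + δ) u) fun n _ => ?_).trans_eq ?_
    · exact transition_abs_le_ballProb hf hC0 hC hR (by
        simpa using (h.abs_position_div_sub_le hT hu ω _ n).trans hδ)
    · simp
  calc ∫ ω, |clusterSum T f (I ω) (M ω)| ^ (l + 1) ∂P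
      ≤ ∫ ω, C ^ l * (((I ω).1 : ℝ) ^ l * clusterSum T (fun x => |f x|) (I ω) (M ω)) ∂P :=
        integral_mono_of_nonneg (ae_of_all _ fun ω => by positivity) (hint.const_mul _)
          (ae_of_all _ hle)
    _ = C ^ l * ∫ ω, ((I ω).1 : ℝ) ^ l * clusterSum T (transition ν fun x => |f x|) (I ω) 0 ∂P := by
        rw [integral_const_mul, h.integral_number_pow_mul_clusterSum h3 hfa T hl]
    _ ≤ C ^ l * ∫ ω, ((I ω).1 : ℝ) ^ (l + 1) * (C * ballProb ν (R + δ) u) ∂P := by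
        refine mul_le_mul_of_nonneg_left (integral_mono_of_nonneg (ae_of_all _ fun ω => ?_)
          ((h.integrable_number h3 (Nat.succ_le_succ hl)).mul_const _)
          (ae_of_all _ fun ω => ?_)) (by positivity)
        · refine mul_nonneg (by positivity) (Finset.sum_nonneg fun n _ => ?_)
          exact integral_nonneg fun y => abs_nonneg _
        · simp only [pow_succ, mul_assoc]
          exact mul_le_mul_of_nonneg_left (hb ω) (by positivity)
    _ = C ^ (l + 1) * momentNumber p (l + 1) * ballProb ν (R + δ) u := by
        rw [integral_mul_const, h.integral_number]
        ring

end IsCluster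

/-! ### The central limit theorem -/

/-- A series over the integers as the integral of a step function with steps of length `1 / T`. -/
lemma hasSum_div_integral_floor {a : ℤ → ℝ} {b : ℝ → ℝ} {T : ℝ} (hT : 0 < T) (hb : Integrable b)
    (hab : ∀ u, |a ⌊T * u⌋| ≤ b u) : HasSum (fun j => a j / T) (∫ u, a ⌊T * u⌋) := by
  have hfl : Measurable fun u : ℝ => ⌊T * u⌋ := Int.measurable_floor.comp (measurable_const_mul T)
  have hm : ∀ j : ℤ, MeasurableSet ((fun u : ℝ => ⌊T * u⌋) ⁻¹' {j}) :=
    fun j => hfl (measurableSet_singleton j)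
  have hU : (⋃ j : ℤ, (fun u : ℝ => ⌊T * u⌋) ⁻¹' {j}) = Set.univ := by
    ext u
    simp
  have hint : Integrable fun u => a ⌊T * u⌋ :=
    hb.mono' ((measurable_of_countable a).comp hfl).aestronglyMeasurable (ae_of_all _ hab)
  have h := hasSum_integral_iUnion hm (fun i j hij => by
    refine Set.disjoint_left.2 fun u hu hu' => hij ?_
    exact (Set.mem_singleton_iff.1 hu).symm.trans hu') (f := fun u => a ⌊T * u⌋) (μ := volume)
    (by rw [hU]; exact hint.integrableOn)
  rw [hU, setIntegral_univ] at h
  refine h.congr_fun fun j => ?_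
  have hset : (fun u : ℝ => ⌊T * u⌋) ⁻¹' {j} = Set.Ico ((j : ℝ) / T) ((j + 1) / T) := by
    ext u
    simp only [Set.mem_preimage, Set.mem_singleton_iff, Int.floor_eq_iff, Set.mem_Ico,
      div_le_iff₀ hT, lt_div_iff₀ hT, mul_comm u T]
  rw [setIntegral_congr_fun (hm j) (g := fun _ => a j) fun u hu => congrArg a hu]
  rw [setIntegral_const, hset, Real.volume_real_Ico_of_le (by gcongr; linarith), smul_eq_mul]
  ring

lemma tendsto_of_abs_sub_le {F : ℝ → ℝ} {c K : ℝ} (hK : 0 ≤ K)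
    (h : ∀ ε > 0, ∀ᶠ T in atTop, |F T - c| ≤ ε * K) : Tendsto F atTop (𝓝 c) := by
  refine Metric.tendsto_nhds.2 fun ε hε => ?_
  filter_upwards [h (ε / (K + 1)) (by positivity)] with T hT
  rw [Real.dist_eq]
  refine hT.trans_lt ?_
  rw [div_mul_eq_mul_div, div_lt_iff₀ (by positivity)]
  nlinarith

lemma eventually_abs_sub_le_of_continuousAt {g : ℝ → ℝ} {u : ℝ} (hg : ContinuousAt g u) {ε : ℝ}
    (hε : 0 < ε) : ∀ᶠ T : ℝ in atTop, 0 < T ∧ ∀ x, |x - u| ≤ 1 / T → |g x - g u| ≤ ε := by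
  obtain ⟨δ, hδ, h⟩ := Metric.continuousAt_iff.1 hg ε hε
  have h1 : Tendsto (fun T : ℝ => 1 / T) atTop (𝓝 0) := by
    simpa using tendsto_inv_atTop_zero (𝕜 := ℝ)
  filter_upwards [eventually_gt_atTop 0, h1.eventually (gt_mem_nhds hδ)] with T hT hTδ
  exact ⟨hT, fun x hx => (h (hx.trans_lt hTδ)).le⟩

section Asymptotics

variable {Ω : Type*} [MeasurableSpace Ω] {P : Measure Ω} {p : PMF ℕ} {ν : Measure ℝ}
  {I : ℤ → Ω → ℕ × ((k : ℕ) → Fin k → ℝ)} {M : ℤ → Ω → ℕ → ℝ} {f : ℝ → ℝ} {T C R δ u : ℝ}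

lemma tendsto_integral_clusterSum_zero (hcl : ∀ j, IsCluster j p ν (I j) (M j) P)
    (h3 : Integrable (fun k : ℕ => (k : ℝ) ^ 3) p.toMeasure) (hf : IsBddIntegrable f)
    (hu : ContinuousAt f u) :
    Tendsto (fun T => ∫ ω, clusterSum T f (I ⌊T * u⌋ ω) 0 ∂P) atTop
      (𝓝 (momentNumber p 1 * f u)) := by
  refine tendsto_of_abs_sub_le (momentNumber_nonneg p 1) fun ε hε => ?_
  filter_upwards [eventually_abs_sub_le_of_continuousAt hu hε] with T hT
  exact (hcl _).abs_integral_clusterSum_zero_sub_le h3 hf hT.1 rfl hT.2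

lemma tendsto_integral_clusterSum_zero_sq (hcl : ∀ j, IsCluster j p ν (I j) (M j) P)
    (h3 : Integrable (fun k : ℕ => (k : ℝ) ^ 3) p.toMeasure) (hf : IsBddIntegrable f)
    (hu : ContinuousAt f u) :
    Tendsto (fun T => ∫ ω, clusterSum T f (I ⌊T * u⌋ ω) 0 ^ 2 ∂P) atTop
      (𝓝 (momentNumber p 2 * f u ^ 2)) := by
  obtain ⟨C, hC0, hC⟩ := hf.exists_bound_nonneg
  have := momentNumber_nonneg p 2
  refine tendsto_of_abs_sub_le (K := 2 * C * momentNumber p 2) (by positivity) fun ε hε => ?_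
  filter_upwards [eventually_abs_sub_le_of_continuousAt hu hε] with T hT
  exact (hcl _).abs_integral_clusterSum_zero_sq_sub_le h3 hf hC hT.1 rfl hT.2

lemma IsCluster.memLp_clusterSum {j : ℤ} {I : Ω → ℕ × ((k : ℕ) → Fin k → ℝ)} {M : Ω → ℕ → ℝ}
    (h : IsCluster j p ν I M P)
    (h3 : Integrable (fun k : ℕ => (k : ℝ) ^ 3) p.toMeasure) (hf : IsBddIntegrable f)
    (T : ℝ) : MemLp (fun ω => clusterSum T f (I ω) (M ω)) 3 P := by
  refine (integrable_norm_rpow_iff (h.measurable_clusterSum T hf.measurable).aestronglyMeasurable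
    (by norm_num) (by norm_num)).1 ?_
  simpa [← abs_pow] using (h.integrable_clusterSum_pow h3 hf T (l := 3) le_rfl).abs

variable [IsProbabilityMeasure P] [IsProbabilityMeasure ν]

lemma summable_integral_abs_clusterSum (hcl : ∀ j, IsCluster j p ν (I j) (M j) P)
    (h3 : Integrable (fun k : ℕ => (k : ℝ) ^ 3) p.toMeasure) (hf : IsTestFunction f)
    (hT : 0 < T) : Summable fun j => ∫ ω, |clusterSum T f (I j ω) (M j ω)| ∂P := by
  obtain ⟨C, hC0, hC⟩ := hf.isBddIntegrable.exists_bound_nonneg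
  obtain ⟨R, hR⟩ := hf.exists_support_bound
  have h := hasSum_div_integral_floor (a := fun j => ∫ ω, |clusterSum T f (I j ω) (M j ω)| ∂P) hT
    ((integrable_ballProb (ν := ν) (R + 1 / T)).const_mul (C * momentNumber p 1)) fun u => by
      rw [abs_of_nonneg (integral_nonneg fun ω => abs_nonneg _)]
      simpa using (hcl _).integral_abs_clusterSum_pow_le h3 hf.isBddIntegrable hC0 hC hR hT le_rfl
        rfl (l := 0) (by norm_num)
  simpa [div_mul_cancel₀ _ hT.ne'] using h.summable.mul_right T

/-- The sum of the variances of the contributions, divided by `T`, converges to the limit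
covariance. -/
lemma tendsto_integral_variance_clusterSum [NullSingletonClass ν]
    (hcl : ∀ j, IsCluster j p ν (I j) (M j) P)
    (h3 : Integrable (fun k : ℕ => (k : ℝ) ^ 3) p.toMeasure) (hf : IsTestFunction f) :
    Tendsto (fun T => ∫ u, ((∫ ω, clusterSum T f (I ⌊T * u⌋ ω) (M ⌊T * u⌋ ω) ^ 2 ∂P)
        - (∫ ω, clusterSum T f (I ⌊T * u⌋ ω) (M ⌊T * u⌋ ω) ∂P) ^ 2)) atTop
      (𝓝 (transitionCov p ν f f)) := by
  have hf' := hf.isBddIntegrable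
  obtain ⟨C, hC0, hC⟩ := hf'.exists_bound_nonneg
  obtain ⟨R, hR⟩ := hf.exists_support_bound
  have hff : IsTestFunction fun x => f x ^ 2 := by simpa [sq] using hf.mul hf
  have hg2 : IsBddIntegrable fun x => transition ν f x ^ 2 := by
    simpa [sq] using hf'.transition.mul hf'.transition
  -- the integrand is the pointwise limit of the variances at `⌊T * u⌋`
  have hlim : transitionCov p ν f f
      = ∫ u, (momentNumber p 1 * transition ν (fun x => f x ^ 2) u
          - momentNumber p 1 * transition ν f u ^ 2 + momentNumber p 2 * transition ν f u ^ 2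
          - (momentNumber p 1 * transition ν f u) ^ 2) := by
    have h1 : ∀ u, momentNumber p 1 * transition ν (fun x => f x ^ 2) u
          - momentNumber p 1 * transition ν f u ^ 2 + momentNumber p 2 * transition ν f u ^ 2
          - (momentNumber p 1 * transition ν f u) ^ 2
        = meanNumber p * transition ν (fun x => f x ^ 2) u
          + (varNumber p - meanNumber p) * transition ν f u ^ 2 := by
      intro u
      rw [varNumber_eq_momentNumber h3, momentNumber_one]
      ring
    simp_rw [h1]
    rw [integral_add (hff.isBddIntegrable.transition.integrable.const_mul _)
      (hg2.integrable.const_mul _), integral_const_mul, integral_const_mul,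
      integral_transition hff.isBddIntegrable, transitionCov]
    simp only [sq]
  rw [hlim]
  refine tendsto_integral_filter_of_dominated_convergence
    (fun u => C ^ 2 * momentNumber p 2 * ballProb ν (R + 1) u) ?_ ?_
    ((integrable_ballProb _).const_mul _) (ae_of_all _ fun u => ?_)
  · refine Eventually.of_forall fun T => ?_
    exact ((measurable_of_countable fun j : ℤ => (∫ ω, clusterSum T f (I j ω) (M j ω) ^ 2 ∂P)
        - (∫ ω, clusterSum T f (I j ω) (M j ω) ∂P) ^ 2).comp
      (Int.measurable_floor.comp (measurable_const_mul T))).aestronglyMeasurable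
  · filter_upwards [eventually_ge_atTop 1] with T hT
    refine ae_of_all _ fun u => ?_
    have hT0 : 0 < T := zero_lt_one.trans_le hT
    have hm := (hcl ⌊T * u⌋).memLp_clusterSum h3 hf' T
    have hv := variance_eq_sub (hm.mono_exponent (by norm_num : (2 : ENNReal) ≤ 3))
    have hb := (hcl ⌊T * u⌋).integral_abs_clusterSum_pow_le h3 hf' hC0 hC hR hT0
      (δ := 1) ((div_le_one hT0).2 hT) rfl (l := 1) (by norm_num)
    have hv0 := variance_nonneg (fun ω => clusterSum T f (I ⌊T * u⌋ ω) (M ⌊T * u⌋ ω)) P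
    simp only [Pi.pow_apply] at hv
    simp only [Nat.reduceAdd, sq_abs] at hb
    rw [← hv, Real.norm_of_nonneg hv0, hv]
    nlinarith [sq_nonneg (∫ ω, clusterSum T f (I ⌊T * u⌋ ω) (M ⌊T * u⌋ ω) ∂P)]
  · have hc := hf.continuous_transition (ν := ν)
    have t1 := tendsto_integral_clusterSum_zero hcl h3 (hff.isBddIntegrable.transition (ν := ν))
      (u := u) hff.continuous_transition.continuousAt
    have t2 := tendsto_integral_clusterSum_zero hcl h3 hg2 (u := u) (hc.pow 2).continuousAt
    have t3 := tendsto_integral_clusterSum_zero_sq hcl h3 (hf'.transition (ν := ν)) (u := u)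
      hc.continuousAt
    have t4 := tendsto_integral_clusterSum_zero hcl h3 (hf'.transition (ν := ν)) (u := u)
      hc.continuousAt
    refine (((t1.sub t2).add t3).sub (t4.pow 2)).congr fun T => ?_
    rw [(hcl _).integral_clusterSum_sq h3 hf', (hcl _).integral_clusterSum h3 hf']

/-- Central limit theorem for the normalized sums of the contributions of all integers: the Lyapunov
ratio is of order `T ^ (-1 / 2)`. -/
lemma tendsto_integral_cexp_hasSum_clusterSum [NullSingletonClass ν]
    (hcl : ∀ j, IsCluster j p ν (I j) (M j) P)
    (hind : iIndepFun (fun j ω => (I j ω, M j ω)) P)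
    (h3 : Integrable (fun k : ℕ => (k : ℝ) ^ 3) p.toMeasure) (hf : IsTestFunction f)
    {Z : ℝ → Ω → ℝ}
    (hZ : ∀ T, 0 < T → ∀ᵐ ω ∂P, HasSum (fun j => (clusterSum T f (I j ω) (M j ω)
      - ∫ ω', clusterSum T f (I j ω') (M j ω') ∂P) / √T) (Z T ω)) :
    Tendsto (fun T => ∫ ω, Complex.exp (Z T ω * Complex.I) ∂P) atTop
      (𝓝 ((Real.exp (-transitionCov p ν f f / 2) : ℝ) : ℂ)) := by
  have hf' := hf.isBddIntegrable
  obtain ⟨C, hC0, hC⟩ := hf'.exists_bound_nonneg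
  obtain ⟨R, hR⟩ := hf.exists_support_bound
  let S : ℝ → ℤ → Ω → ℝ := fun T j ω => clusterSum T f (I j ω) (M j ω)
  let Y : ℝ → ℤ → Ω → ℝ := fun T j ω => (S T j ω - ∫ ω', S T j ω' ∂P) / √T
  let V : ℝ → ℝ := fun T => ∫ u, ((∫ ω, S T ⌊T * u⌋ ω ^ 2 ∂P) - (∫ ω, S T ⌊T * u⌋ ω ∂P) ^ 2)
  let B : ℝ := ∫ u, ballProb ν (R + 1) u
  let K : ℝ := 4 * (C ^ 3 * momentNumber p 3 + (C * momentNumber p 1) ^ 3)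
  have hm1 := momentNumber_nonneg p 1
  have hm2 := momentNumber_nonneg p 2
  have hm3 := momentNumber_nonneg p 3
  have hSm : ∀ T j, MemLp (S T j) 3 P := fun T j => (hcl j).memLp_clusterSum h3 hf' T
  have hSi : ∀ T j, Integrable (S T j) P := fun T j => (hcl j).integrable_clusterSum h3 hf' T
  have hY3 : ∀ T j, MemLp (Y T j) 3 P := fun T j =>
    (((hSm T j).sub (memLp_const _)).mul_const (√T)⁻¹)
  have hYind : ∀ T, iIndepFun (Y T) P := fun T =>
    hind.comp (fun j q => (clusterSum T f q.1 q.2 - ∫ ω', S T j ω' ∂P) / √T) fun j =>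
      ((measurable_clusterSum T hf.measurable).sub_const _).div_const _
  have hY0 : ∀ T j, ∫ ω, Y T j ω ∂P = 0 := fun T j => by
    simp only [Y]
    rw [integral_div, integral_sub (hSi T j) (integrable_const _)]
    simp
  have hYv : ∀ T, 0 < T → ∀ j, ∫ ω, Y T j ω ^ 2 ∂P
      = ((∫ ω, S T j ω ^ 2 ∂P) - (∫ ω, S T j ω ∂P) ^ 2) / T := fun T hT j => by
    have h1 := variance_eq_sub ((hSm T j).mono_exponent (by norm_num : (2 : ENNReal) ≤ 3))
    have h2 := variance_eq_integral (hSm T j).1.aemeasurable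
    simp only [Pi.pow_apply] at h1
    rw [← h1, h2, ← integral_div]
    simp only [Y, div_pow, Real.sq_sqrt hT.le]
  have hb2 : ∀ T, 1 ≤ T → ∀ u, ∫ ω, Y T ⌊T * u⌋ ω ^ 2 ∂P
      ≤ C ^ 2 * momentNumber p 2 * ballProb ν (R + 1) u / T := fun T hT u => by
    have hT0 : 0 < T := zero_lt_one.trans_le hT
    have hb := (hcl ⌊T * u⌋).integral_abs_clusterSum_pow_le h3 hf' hC0 hC hR hT0
      (δ := 1) ((div_le_one hT0).2 hT) rfl (l := 1) (by norm_num)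
    simp only [Nat.reduceAdd, sq_abs] at hb
    rw [hYv T hT0]
    refine div_le_div_of_nonneg_right ?_ hT0.le
    exact (sub_le_self _ (sq_nonneg _)).trans hb
  -- the uniform bound on the variances comes from `ballProb ≤ 1`, evaluated at `u = j / T`
  have hYε : ∀ T, 1 ≤ T → ∀ j, ∫ ω, Y T j ω ^ 2 ∂P ≤ C ^ 2 * momentNumber p 2 / T := by
    intro T hT j
    have hT0 : 0 < T := zero_lt_one.trans_le hT
    have hj : ⌊T * (j / T)⌋ = j := by
      rw [mul_div_cancel₀ _ hT0.ne']
      exact Int.floor_intCast j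
    have h1 := hb2 T hT (j / T)
    rw [hj] at h1
    refine h1.trans (div_le_div_of_nonneg_right ?_ hT0.le)
    exact mul_le_of_le_one_right (by positivity) (ballProb_le_one _ _)
  have hsum2 : ∀ T, 1 ≤ T → HasSum (fun j => ∫ ω, Y T j ω ^ 2 ∂P) (V T) := by
    intro T hT
    have hT0 : 0 < T := zero_lt_one.trans_le hT
    have h := hasSum_div_integral_floor
      (a := fun j => (∫ ω, S T j ω ^ 2 ∂P) - (∫ ω, S T j ω ∂P) ^ 2) hT0
      ((integrable_ballProb (ν := ν) (R + 1)).const_mul (C ^ 2 * momentNumber p 2)) fun u => by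
        have h1 := hb2 T hT u
        have h2 : 0 ≤ ∫ ω, Y T ⌊T * u⌋ ω ^ 2 ∂P := integral_nonneg fun ω => sq_nonneg _
        rw [hYv T hT0] at h1 h2
        rw [abs_of_nonneg (by simpa [hT0.ne'] using mul_nonneg h2 hT0.le)]
        exact (div_le_div_iff_of_pos_right hT0).1 h1
    exact h.congr_fun fun j => hYv T hT0 j
  have hb3 : ∀ T, 1 ≤ T → ∀ u, ∫ ω, |Y T ⌊T * u⌋ ω| ^ 3 ∂P
      ≤ K * ballProb ν (R + 1) u / √T ^ 3 := by
    intro T hT u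
    have hT0 : 0 < T := zero_lt_one.trans_le hT
    have hb0 := ballProb_nonneg ν (R + 1) u
    have hb := fun l hl => (hcl ⌊T * u⌋).integral_abs_clusterSum_pow_le h3 hf' hC0 hC hR hT0
      (δ := 1) ((div_le_one hT0).2 hT) rfl (l := l) hl
    have hb1 := hb 0 (by norm_num)
    have hb3 := hb 2 le_rfl
    simp only [zero_add, pow_one, Nat.reduceAdd] at hb1 hb3
    have he : |∫ ω, S T ⌊T * u⌋ ω ∂P| ^ 3 ≤ (C * momentNumber p 1) ^ 3 * ballProb ν (R + 1) u := by
      calc |∫ ω, S T ⌊T * u⌋ ω ∂P| ^ 3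
          ≤ (C * momentNumber p 1 * ballProb ν (R + 1) u) ^ 3 :=
            pow_le_pow_left₀ (abs_nonneg _) (abs_integral_le_integral_abs.trans hb1) 3
        _ = (C * momentNumber p 1) ^ 3 * ballProb ν (R + 1) u ^ 3 := by ring
        _ ≤ (C * momentNumber p 1) ^ 3 * ballProb ν (R + 1) u := by
            refine mul_le_mul_of_nonneg_left ?_ (by positivity)
            exact pow_le_of_le_one hb0 (ballProb_le_one _ _) (by norm_num)
    have hint : Integrable (fun ω => |S T ⌊T * u⌋ ω| ^ 3) P := by
      simpa [← abs_pow] using ((hcl ⌊T * u⌋).integrable_clusterSum_pow h3 hf' T le_rfl).abs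
    calc ∫ ω, |Y T ⌊T * u⌋ ω| ^ 3 ∂P
        ≤ ∫ ω, 4 * (|S T ⌊T * u⌋ ω| ^ 3 + |∫ ω', S T ⌊T * u⌋ ω' ∂P| ^ 3) / √T ^ 3 ∂P := by
          refine integral_mono_of_nonneg (ae_of_all _ fun ω => by positivity)
            (((hint.add (integrable_const _)).const_mul 4).div_const _)
            (ae_of_all _ fun ω => ?_)
          simp only [Y, abs_div, div_pow, abs_of_nonneg (Real.sqrt_nonneg T)]
          refine div_le_div_of_nonneg_right ?_ (by positivity)
          refine (pow_le_pow_left₀ (abs_nonneg _) (abs_sub _ _) 3).trans ?_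
          refine (add_pow_le (abs_nonneg _) (abs_nonneg _) 3).trans_eq (by norm_num)
      _ = 4 * ((∫ ω, |S T ⌊T * u⌋ ω| ^ 3 ∂P) + |∫ ω', S T ⌊T * u⌋ ω' ∂P| ^ 3) / √T ^ 3 := by
          rw [integral_div, integral_const_mul, integral_add hint (integrable_const _)]
          simp
      _ ≤ K * ballProb ν (R + 1) u / √T ^ 3 := by
          refine div_le_div_of_nonneg_right ?_ (by positivity)
          have : K * ballProb ν (R + 1) u = 4 * (C ^ 3 * momentNumber p 3 * ballProb ν (R + 1) u
              + (C * momentNumber p 1) ^ 3 * ballProb ν (R + 1) u) := by ring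
          rw [this]
          exact mul_le_mul_of_nonneg_left (add_le_add hb3 he) (by norm_num)
  -- a sum over the integers is `T` times an integral, so that the factor `√T ^ (-3)` yields
  -- `T ^ (-1 / 2)`
  have hsum3 : ∀ T, 1 ≤ T → (Summable fun j => ∫ ω, |Y T j ω| ^ 3 ∂P) ∧
      ∑' j, ∫ ω, |Y T j ω| ^ 3 ∂P ≤ K * B / √T := by
    intro T hT
    have hT0 : 0 < T := zero_lt_one.trans_le hT
    have hnn : ∀ u, 0 ≤ ∫ ω, |Y T ⌊T * u⌋ ω| ^ 3 ∂P :=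
      fun u => integral_nonneg fun ω => by positivity
    have hint := (((integrable_ballProb (ν := ν) (R + 1)).const_mul K).div_const (√T ^ 3))
    have h := (hasSum_div_integral_floor (a := fun j => ∫ ω, |Y T j ω| ^ 3 ∂P) hT0 hint fun u => by
      rw [abs_of_nonneg (hnn u)]
      exact hb3 T hT u).mul_right T
    simp only [div_mul_cancel₀ _ hT0.ne'] at h
    refine ⟨h.summable, h.tsum_eq.trans_le ?_⟩
    have h5 : ∫ u, ∫ ω, |Y T ⌊T * u⌋ ω| ^ 3 ∂P ≤ K * B / √T ^ 3 := by
      rw [← integral_const_mul, ← integral_div]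
      exact integral_mono_of_nonneg (ae_of_all _ hnn) hint (ae_of_all _ (hb3 T hT))
    refine (mul_le_mul_of_nonneg_right h5 hT0.le).trans_eq ?_
    have hs : √T ≠ 0 := (Real.sqrt_pos.2 hT0).ne'
    have hss : √T ^ 2 = T := Real.sq_sqrt hT0.le
    field_simp
    rw [hss]
  have hV : Tendsto V atTop (𝓝 (transitionCov p ν f f)) :=
    tendsto_integral_variance_clusterSum hcl h3 hf
  have hbound : ∀ T, 1 ≤ T → ‖∫ ω, Complex.exp (Z T ω * Complex.I) ∂P
      - ((Real.exp (-(V T) / 2) : ℝ) : ℂ)‖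
        ≤ 4 * (K * B / √T) + C ^ 2 * momentNumber p 2 / T * V T := by
    intro T hT
    have h := norm_integral_cexp_hasSum_sub_exp_le (hY3 T) (hYind T) (hY0 T)
      (hZ T (zero_lt_one.trans_le hT)) (hsum2 T hT).summable (hsum3 T hT).1 (hYε T hT)
    rw [(hsum2 T hT).tsum_eq] at h
    linarith [(hsum3 T hT).2]
  have hzero : Tendsto (fun T => 4 * (K * B / √T) + C ^ 2 * momentNumber p 2 / T * V T) atTop
      (𝓝 0) := by
    have h1 : Tendsto (fun T : ℝ => K * B / √T) atTop (𝓝 0) :=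
      tendsto_const_nhds.div_atTop Real.tendsto_sqrt_atTop
    have h2 : Tendsto (fun T : ℝ => C ^ 2 * momentNumber p 2 / T) atTop (𝓝 0) :=
      tendsto_const_nhds.div_atTop tendsto_id
    simpa using (h1.const_mul 4).add (h2.mul hV)
  have h1 : Tendsto (fun T => (∫ ω, Complex.exp (Z T ω * Complex.I) ∂P)
      - ((Real.exp (-(V T) / 2) : ℝ) : ℂ)) atTop (𝓝 0) :=
    squeeze_zero_norm' ((eventually_ge_atTop 1).mono hbound) hzero
  have h2 : Tendsto (fun T => ((Real.exp (-(V T) / 2) : ℝ) : ℂ)) atTop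
      (𝓝 ((Real.exp (-transitionCov p ν f f / 2) : ℝ) : ℂ)) :=
    (Complex.continuous_ofReal.tendsto _).comp
      ((Real.continuous_exp.tendsto _).comp (hV.neg.div_const 2))
  simpa using h1.add h2

end Asymptotics

/-! ### The particle system as a family of independent clusters -/

lemma IsTestFunction.abs {f : ℝ → ℝ} (hf : IsTestFunction f) : IsTestFunction fun x => |f x| where
  bounded := by simpa using hf.bounded
  piecewise_continuous := hf.piecewise_continuous.subset fun _ hx h => hx (h.abs)
  compact_support := hf.compact_support.comp_left (g := fun y => |y|) abs_zero

section System

variable {Ω : Type*} {θ : ℤ → Ω → ℕ} {ρ : ℤ → (k : ℕ) → Fin k → Ω → ℝ} {ϑ : ℤ → ℕ → ℝ≥0 → Ω → ℝ}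
  {f : ℝ → ℝ} {T : ℝ}

/-- The number of particles attached to the integer `j`, together with all their potential
initial positions. -/
def initialData (θ : ℤ → Ω → ℕ) (ρ : ℤ → (k : ℕ) → Fin k → Ω → ℝ) (j : ℤ) (ω : Ω) :
    ℕ × ((k : ℕ) → Fin k → ℝ) :=
  (θ j ω, fun k n => ρ j k n ω)

/-- The positions at time `1` of the motions attached to the integer `j`. -/
def displacement (ϑ : ℤ → ℕ → ℝ≥0 → Ω → ℝ) (j : ℤ) (ω : Ω) (n : ℕ) : ℝ := ϑ j n 1 ω

lemma lintegral_empirical (hf : Measurable f) (h0 : ∀ x, 0 ≤ f x) (T : ℝ) (ω : Ω) :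
    ∫⁻ x, ENNReal.ofReal (f x) ∂(empirical θ ρ ϑ T 1 ω)
      = ∑' j, ENNReal.ofReal (clusterSum T f (initialData θ ρ j ω) (displacement ϑ j ω)) := by
  rw [empirical, lintegral_sum_measure]
  refine tsum_congr fun j => ?_
  rw [lintegral_finsetSum_measure, clusterSum, ENNReal.ofReal_sum_of_nonneg fun n _ => h0 _]
  refine Finset.sum_congr rfl fun n _ => ?_
  rw [lintegral_dirac' _ hf.ennreal_ofReal]
  rfl

lemma hasSum_clusterSum_empiricalPairing (hf : Measurable f) {ω : Ω}
    (h : Integrable f (empirical θ ρ ϑ T 1 ω)) :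
    HasSum (fun j => clusterSum T f (initialData θ ρ j ω) (displacement ϑ j ω))
      (empiricalPairing θ ρ ϑ T 1 f ω) := by
  refine (hasSum_integral_measure h).congr_fun fun j => ?_
  rw [integral_finsetSum_measure]
  · simp only [integral_dirac' _ _ hf.stronglyMeasurable]
    rfl
  · exact fun n _ => integrable_dirac' hf.stronglyMeasurable (by simp)

variable [MeasurableSpace Ω] {P : Measure Ω} {α : ℝ} {p : PMF ℕ}

lemma IsStableLevy.charFun_one {L : ℝ≥0 → Ω → ℝ} (h : IsStableLevy α L P) (u : ℝ) :
    charFun (P.map (L 1)) u = ((Real.exp (-(1 * |u| ^ α)) : ℝ) : ℂ) := by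
  have h1 := h.charFun_increment 0 1 zero_le_one u
  have h2 : (fun ω => L 1 ω - L 0 ω) =ᵐ[P] L 1 := by
    filter_upwards [h.zero] with ω hω
    rw [hω, sub_zero]
  rw [Measure.map_congr h2] at h1
  simpa using h1

namespace IsParticleSystem

lemma measurable_initialData (h : IsParticleSystem α p θ ρ ϑ P) (j : ℤ) :
    Measurable (initialData θ ρ j) :=
  (h.measurable_number j).prodMk
    (measurable_pi_iff.2 fun k => measurable_pi_iff.2 fun n => h.measurable_position j k n)

lemma measurable_displacement (h : IsParticleSystem α p θ ρ ϑ P) (j : ℤ) :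
    Measurable (displacement ϑ j) :=
  measurable_pi_iff.2 fun n => (h.levy j n).measurable 1

lemma measurable_clusterSum (h : IsParticleSystem α p θ ρ ϑ P) (hf : Measurable f) (T : ℝ)
    (j : ℤ) : Measurable fun ω => clusterSum T f (initialData θ ρ j ω) (displacement ϑ j ω) :=
  (DensityProcess.measurable_clusterSum T hf).comp
    ((h.measurable_initialData j).prodMk (h.measurable_displacement j))

lemma iIndepFun_displacement_one (h : IsParticleSystem α p θ ρ ϑ P) :
    iIndepFun (fun (q : ℤ × ℕ) ω => ϑ q.1 q.2 1 ω) P :=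
  h.indep_motion.comp (fun _ x => x 1) fun _ => measurable_pi_apply 1

lemma measurable_lintegral_empirical (h : IsParticleSystem α p θ ρ ϑ P) (hf : Measurable f)
    (h0 : ∀ x, 0 ≤ f x) (T : ℝ) :
    Measurable fun ω => ∫⁻ x, ENNReal.ofReal (f x) ∂(empirical θ ρ ϑ T 1 ω) := by
  simp_rw [lintegral_empirical hf h0]
  exact Measurable.tsum fun j => (h.measurable_clusterSum hf T j).ennreal_ofReal

/-- Measurability holds for every `T`, also where the series of the contributions need not converge:
there the pairing is the junk value `0` of the integral, and the set of those `ω` is measurable. -/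
lemma measurable_empiricalPairing (h : IsParticleSystem α p θ ρ ϑ P) (hf : Measurable f) (T : ℝ) :
    Measurable (empiricalPairing θ ρ ϑ T 1 f) := by
  classical
  have hA : MeasurableSet {ω | Integrable f (empirical θ ρ ϑ T 1 ω)} := by
    have h1 : {ω | Integrable f (empirical θ ρ ϑ T 1 ω)}
        = {ω | ∫⁻ x, ENNReal.ofReal |f x| ∂(empirical θ ρ ϑ T 1 ω) < ⊤} := by
      ext ω
      simp [Integrable, hf.aestronglyMeasurable, hasFiniteIntegral_iff_norm]
    rw [h1]
    exact measurableSet_lt (h.measurable_lintegral_empirical hf.abs (fun x => abs_nonneg _) T)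
      measurable_const
  have hp := h.measurable_lintegral_empirical (hf.max measurable_const) (f := fun x => max (f x) 0)
    (fun x => le_max_right _ _) T
  have hn := h.measurable_lintegral_empirical (hf.neg.max measurable_const)
    (f := fun x => max (-f x) 0) (fun x => le_max_right _ _) T
  have h2 : empiricalPairing θ ρ ϑ T 1 f = fun ω => if Integrable f (empirical θ ρ ϑ T 1 ω) then
      (∫⁻ x, ENNReal.ofReal (max (f x) 0) ∂(empirical θ ρ ϑ T 1 ω)).toReal
        - (∫⁻ x, ENNReal.ofReal (max (-f x) 0) ∂(empirical θ ρ ϑ T 1 ω)).toReal else 0 := by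
    ext ω
    split_ifs with hi
    · simp only [ENNReal.ofReal_max, ENNReal.ofReal_zero, zero_le, sup_of_le_left]
      exact integral_eq_lintegral_pos_part_sub_lintegral_neg_part hi
    · exact integral_undef hi
  rw [h2]
  exact Measurable.ite hA (hp.ennreal_toReal.sub hn.ennreal_toReal) measurable_const

variable [IsProbabilityMeasure P]

lemma isCluster (h : IsParticleSystem α p θ ρ ϑ P) (j : ℤ) :
    IsCluster j p (P.map (ϑ 0 0 1)) (initialData θ ρ j) (displacement ϑ j) P where
  measurable_initial := h.measurable_initialData j
  measurable_motion := h.measurable_displacement j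
  law_number := h.law_number j
  position_mem ω k n := h.position_mem j k n ω
  -- all the displacements have the characteristic function of `ϑ 0 0 1`
  law_motion n := by
    have h1 : ∀ j n, IsProbabilityMeasure (P.map (ϑ j n 1)) := fun j n =>
      Measure.isProbabilityMeasure_map ((h.levy j n).measurable 1).aemeasurable
    have h2 : P.map (ϑ j n 1) = P.map (ϑ 0 0 1) := by
      refine Measure.ext_of_charFun ?_
      ext u
      rw [(h.levy j n).charFun_one, (h.levy 0 0).charFun_one]
    exact h2
  indep_motion := h.iIndepFun_displacement_one.precomp (g := fun n : ℕ => (j, n))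
    fun _ _ hn => (Prod.mk.inj hn).2
  indep := h.indep_initial_motion.comp
    (φ := fun x : ℤ → ℕ × ((k : ℕ) → Fin k → ℝ) => x j)
    (ψ := fun (x : ℤ × ℕ → ℝ≥0 → ℝ) (n : ℕ) => x (j, n) 1)
    (measurable_pi_apply j) (measurable_pi_iff.2 fun n =>
      (measurable_pi_apply 1).comp (measurable_pi_apply (j, n)))

lemma iIndepFun_initialData_displacement (h : IsParticleSystem α p θ ρ ϑ P) :
    iIndepFun (fun j ω => (initialData θ ρ j ω, displacement ϑ j ω)) P := by
  refine iIndepFun_prodMk_of_indepFun h.measurable_initialData h.measurable_displacement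
    h.indep_initial ?_ ?_
  · exact iIndepFun_curry (X := fun (q : ℤ × ℕ) ω => ϑ q.1 q.2 1 ω)
      (fun q => (h.levy q.1 q.2).measurable 1) h.iIndepFun_displacement_one
  · exact h.indep_initial_motion.comp (φ := id)
      (ψ := fun (x : ℤ × ℕ → ℝ≥0 → ℝ) (j : ℤ) (n : ℕ) => x (j, n) 1)
      measurable_id (measurable_pi_iff.2 fun j => measurable_pi_iff.2 fun n =>
        (measurable_pi_apply 1).comp (measurable_pi_apply (j, n)))

lemma lintegral_lintegral_empirical_lt_top (h : IsParticleSystem α p θ ρ ϑ P)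
    (hf : IsTestFunction f) (hT : 0 < T) :
    ∫⁻ ω, ∫⁻ x, ENNReal.ofReal |f x| ∂(empirical θ ρ ϑ T 1 ω) ∂P < ⊤ := by
  have hν : IsProbabilityMeasure (P.map (ϑ 0 0 1)) :=
    Measure.isProbabilityMeasure_map ((h.levy 0 0).measurable 1).aemeasurable
  have hs := summable_integral_abs_clusterSum h.isCluster h.third_moment hf.abs hT
  have h1 : ∀ j ω, 0 ≤ clusterSum T (fun x => |f x|) (initialData θ ρ j ω) (displacement ϑ j ω) :=
    fun j ω => Finset.sum_nonneg fun n _ => abs_nonneg _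
  simp_rw [abs_of_nonneg (h1 _ _)] at hs
  simp_rw [lintegral_empirical hf.measurable.abs fun x => abs_nonneg (f x)]
  rw [lintegral_tsum fun j =>
    (h.measurable_clusterSum hf.measurable.abs T j).ennreal_ofReal.aemeasurable]
  convert! hs.tsum_ofReal_lt_top with j
  rw [ofReal_integral_eq_lintegral_ofReal _ (ae_of_all _ (h1 j))]
  exact (h.isCluster j).integrable_clusterSum h.third_moment hf.abs.isBddIntegrable T

lemma ae_integrable_empirical (h : IsParticleSystem α p θ ρ ϑ P)
    (hf : IsTestFunction f) (hT : 0 < T) : ∀ᵐ ω ∂P, Integrable f (empirical θ ρ ϑ T 1 ω) := by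
  filter_upwards [ae_lt_top (h.measurable_lintegral_empirical hf.measurable.abs
    (fun x => abs_nonneg _) T) (h.lintegral_lintegral_empirical_lt_top hf hT).ne] with ω hω
  exact ⟨hf.measurable.aestronglyMeasurable, hasFiniteIntegral_iff_norm _ |>.2 hω⟩

lemma integrable_empiricalPairing (h : IsParticleSystem α p θ ρ ϑ P)
    (hf : IsTestFunction f) (hT : 0 < T) : Integrable (empiricalPairing θ ρ ϑ T 1 f) P := by
  refine ⟨(h.measurable_empiricalPairing hf.measurable T).aestronglyMeasurable, ?_⟩
  refine (lintegral_mono fun ω => ?_).trans_lt (h.lintegral_lintegral_empirical_lt_top hf hT)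
  refine (enorm_integral_le_lintegral_enorm _).trans_eq ?_
  simp_rw [Real.enorm_eq_ofReal_abs]

end IsParticleSystem

end System

/-! ### Convergence of the finite-dimensional distributions -/

namespace IsParticleSystem

variable {Ω : Type*} {θ : ℤ → Ω → ℕ} {ρ : ℤ → (k : ℕ) → Fin k → Ω → ℝ} {ϑ : ℤ → ℕ → ℝ≥0 → Ω → ℝ}
  [MeasurableSpace Ω] {P : Measure Ω} {α : ℝ} {p : PMF ℕ}
  {f : ℝ → ℝ} {T : ℝ}

lemma measurable_fluctuation (h : IsParticleSystem α p θ ρ ϑ P) (hf : IsTestFunction f) (T : ℝ) :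
    Measurable (fluctuation θ ρ ϑ P T 1 f) :=
  ((h.measurable_empiricalPairing hf.measurable T).sub_const _).div_const _

variable [IsProbabilityMeasure P]

lemma hasSum_integral_clusterSum (h : IsParticleSystem α p θ ρ ϑ P) (hf : IsTestFunction f)
    (hT : 0 < T) :
    HasSum (fun j => ∫ ω, clusterSum T f (initialData θ ρ j ω) (displacement ϑ j ω) ∂P)
      (∫ ω, empiricalPairing θ ρ ϑ T 1 f ω ∂P) := by
  have hν : IsProbabilityMeasure (P.map (ϑ 0 0 1)) :=
    Measure.isProbabilityMeasure_map ((h.levy 0 0).measurable 1).aemeasurable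
  have h1 := hasSum_integral_of_summable_integral_norm
    (fun j => (h.isCluster j).integrable_clusterSum h.third_moment hf.isBddIntegrable T)
    (summable_integral_abs_clusterSum h.isCluster h.third_moment hf hT)
  convert! h1 using 1
  refine integral_congr_ae ?_
  filter_upwards [h.ae_integrable_empirical hf hT] with ω hω
  exact (hasSum_clusterSum_empiricalPairing hf.measurable hω).tsum_eq.symm

lemma ae_hasSum_fluctuation (h : IsParticleSystem α p θ ρ ϑ P) (hf : IsTestFunction f)
    (hT : 0 < T) :
    ∀ᵐ ω ∂P, HasSum (fun j => (clusterSum T f (initialData θ ρ j ω) (displacement ϑ j ω)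
        - ∫ ω', clusterSum T f (initialData θ ρ j ω') (displacement ϑ j ω') ∂P) / √T)
      (fluctuation θ ρ ϑ P T 1 f ω) := by
  filter_upwards [h.ae_integrable_empirical hf hT] with ω hω
  exact ((hasSum_clusterSum_empiricalPairing hf.measurable hω).sub
    (h.hasSum_integral_clusterSum hf hT)).div_const _

/-- Convergence of the characteristic functions of the finite-dimensional distributions, by the
Cramér-Wold device: a linear combination of the pairings is the pairing with the linear
combination of the test functions. -/
lemma tendsto_integral_cexp_fluctuation (h : IsParticleSystem α p θ ρ ϑ P) (hα : 0 < α)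
    {ι : Type*} [Fintype ι] (c : ι → ℝ) {ψ : ι → ℝ → ℝ} (hψ : ∀ i, IsTestFunction (ψ i)) :
    Tendsto (fun T => ∫ ω, Complex.exp
        ((∑ i, c i * fluctuation θ ρ ϑ P T 1 (ψ i) ω : ℝ) * Complex.I) ∂P) atTop
      (𝓝 ((Real.exp (-(∑ i, ∑ j, c i * c j * transitionCov p (P.map (ϑ 0 0 1)) (ψ i) (ψ j)) / 2) :
        ℝ) : ℂ)) := by
  have hν : IsProbabilityMeasure (P.map (ϑ 0 0 1)) :=
    Measure.isProbabilityMeasure_map ((h.levy 0 0).measurable 1).aemeasurable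
  have hν0 := nullSingletonClass_of_charFun hα one_pos _ (h.levy 0 0).charFun_one
  rw [← transitionCov_sum Finset.univ c fun i => (hψ i).isBddIntegrable]
  refine tendsto_integral_cexp_hasSum_clusterSum h.isCluster h.iIndepFun_initialData_displacement
    h.third_moment (IsTestFunction.sum_mul Finset.univ c hψ) fun T hT => ?_
  have hS : ∀ i j, Integrable
      (fun ω => clusterSum T (ψ i) (initialData θ ρ j ω) (displacement ϑ j ω)) P := fun i j =>
    (h.isCluster j).integrable_clusterSum h.third_moment (hψ i).isBddIntegrable T
  have hlin : ∀ x m, clusterSum T (fun y => ∑ i, c i * ψ i y) x m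
      = ∑ i, c i * clusterSum T (ψ i) x m := by
    intro x m
    simp only [clusterSum, Finset.mul_sum]
    exact Finset.sum_comm
  filter_upwards [ae_all_iff.2 fun i => h.ae_hasSum_fluctuation (hψ i) hT] with ω hω
  refine (hasSum_sum fun i (_ : i ∈ Finset.univ) => (hω i).mul_left (c i)).congr_fun fun j => ?_
  simp_rw [hlin]
  rw [integral_finsetSum _ fun i _ => (hS i j).const_mul (c i), ← Finset.sum_sub_distrib,
    Finset.sum_div]
  refine Finset.sum_congr rfl fun i _ => ?_
  rw [integral_const_mul]
  ring

theorem fddTendsto_fluctuation (h : IsParticleSystem α p θ ρ ϑ P) (hα : 0 < α) {S : Type*}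
    {ψ : S → ℝ → ℝ} (hψ : ∀ s, IsTestFunction (ψ s)) {Ω' : Type*} [MeasurableSpace Ω']
    {Q : Measure Ω'} [IsProbabilityMeasure Q] {ϱ : S → Ω' → ℝ}
    (hϱ : IsCenteredGaussian ϱ
      (fun s t => transitionCov p (P.map (ϑ 0 0 1)) (ψ s) (ψ t)) Q) :
    FDDTendsto (fun T s => fluctuation θ ρ ϑ P T 1 (ψ s)) ϱ P Q := by
  refine fddTendsto_of_integral_cexp
    (fun T s => (h.measurable_fluctuation (hψ s) T).aemeasurable)
    (fun s => (hϱ.memLp s).1.aemeasurable) fun I c => ?_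
  rw [hϱ.integral_cexp I c]
  exact h.tendsto_integral_cexp_fluctuation hα c fun i : I => hψ i

end IsParticleSystem

end DensityProcess

theorem proposition2p3 {Ω : Type*} [MeasurableSpace Ω] (P : Measure Ω) [IsProbabilityMeasure P]
    (α : ℝ) (hα : 0 < α) (hα' : α ≤ 2) (p : PMF ℕ)
    (θ : ℤ → Ω → ℕ) (ρ : ℤ → (k : ℕ) → Fin k → Ω → ℝ) (ϑ : ℤ → ℕ → ℝ≥0 → Ω → ℝ)
    (hsys : DensityProcess.IsParticleSystem α p θ ρ ϑ P)
    (ψ : ℝ≥0 → ℝ → ℝ) (hψ : ∀ t, DensityProcess.IsTestFunction (ψ t)) :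
    -- the pairings `⟨N_1^T, ψ_t⟩` and their expectations are well defined
    (∀ T : ℝ, 0 < T → ∀ t : ℝ≥0,
      (∀ᵐ ω ∂P, Integrable (ψ t) (DensityProcess.empirical θ ρ ϑ T 1 ω)) ∧
      Integrable (DensityProcess.empiricalPairing θ ρ ϑ T 1 (ψ t)) P) ∧
    -- there is a centered Gaussian process with the limit covariance
    (∃ (Ω' : Type) (_ : MeasurableSpace Ω') (Q : Measure Ω') (_ : IsProbabilityMeasure Q)
      (ϱ : ℝ≥0 → Ω' → ℝ),
      DensityProcess.IsCenteredGaussian ϱ (DensityProcess.limitCov α p ψ) Q) ∧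
    -- the fluctuations converge to every such process
    (∀ (Ω' : Type*) [MeasurableSpace Ω'] (Q : Measure Ω') [IsProbabilityMeasure Q]
      (ϱ : ℝ≥0 → Ω' → ℝ),
      DensityProcess.IsCenteredGaussian ϱ (DensityProcess.limitCov α p ψ) Q →
      DensityProcess.FDDTendsto
        (fun T t => DensityProcess.fluctuation θ ρ ϑ P T 1 (ψ t)) ϱ P Q) ∧
    -- for a density process `X` the extension `⟨X(1), ψ_t⟩` exists and is a.s. unique, and it is
    -- such a process, hence the limit
    (∀ (Ω' : Type*) [MeasurableSpace Ω'] (Q : Measure Ω') [IsProbabilityMeasure Q]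
      (X : ℝ≥0 → Ω' → (𝓢(ℝ, ℝ) →L[ℝ] ℝ)), DensityProcess.IsDensityProcess α p X Q →
      (∀ t, ∃ Y, DensityProcess.IsL2Pairing (X 1) (ψ t) Y Q ∧
        ∀ Y', DensityProcess.IsL2Pairing (X 1) (ψ t) Y' Q → Y' =ᵐ[Q] Y) ∧
      ∀ ϱ : ℝ≥0 → Ω' → ℝ, (∀ t, DensityProcess.IsL2Pairing (X 1) (ψ t) (ϱ t) Q) →
        DensityProcess.IsCenteredGaussian ϱ (DensityProcess.limitCov α p ψ) Q ∧
        DensityProcess.FDDTendsto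
          (fun T t => DensityProcess.fluctuation θ ρ ϑ P T 1 (ψ t)) ϱ P Q) := by
  have hν : IsProbabilityMeasure (P.map (ϑ 0 0 1)) :=
    Measure.isProbabilityMeasure_map ((hsys.levy 0 0).measurable 1).aemeasurable
  have hν1 := (hsys.levy 0 0).charFun_one
  have hb := fun t => (hψ t).isBddIntegrable
  have hcov : DensityProcess.limitCov α p ψ
      = fun s t => DensityProcess.transitionCov p (P.map (ϑ 0 0 1)) (ψ s) (ψ t) := by
    ext s t
    exact DensityProcess.limitCov_eq_transitionCov hα hν1 hb s t
  rw [hcov]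
  refine ⟨fun T hT t => ⟨hsys.ae_integrable_empirical (hψ t) hT,
    hsys.integrable_empiricalPairing (hψ t) hT⟩,
    DensityProcess.exists_isCenteredGaussian_transitionCov hb,
    fun Ω' _ Q _ ϱ hϱ => hsys.fddTendsto_fluctuation hα hψ hϱ, fun Ω' _ Q _ X hX => ⟨fun t => ?_,
    fun ϱ hϱ => ?_⟩⟩
  · obtain ⟨Y, hY⟩ := hX.exists_isL2Pairing hα hν1 (hb t).memLp_two
    exact ⟨Y, hY, fun Y' hY' => hY.ae_eq (hb t).memLp_two hX.memLp hY'⟩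
  · have hG := hX.isCenteredGaussian_of_isL2Pairing hα hν1 hb hϱ
    exact ⟨hG, hsys.fddTendsto_fluctuation hα hψ hG⟩
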